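/- **Setting.** Let $C$, $A$, $Z$ be discrete random variables with countable sets of values $\mathcal C,\mathcal A,\mathcal Z$ (covariates, treatment, mediator), and let $Y$ be a real outcome. Let $Z(\bar a)$, $Y(\bar a)$, $Y(\bar a,z)$ be potential mediators and outcomes. Assume: * *consistency*: almost surely, if $A=\bar a$ then $Y=Y(\bar a)$ and $Z=Z(\bar a)$; if $A=\bar a$ and $Z=z$ then $Y=Y(\bar a,z)$; and $Y(\bar a)=Y(\bar a,Z(\bar a))$; * *positivity*: $P(C=c,A=\bar a,Z=z)>0$ for all $c,\bar a,z$; and $Y$ and all $Y(\bar a)$ are integrable; * *back-door*: $(Y(\bar a),Y(\bar a'))\perp A\mid C$ and $Y(\bar a,z)\perp A\mid C$ for all $\bar a,\bar a',z$; * *two-door*: $Y(\bar a,z)=Y(\bar a',z)$ a.s., $Z(\bar a')\perp A\mid C$, and $Y(\bar a,z)\perp Z(\bar a')\mid A,C$ for all $\bar a,\bar a',z$. Fix $a^*,a\in\mathcal A$ and let $\theta=EY(a^*)-EY(a)$. For nuisance functions $\eta=(Q,g,\pi)$, with true value $\eta_0=(E(Y\mid z,c),\,p(z\mid \bar a,c),\,p(\bar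 a\mid c))$, and $x=(C,A,Z,Y)$, put $\varphi_{bd,td}(x,\eta,\theta)=m(x,\eta)-\theta$, where $$m(x,\eta)=(Y-Q(Z,C))\frac{g(Z|a^*,C)-g(Z|a,C)}{\sum_{\bar a}g(Z|\bar a,C)\pi(\bar a|C)}+\Big(Q(Z,C)-\sum_z Q(z,C)g(z|A,C)\Big)\frac{I(A=a^*)-I(A=a)}{\pi(A|C)}+\sum_z Q(z,C)\big(g(z|a^*,C)-g(z|a,C)\big).$$ Let $X_1,\dots,X_n$ be i.i.d. copies of $X=(C,A,Z,Y)$ with law $P$. The nuisance estimator $\hat\eta=(\hat E(Y|Z,C),\hat p(Z|A,C),\hat p(A|C))$ is a function of $X_1,\dots,X_n$ and possibly of $k_n\ge 0$ further independent observations with law $P$. Let $\hat\theta$ solve $\frac1n\sum_{i=1}^n\varphi_{bd,td}(X_i,\hat\eta,\hat\theta)=0$. **Theorem.** **(1) Consistency.** Let the working models be $\eta=\nu(\beta)$ with $\beta$ in a real normed space (for instance $\mathbb R^q$, or the space of all nuisance tables when $\mathcal A,\mathcal Z,\mathcal C$ are finite), let $\hat\eta=\nu(\hat\beta)$ with $\hat\beta\to\bar\beta$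 in probability, and let $\bar\eta=\nu(\bar\beta)=(\bar E(Y|Z,C),\bar p(Z|A,C),\bar p(A|C))$. Suppose that there are a neighbourhood $U$ of $\bar\beta$ and a function $D$ with $ED(X)<\infty$ such that, for almost every $x$, $\beta\mapsto m(x,\nu(\beta))$ is differentiable at every $\beta\in U$ with derivative of norm at most $D(x)$; that $m(X,\bar\eta)$ is integrable; and that $\sum_z|\bar E(Y|z,c)|\,|\bar p(z|\bar a,c)|<\infty$ for all $\bar a,c$. Then $\hat\theta\to\theta$ in probability if at least one of the following holds: * $\bar E(Y|Z,C)=E(Y|Z,C)$ and $\bar p(A|C)=p(A|C)$; * $\bar E(Y|Z,C)=E(Y|Z,C)$ and $\bar p(Z|A,C)=p(Z|A,C)$; * $\bar p(Z|A,C)=p(Z|A,C)$ and $\bar p(A|C)=p(A|C)$. **(2) Regularity and asymptotic linearity.** Let $\hat\eta$ be a measurable function of the data with $\hat p(\cdot|\cdot)\in[0,1]$, let $EY^2<\infty$ and $k_n=O(n)$. Write $\|f\|^2=\int f^2\,dP$ (for $f$ built from estimators, the data are held fixed). Suppose: * $\|m(X,\hat\eta)-m(X,\eta_0)\|=o_p(1)$;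 * either sample splitting is used ($\hat\eta$ depends only on the $k_n$ further observations), or, with probability tending to one, $m(\cdot,\hat\eta)$ belongs to a fixed $P$-Donsker class; * there are constants $\epsilon_i>0$ such that, $P$-almost surely, $|E(Y|Z,C)|<\epsilon_1$, $p(Z|A,C)>\epsilon_2$, $p(A|C)>\epsilon_5$ and $\sum_{\bar a}p(Z|\bar a,C)p(\bar a|C)>0$; and, with probability tending to one, $P$-almost surely $\sum_{\bar a}\hat p(Z|\bar a,C)\hat p(\bar a|C)>0$, $|\hat p(Z|\breve a,C)|<\epsilon_4$ and $\hat p(\breve a|C)>\epsilon_6$ for $\breve a\in\{a^*,a\}$; * the following are all $o_p(n^{-1/2})$, for $\breve a\in\{a^*,a\}$: $$\|\hat E(Y|Z,C)-E(Y|Z,C)\|\cdot\|\hat p(A|C)-p(A|C)\|,$$ $$\|\hat E(Y|Z,C)-E(Y|Z,C)\|\cdot\|\hat p(Z|A,C)-p(Z|A,C)\|,$$ $$\|\hat E(Y|Z,C)-E(Y|Z,C)\|\cdot\|\hat p(Z|\breve a,C)-p(Z|\breve a,C)\|,$$ $$\|\hat p(Z|\breve a,C)-p(Z|\breve a,C)\|\cdot\|\hat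 p(\breve a|C)-p(\breve a|C)\|.$$ Then $\hat\theta$ is a regular asymptotically linear estimator of $\theta$ with influence function $\varphi_{bd,td}$. That is, $E\varphi_{bd,td}(X,\eta_0,\theta)=0$, $E\varphi_{bd,td}(X,\eta_0,\theta)^2<\infty$ and $$\sqrt n(\hat\theta-\theta)=\frac1{\sqrt n}\sum_{i=1}^n\varphi_{bd,td}(X_i,\eta_0,\theta)+o_p(1);$$ and there is a probability law $L$ on $\mathbb R$ such that, for every regular finite-dimensional parametric submodel $(P_\alpha)$ through $P=P_0$ and all $\alpha_n\to 0$ with $\sqrt n\|\alpha_n\|$ bounded, $\sqrt n(\hat\theta-\theta(\alpha_n))$ converges in distribution to $L$ when all observations are i.i.d. from $P_{\alpha_n}$. Here a submodel is regular if, for $\alpha$ near $0$, $P_\alpha$ is the observed-data law of a model satisfying the assumptions of the setting, with average causal effect $\theta(\alpha)$; the $P_\alpha$ are dominated and differentiable in quadratic mean at $\alpha=0$; and, uniformly for $\alpha$ near $0$, $p_\alpha(z|\bar a,c)$ and $p_\alpha(\bar a|c)$ are bounded away from $0$ and $E_\alpha Y^2$ is bounded. -/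

import Mathlib

open MeasureTheory ProbabilityTheory Filter Topology
open scoped ENNReal NNReal

/-! ### Potential-outcome models -/

/-- An observation `x = (c, a, z, y)`: covariates, treatment, mediator, outcome. -/
abbrev Obs (𝒜 𝒵 𝒞 : Type*) := 𝒞 × 𝒜 × 𝒵 × ℝ

/-- A probability space carrying the covariates `C`, the treatment `A`, the potential mediators
`Z(a)`, the potential outcomes `Y(a)` and `Y(a, z)`, the observed mediator and outcome. -/
structure CausalModel (𝒜 𝒵 𝒞 : Type*) [MeasurableSpace 𝒜] [MeasurableSpace 𝒵]
    [MeasurableSpace 𝒞] where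
  Ω : Type*
  mΩ : MeasurableSpace Ω
  prob : Measure Ω
  isProb : IsProbabilityMeasure prob
  C : Ω → 𝒞
  A : Ω → 𝒜
  Zpot : 𝒜 → Ω → 𝒵
  Ypot : 𝒜 → Ω → ℝ
  Ypot₂ : 𝒜 → 𝒵 → Ω → ℝ
  Z : Ω → 𝒵
  Y : Ω → ℝ
  measurable_C : Measurable C
  measurable_A : Measurable A
  measurable_Zpot : ∀ a, Measurable (Zpot a)
  measurable_Ypot : ∀ a, Measurable (Ypot a)
  measurable_Ypot₂ : ∀ a z, Measurable (Ypot₂ a z)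
  measurable_Z : Measurable Z
  measurable_Y : Measurable Y

namespace CausalModel

attribute [instance] CausalModel.mΩ CausalModel.isProb

variable {𝒜 𝒵 𝒞 : Type*} [MeasurableSpace 𝒜] [MeasurableSpace 𝒵] [MeasurableSpace 𝒞]

/-- Consistency of the potential outcomes with the observed variables, and the composition rule
`Y(a) = Y(a, Z(a))`. -/
structure Consistency (M : CausalModel 𝒜 𝒵 𝒞) : Prop where
  outcome : ∀ a, ∀ᵐ ω ∂M.prob, M.A ω = a → M.Y ω = M.Ypot a ω
  mediator : ∀ a, ∀ᵐ ω ∂M.prob, M.A ω = a → M.Z ω = M.Zpot a ω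
  outcome₂ : ∀ a z, ∀ᵐ ω ∂M.prob, M.A ω = a → M.Z ω = z → M.Y ω = M.Ypot₂ a z ω
  composition : ∀ a, ∀ᵐ ω ∂M.prob, M.Ypot a ω = M.Ypot₂ a (M.Zpot a ω) ω

/-- Back-door assumption: given `C`, the treatment is independent of `(Y(a), Y(a'))` and of
`Y(a, z)`. All conditioning variables are discrete, so conditional independence is independence
under the elementary conditional measures. -/
structure BackDoor (M : CausalModel 𝒜 𝒵 𝒞) : Prop where
  pair : ∀ a a' c, M.prob {ω | M.C ω = c} ≠ 0 →
    IndepFun (fun ω => (M.Ypot a ω, M.Ypot a' ω)) M.A (ProbabilityTheory.cond M.prob {ω | M.C ω = c})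
  joint : ∀ a z c, M.prob {ω | M.C ω = c} ≠ 0 →
    IndepFun (M.Ypot₂ a z) M.A (ProbabilityTheory.cond M.prob {ω | M.C ω = c})

/-- Two-door assumption. -/
structure TwoDoor (M : CausalModel 𝒜 𝒵 𝒞) : Prop where
  exclusion : ∀ a a' z, ∀ᵐ ω ∂M.prob, M.Ypot₂ a z ω = M.Ypot₂ a' z ω
  mediator : ∀ a' c, M.prob {ω | M.C ω = c} ≠ 0 →
    IndepFun (M.Zpot a') M.A (ProbabilityTheory.cond M.prob {ω | M.C ω = c})
  outcome : ∀ a a' z b c, M.prob {ω | M.A ω = b ∧ M.C ω = c} ≠ 0 →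
    IndepFun (M.Ypot₂ a z) (M.Zpot a') (ProbabilityTheory.cond M.prob {ω | M.A ω = b ∧ M.C ω = c})

/-- The model: consistency, positivity, integrable outcomes, back-door and two-door. -/
structure IsBDTD (M : CausalModel 𝒜 𝒵 𝒞) : Prop where
  consistency : M.Consistency
  positivity : ∀ c a z, 0 < M.prob {ω | M.C ω = c ∧ M.A ω = a ∧ M.Z ω = z}
  integrable_Y : Integrable M.Y M.prob
  integrable_Ypot : ∀ a, Integrable (M.Ypot a) M.prob
  backDoor : M.BackDoor
  twoDoor : M.TwoDoor

/-- The average causal effect `E Y(a*) - E Y(a)`. -/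
noncomputable def ace (M : CausalModel 𝒜 𝒵 𝒞) (aStar a : 𝒜) : ℝ :=
  (∫ ω, M.Ypot aStar ω ∂M.prob) - ∫ ω, M.Ypot a ω ∂M.prob

/-- The law of the observed data `(C, A, Z, Y)`. -/
noncomputable def obsLaw (M : CausalModel 𝒜 𝒵 𝒞) : Measure (Obs 𝒜 𝒵 𝒞) :=
  M.prob.map fun ω => (M.C ω, M.A ω, M.Z ω, M.Y ω)

end CausalModel

/-! ### Nuisance functions, the influence function -/

/-- Values for the nuisance functions: `outcome z c` for `E(Y | z, c)`, `mediator z a c` for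
`p(z | a, c)`, `treatment a c` for `p(a | c)`. -/
@[ext] structure Nuisance (𝒜 𝒵 𝒞 : Type*) where
  outcome : 𝒵 → 𝒞 → ℝ
  mediator : 𝒵 → 𝒜 → 𝒞 → ℝ
  treatment : 𝒜 → 𝒞 → ℝ

section nuisance

variable {𝒜 𝒵 𝒞 : Type*}

/-- The true nuisance functions under the observed-data law `P`. -/
noncomputable def trueNuisance [MeasurableSpace 𝒜] [MeasurableSpace 𝒵] [MeasurableSpace 𝒞]
    (P : Measure (Obs 𝒜 𝒵 𝒞)) : Nuisance 𝒜 𝒵 𝒞 where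
  outcome z c := ∫ x, x.2.2.2 ∂(ProbabilityTheory.cond P {x | x.2.2.1 = z ∧ x.1 = c})
  mediator z a c := (ProbabilityTheory.cond P {x | x.2.1 = a ∧ x.1 = c}).real {x | x.2.2.1 = z}
  treatment a c := (ProbabilityTheory.cond P {x | x.1 = c}).real {x | x.2.1 = a}

/-- The indicator `I(a' = a)`. -/
noncomputable def ind (a a' : 𝒜) : ℝ := Set.indicator {a} (fun _ => (1 : ℝ)) a'

/-- `m_{bd,td}(x, η) = φ_{bd,td}(x, η, θ) + θ`. -/
noncomputable def mBDTD (aStar a : 𝒜) (η : Nuisance 𝒜 𝒵 𝒞) : Obs 𝒜 𝒵 𝒞 → ℝ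
  | (C, A, Z, Y) =>
    (Y - η.outcome Z C) * ((η.mediator Z aStar C - η.mediator Z a C) /
        ∑' b, η.mediator Z b C * η.treatment b C)
      + (η.outcome Z C - ∑' z, η.outcome z C * η.mediator z A C) *
          ((ind aStar A - ind a A) / η.treatment A C)
      + ∑' z, η.outcome z C * (η.mediator z aStar C - η.mediator z a C)

/-- The influence function `φ_{bd,td}(x, η, θ)`. -/
noncomputable def phiBDTD (aStar a : 𝒜) (η : Nuisance 𝒜 𝒵 𝒞) (θ : ℝ) (x : Obs 𝒜 𝒵 𝒞) : ℝ :=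
  mBDTD aStar a η x - θ

end nuisance

/-! ### Samples and stochastic order -/

/-- The data: a sample of size `n` over which the estimating equation is averaged, and a further
sample of size `k` (possibly `k = 0`) that may be used to estimate the nuisance functions. -/
abbrev Sample (X : Type*) (n k : ℕ) := (Fin n → X) × (Fin k → X)

/-- The law of the data when all `n + k` observations are i.i.d. with law `P`. -/
noncomputable def sampleLaw {X : Type*} [MeasurableSpace X] (P : Measure X) (n k : ℕ) :
    Measure (Sample X n k) :=
  (Measure.pi fun _ : Fin n => P).prod (Measure.pi fun _ : Fin k => P)

/-- `R n = o_p(1)`, for nonnegative extended-real `R n` defined on probability spaces that may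
change with `n`. -/
def IsLittleOP {S : ℕ → Type*} [∀ n, MeasurableSpace (S n)] (μ : ∀ n, Measure (S n))
    (R : ∀ n, S n → ℝ≥0∞) : Prop :=
  ∀ ε : ℝ≥0∞, 0 < ε → Tendsto (fun n => μ n {w | ε ≤ R n w}) atTop (𝓝 0)

/-- The event `p n` has probability at least `1 - δ n` with `δ n → 0`. -/
def WithProbToOne {S : ℕ → Type*} [∀ n, MeasurableSpace (S n)] (μ : ∀ n, Measure (S n))
    (p : ∀ n, S n → Prop) : Prop :=
  Tendsto (fun n => μ n {w | ¬ p n w}) atTop (𝓝 0)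

/-! ### Donsker classes -/

section donsker

/-- The Banach space `ℓ^∞(ι)` of bounded real functions on `ι`, with its Borel σ-algebra. -/
abbrev EllInf (ι : Type*) := lp (fun _ : ι => ℝ) ∞

noncomputable instance EllInf.measurableSpace (ι : Type*) : MeasurableSpace (EllInf ι) := borel _

instance EllInf.borelSpace (ι : Type*) : BorelSpace (EllInf ι) := ⟨rfl⟩

/-- Outer expectation. -/
noncomputable def outerExp {α : Type*} [MeasurableSpace α] (μ : Measure α) (f : α → ℝ≥0∞) :
    ℝ≥0∞ :=
  ⨅ (g : α → ℝ≥0∞) (_ : Measurable g) (_ : f ≤ g), ∫⁻ x, g x ∂μ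

/-- `𝓕` is a `P`-Donsker class: the empirical processes `G n` converge weakly in `ℓ^∞(𝓕)`, in the
sense of outer expectations of nonnegative bounded continuous functions, to a tight centred
Gaussian process with the covariance of the `P`-Brownian bridge, whose sample paths are almost
surely uniformly continuous for the standard-deviation metric. -/
def IsDonsker {X : Type*} [MeasurableSpace X] (P : Measure X) (𝓕 : Set (X → ℝ)) : Prop :=
  (∀ f ∈ 𝓕, Measurable f ∧ MemLp f 2 P) ∧
  ∃ G : ∀ n : ℕ, (Fin n → X) → EllInf 𝓕,
    (∀ n w (f : 𝓕), G n w f = (√(n : ℝ))⁻¹ * ∑ i, (f.1 (w i) - ∫ x, f.1 x ∂P)) ∧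
    ∃ μ : Measure (EllInf 𝓕), IsProbabilityMeasure μ ∧
      (∀ (s : Finset 𝓕) (b : 𝓕 → ℝ),
        μ.map (fun z : EllInf 𝓕 => ∑ f ∈ s, b f * z f) =
          gaussianReal 0 (variance (fun x => ∑ f ∈ s, b f * f.1 x) P).toNNReal) ∧
      (∀ ε : ℝ≥0∞, 0 < ε → ∃ K : Set (EllInf 𝓕), IsCompact K ∧ μ Kᶜ ≤ ε) ∧
      (∀ᵐ z ∂μ, ∀ ε : ℝ, 0 < ε → ∃ δ : ℝ, 0 < δ ∧ ∀ f g : 𝓕,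
        √(variance (fun x => f.1 x - g.1 x) P) < δ → |z f - z g| < ε) ∧
      ∀ h : EllInf 𝓕 → ℝ≥0, Continuous h → (∃ K, ∀ z, h z ≤ K) →
        Tendsto (fun n => outerExp (Measure.pi fun _ : Fin n => P) (fun w => (h (G n w) : ℝ≥0∞)))
          atTop (𝓝 (∫⁻ z, (h z : ℝ≥0∞) ∂μ))

end donsker

/-! ### Regular submodels, regular and asymptotically linear estimators -/

section regular

universe uA uZ uC uΩ

variable {𝒜 : Type uA} {𝒵 : Type uZ} {𝒞 : Type uC}
  [MeasurableSpace 𝒜] [MeasurableSpace 𝒵] [MeasurableSpace 𝒞]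

/-- `F` is a regular `d`-dimensional parametric submodel through the observed-data law of `M`:
near `0` all `F α` satisfy the back-door and two-door model; the observed-data laws are dominated
and differentiable in quadratic mean at `0`, with score `S`; and, locally uniformly in `α`, the
conditional probabilities are bounded away from `0` and `Y` has bounded second moment. -/
structure IsRegularSubmodel (M : CausalModel.{uA, uZ, uC, uΩ} 𝒜 𝒵 𝒞) {d : ℕ}
    (F : EuclideanSpace ℝ (Fin d) → CausalModel.{uA, uZ, uC, uΩ} 𝒜 𝒵 𝒞) : Prop where
  through : (F 0).obsLaw = M.obsLaw
  model : ∀ᶠ α in 𝓝 0, (F α).IsBDTD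
  qmd : ∃ (μ : Measure (Obs 𝒜 𝒵 𝒞)) (p : EuclideanSpace ℝ (Fin d) → Obs 𝒜 𝒵 𝒞 → ℝ)
      (S : Obs 𝒜 𝒵 𝒞 → EuclideanSpace ℝ (Fin d)),
    SigmaFinite μ ∧ Measurable S ∧ (∀ α, Measurable (p α)) ∧ (∀ α x, 0 ≤ p α x) ∧
    (∀ᶠ α in 𝓝 0, (F α).obsLaw = μ.withDensity fun x => ENNReal.ofReal (p α x)) ∧
    Tendsto (fun α => (∫⁻ x, ENNReal.ofReal
        ((√(p α x) - √(p 0 x) - 1 / 2 * inner ℝ α (S x) * √(p 0 x)) ^ 2) ∂μ) /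
          ENNReal.ofReal (‖α‖ ^ 2))
      (𝓝[≠] 0) (𝓝 0)
  overlap : ∃ ε : ℝ, 0 < ε ∧ ∀ᶠ α in 𝓝 0, ∀ z a c,
    ε ≤ (trueNuisance (F α).obsLaw).mediator z a c ∧ ε ≤ (trueNuisance (F α).obsLaw).treatment a c
  moment : ∃ K : ℝ≥0, ∀ᶠ α in 𝓝 0, ∫⁻ x, ‖x.2.2.2‖ₑ ^ 2 ∂(F α).obsLaw ≤ K

/-- Regular estimators of the average causal effect: along every regular parametric submodel and
every local sequence `α n` with `√n α n` bounded, the law of `√n (θ̂ n - θ(α n))` under `α n`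
converges weakly, to a limit that depends neither on the submodel nor on the sequence. -/
def IsRegularEstimator (M : CausalModel.{uA, uZ, uC, uΩ} 𝒜 𝒵 𝒞) (aStar a : 𝒜) (k : ℕ → ℕ)
    (θhat : ∀ n, Sample (Obs 𝒜 𝒵 𝒞) n (k n) → ℝ) : Prop :=
  ∃ L : Measure ℝ, IsProbabilityMeasure L ∧
    ∀ (d : ℕ) (F : EuclideanSpace ℝ (Fin d) → CausalModel.{uA, uZ, uC, uΩ} 𝒜 𝒵 𝒞), IsRegularSubmodel M F →
    ∀ α : ℕ → EuclideanSpace ℝ (Fin d), (∃ B : ℝ, ∀ n : ℕ, √(n : ℝ) * ‖α n‖ ≤ B) →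
    Tendsto α atTop (𝓝 0) →
    ∀ f : BoundedContinuousFunction ℝ ℝ,
      Tendsto (fun n => ∫ w, f (√(n : ℝ) * (θhat n w - (F (α n)).ace aStar a))
          ∂(sampleLaw (F (α n)).obsLaw n (k n)))
        atTop (𝓝 (∫ u, f u ∂L))

/-- `θ̂` is an asymptotically linear estimator of `θ` with influence function `φ` under `P`. -/
structure IsAsymptoticallyLinear {X : Type*} [MeasurableSpace X] (P : Measure X) (θ : ℝ)
    (φ : X → ℝ) (k : ℕ → ℕ) (θhat : ∀ n, Sample X n (k n) → ℝ) : Prop where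
  memLp : MemLp φ 2 P
  mean_zero : ∫ x, φ x ∂P = 0
  expansion : IsLittleOP (fun n => sampleLaw P n (k n)) fun n w =>
    ‖√(n : ℝ) * (θhat n w - θ) - (√(n : ℝ))⁻¹ * ∑ i, φ (w.1 i)‖ₑ

end regular

/-! ### The estimator and the assumptions of the theorem -/

section assumptions

variable {𝒜 𝒵 𝒞 : Type*} [MeasurableSpace 𝒜] [MeasurableSpace 𝒵] [MeasurableSpace 𝒞]

/-- `θ̂ n` solves the plug-in estimating equation `n⁻¹ ∑ φ_{bd,td}(Xᵢ, η̂, θ̂) = 0`. -/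
def SolvesEstimatingEquation (aStar a : 𝒜) (k : ℕ → ℕ)
    (ηhat : ∀ n, Sample (Obs 𝒜 𝒵 𝒞) n (k n) → Nuisance 𝒜 𝒵 𝒞)
    (θhat : ∀ n, Sample (Obs 𝒜 𝒵 𝒞) n (k n) → ℝ) : Prop :=
  ∀ n : ℕ, 0 < n → ∀ w, (n : ℝ)⁻¹ * ∑ i, phiBDTD aStar a (ηhat n w) (θhat n w) (w.1 i) = 0

/-- The nuisance estimators are `ν (β̂ n)`, where the working models `ν` are indexed by a normed
space, `β̂ n → β̄` in probability, and `m_{bd,td}(x, ν β)` is differentiable in `β` near `β̄` with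
derivative dominated by an integrable function of `x`. Then `ν β̄` collects the limits of the
nuisance estimators. The last two fields say that `E m_{bd,td}(X, ν β̄)` is defined. -/
structure ConsistencyConditions {E : Type*} [NormedAddCommGroup E] [NormedSpace ℝ E]
    (P : Measure (Obs 𝒜 𝒵 𝒞)) (aStar a : 𝒜) (k : ℕ → ℕ)
    (ηhat : ∀ n, Sample (Obs 𝒜 𝒵 𝒞) n (k n) → Nuisance 𝒜 𝒵 𝒞)
    (ν : E → Nuisance 𝒜 𝒵 𝒞) (βhat : ∀ n, Sample (Obs 𝒜 𝒵 𝒞) n (k n) → E) (βbar : E) : Prop where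
  estimator : ∀ n w, ηhat n w = ν (βhat n w)
  convergence : IsLittleOP (fun n => sampleLaw P n (k n)) fun n w => ‖βhat n w - βbar‖ₑ
  dominated : ∃ U ∈ 𝓝 βbar, ∃ D : Obs 𝒜 𝒵 𝒞 → ℝ, Integrable D P ∧ ∀ᵐ x ∂P, ∀ β ∈ U,
    DifferentiableAt ℝ (fun b => mBDTD aStar a (ν b) x) β ∧
      ‖fderiv ℝ (fun b => mBDTD aStar a (ν b) x) β‖ ≤ D x
  summable : ∀ b c, Summable fun z => (ν βbar).outcome z c * (ν βbar).mediator z b c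
  integrable : Integrable (mBDTD aStar a (ν βbar)) P

/-- The nuisance estimators are measurable functions of the data, and the estimated conditional
probabilities lie in `[0, 1]`. -/
structure IsNuisanceEstimator (k : ℕ → ℕ)
    (ηhat : ∀ n, Sample (Obs 𝒜 𝒵 𝒞) n (k n) → Nuisance 𝒜 𝒵 𝒞) : Prop where
  measurable_outcome : ∀ n z c, Measurable fun w => (ηhat n w).outcome z c
  measurable_mediator : ∀ n z a c, Measurable fun w => (ηhat n w).mediator z a c
  measurable_treatment : ∀ n a c, Measurable fun w => (ηhat n w).treatment a c
  mediator_mem : ∀ n w z a c, (ηhat n w).mediator z a c ∈ Set.Icc (0 : ℝ) 1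
  treatment_mem : ∀ n w a c, (ηhat n w).treatment a c ∈ Set.Icc (0 : ℝ) 1

/-- (a) `‖m(X, η̂) - m(X, η₀)‖ = o_p(1)`; (b) `η̂` is constructed by sample splitting, that is, it
does not depend on the observations over which the estimating equation is averaged, or
`m(·, η̂)` belongs to a Donsker class. -/
structure AsymptoticNormalityConditions (P : Measure (Obs 𝒜 𝒵 𝒞)) (aStar a : 𝒜) (k : ℕ → ℕ)
    (ηhat : ∀ n, Sample (Obs 𝒜 𝒵 𝒞) n (k n) → Nuisance 𝒜 𝒵 𝒞) : Prop where
  l2_consistent : IsLittleOP (fun n => sampleLaw P n (k n)) fun n w =>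
    eLpNorm (fun x => mBDTD aStar a (ηhat n w) x - mBDTD aStar a (trueNuisance P) x) 2 P
  splitting_or_donsker :
    (∀ n w w', w.2 = w'.2 → ηhat n w = ηhat n w') ∨
    ∃ 𝓕 : Set (Obs 𝒜 𝒵 𝒞 → ℝ), IsDonsker P 𝓕 ∧
      WithProbToOne (fun n => sampleLaw P n (k n)) fun n w => mBDTD aStar a (ηhat n w) ∈ 𝓕

/-- Boundedness assumptions. -/
structure BoundednessConditions (P : Measure (Obs 𝒜 𝒵 𝒞)) (aStar a : 𝒜) (k : ℕ → ℕ)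
    (ηhat : ∀ n, Sample (Obs 𝒜 𝒵 𝒞) n (k n) → Nuisance 𝒜 𝒵 𝒞) : Prop where
  outcome_bdd : ∃ ε₁ : ℝ, ∀ᵐ x ∂P, |(trueNuisance P).outcome x.2.2.1 x.1| < ε₁
  mediator_pos : ∃ ε₂ : ℝ, 0 < ε₂ ∧ ∀ᵐ x ∂P, ε₂ < (trueNuisance P).mediator x.2.2.1 x.2.1 x.1
  mix_est_pos : WithProbToOne (fun n => sampleLaw P n (k n)) fun n w => ∀ᵐ x ∂P,
    0 < ∑' b, (ηhat n w).mediator x.2.2.1 b x.1 * (ηhat n w).treatment b x.1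
  mix_pos : ∀ᵐ x ∂P,
    0 < ∑' b, (trueNuisance P).mediator x.2.2.1 b x.1 * (trueNuisance P).treatment b x.1
  mediator_est_bdd : ∀ b ∈ ({aStar, a} : Set 𝒜), ∃ ε₄ : ℝ,
    WithProbToOne (fun n => sampleLaw P n (k n)) fun n w => ∀ᵐ x ∂P,
      |(ηhat n w).mediator x.2.2.1 b x.1| < ε₄
  treatment_pos : ∃ ε₅ : ℝ, 0 < ε₅ ∧ ∀ᵐ x ∂P, ε₅ < (trueNuisance P).treatment x.2.1 x.1
  treatment_est_pos : ∀ b ∈ ({aStar, a} : Set 𝒜), ∃ ε₆ : ℝ, 0 < ε₆ ∧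
    WithProbToOne (fun n => sampleLaw P n (k n)) fun n w => ∀ᵐ x ∂P,
      ε₆ < (ηhat n w).treatment b x.1

/-- The product-rate conditions; `‖·‖` is the `L²(P)` norm, with values in `[0, ∞]`. -/
structure ProductRateConditions (P : Measure (Obs 𝒜 𝒵 𝒞)) (aStar a : 𝒜) (k : ℕ → ℕ)
    (ηhat : ∀ n, Sample (Obs 𝒜 𝒵 𝒞) n (k n) → Nuisance 𝒜 𝒵 𝒞) : Prop where
  outcome_treatment : IsLittleOP (fun n => sampleLaw P n (k n)) fun n w =>
    ENNReal.ofReal √(n : ℝ) *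
      (eLpNorm (fun x => (ηhat n w).outcome x.2.2.1 x.1
        - (trueNuisance P).outcome x.2.2.1 x.1) 2 P *
      eLpNorm (fun x => (ηhat n w).treatment x.2.1 x.1
        - (trueNuisance P).treatment x.2.1 x.1) 2 P)
  outcome_mediator : IsLittleOP (fun n => sampleLaw P n (k n)) fun n w =>
    ENNReal.ofReal √(n : ℝ) *
      (eLpNorm (fun x => (ηhat n w).outcome x.2.2.1 x.1
        - (trueNuisance P).outcome x.2.2.1 x.1) 2 P *
      eLpNorm (fun x => (ηhat n w).mediator x.2.2.1 x.2.1 x.1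
        - (trueNuisance P).mediator x.2.2.1 x.2.1 x.1) 2 P)
  outcome_mediator_at : ∀ b ∈ ({aStar, a} : Set 𝒜),
    IsLittleOP (fun n => sampleLaw P n (k n)) fun n w =>
    ENNReal.ofReal √(n : ℝ) *
      (eLpNorm (fun x => (ηhat n w).outcome x.2.2.1 x.1
        - (trueNuisance P).outcome x.2.2.1 x.1) 2 P *
      eLpNorm (fun x => (ηhat n w).mediator x.2.2.1 b x.1
        - (trueNuisance P).mediator x.2.2.1 b x.1) 2 P)
  mediator_treatment_at : ∀ b ∈ ({aStar, a} : Set 𝒜),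
    IsLittleOP (fun n => sampleLaw P n (k n)) fun n w =>
    ENNReal.ofReal √(n : ℝ) *
      (eLpNorm (fun x => (ηhat n w).mediator x.2.2.1 b x.1
        - (trueNuisance P).mediator x.2.2.1 b x.1) 2 P *
      eLpNorm (fun x => (ηhat n w).treatment b x.1
        - (trueNuisance P).treatment b x.1) 2 P)

end assumptions

/-! Identification. Given `C = c`, the back-door assumption gives E(Y(a) | c) = E(Y | a, c).
Consistency, the exclusion restriction and the independence of Y(b, z) from Z(a) and then from A
show that the mean of Y over a cell (c, a, z) is E(Y(b, z) | c) for every b. It therefore does not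
depend on a and equals E(Y | z, c). Hence E(Y(a) | c) = ∑ z, E(Y | z, c) p(z | a, c), and θ is the
mean of a contrast of these front-door means (`CausalModel.IsBDTD.ace_eq`).

Consistency. The mean of m(X, η) given C = c is computed for arbitrary nuisance values
(`setIntegral_drScore`). It equals the contrast of front-door means as soon as two of the three
components are true (`IsBDTDLaw.integral_mBDTD`). A Lipschitz bound in β and the law of large
numbers do the rest.

Asymptotic linearity. With m̂ = m(·, η̂) and m₀ = m(·, η₀), the remainder √n(θ̂ - θ) - n^{-1/2} ∑
φ(Xᵢ) is exactly √n(Pₙ - P)(m̂ - m₀) + √n(P m̂ - θ). The first term vanishes by Chebyshev's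
inequality conditionally on the auxiliary sample, or by asymptotic equicontinuity over a Donsker
class. The second is a bias in which every first-order term cancels (`abs_bias_le`); Cauchy-Schwarz
turns it into the four product rates. The lower bounds on the conditional probabilities force 𝒜 and
𝒵 to be finite and make cell masses given c comparable.

Regularity. Differentiability in quadratic mean makes the local laws contiguous to P
(`LocalDensities.contiguous`), so the linear expansion survives under them. Two facts remain: a
central limit theorem for φ under the moving laws, and θ(αₙ) - θ = ∫ φ dP_{αₙ} + o(n^{-1/2}). Both
follow from one principle (`LocalAlternatives.tendsto`): √n ∫ uₙ d(P_{αₙ} - P) → 0 whenever uₙ → 0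
under a fixed envelope. For the second fact it is applied to a score that takes its outcome
regression from P and its other nuisances from P_{αₙ}; this score is unbiased under both laws. The
limit N(0, Eφ²) involves neither the submodel nor the sequence. -/

set_option linter.unusedSectionVars false

/-! ### Integration over the fibres of a discrete random variable -/

section Discrete

variable {Ω ι : Type*} [MeasurableSpace Ω] [MeasurableSpace ι] [MeasurableSingletonClass ι]

lemma measurableSet_fiber {X : Ω → ι} (hX : Measurable X) (c : ι) :
    MeasurableSet {ω | X ω = c} := hX (measurableSet_singleton c)

lemma pairwise_disjoint_setOf_eq (X : Ω → ι) :
    Pairwise (Function.onFun Disjoint fun c => {ω | X ω = c}) := by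
  intro c d hcd
  rw [Function.onFun, Set.disjoint_left]
  rintro ω (h : X ω = c) (h' : X ω = d)
  exact hcd (h.symm.trans h')

lemma iUnion_setOf_eq (X : Ω → ι) : ⋃ c, {ω | X ω = c} = Set.univ := by
  ext ω; simp

variable [Countable ι]

lemma hasSum_setIntegral_fiber {μ : Measure Ω} {f : Ω → ℝ} (hf : Integrable f μ) {X : Ω → ι}
    (hX : Measurable X) :
    HasSum (fun c => ∫ ω in {ω | X ω = c}, f ω ∂μ) (∫ ω, f ω ∂μ) := by
  have h := hasSum_integral_iUnion (f := f) (μ := μ) (s := fun c => {ω | X ω = c})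
    (measurableSet_fiber hX) (pairwise_disjoint_setOf_eq X) hf.integrableOn
  rwa [iUnion_setOf_eq, setIntegral_univ] at h

lemma lintegral_eq_tsum_fiber {μ : Measure Ω} (f : Ω → ℝ≥0∞) {X : Ω → ι} (hX : Measurable X) :
    ∫⁻ ω, f ω ∂μ = ∑' c, ∫⁻ ω in {ω | X ω = c}, f ω ∂μ := by
  rw [← lintegral_iUnion (measurableSet_fiber hX) (pairwise_disjoint_setOf_eq X), iUnion_setOf_eq,
    Measure.restrict_univ]

lemma integrable_iff_summable_fiber {μ : Measure Ω} {f : Ω → ℝ} (hm : AEStronglyMeasurable f μ)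
    {X : Ω → ι} (hX : Measurable X) (hi : ∀ c, IntegrableOn f {ω | X ω = c} μ)
    (hs : Summable fun c => ∫ ω in {ω | X ω = c}, |f ω| ∂μ) : Integrable f μ := by
  refine ⟨hm, ?_⟩
  rw [HasFiniteIntegral, lintegral_eq_tsum_fiber _ hX]
  have : ∀ c, ∫⁻ ω in {ω | X ω = c}, ‖f ω‖ₑ ∂μ
      = ENNReal.ofReal (∫ ω in {ω | X ω = c}, |f ω| ∂μ) := by
    intro c
    rw [ofReal_integral_eq_lintegral_ofReal (hi c).abs (ae_of_all _ fun _ => abs_nonneg _)]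
    simp_rw [← Real.norm_eq_abs, ofReal_norm]
  simp_rw [this]
  exact hs.tsum_ofReal_lt_top

/-- A function of a discrete variable with the same integrals as `f` over all fibres is a version
of the conditional expectation of `f`. -/
lemma integrable_comp_of_setIntegral_fiber {μ : Measure Ω} [IsFiniteMeasure μ] {f : Ω → ℝ}
    (hf : Integrable f μ) {X : Ω → ι} (hX : Measurable X) {B : ι → ℝ}
    (h : ∀ c, ∫ ω in {ω | X ω = c}, f ω ∂μ = μ.real {ω | X ω = c} * B c) :
    Integrable (fun ω => B (X ω)) μ ∧ ∫ ω, B (X ω) ∂μ = ∫ ω, f ω ∂μ := by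
  have hconst : ∀ c, ∫ ω in {ω | X ω = c}, |B (X ω)| ∂μ = μ.real {ω | X ω = c} * |B c| := by
    intro c
    rw [setIntegral_congr_fun (measurableSet_fiber hX c)
      (g := fun _ => |B c|) (fun ω (hω : X ω = c) => by simp [hω]), setIntegral_const, smul_eq_mul]
  have hB : Measurable B := measurable_of_countable B
  have hint : Integrable (fun ω => B (X ω)) μ := by
    refine integrable_iff_summable_fiber (hB.comp hX).aestronglyMeasurable hX ?_ ?_
    · intro c
      refine (integrableOn_const (C := B c) (measure_ne_top _ _)).congr_fun ?_
        (measurableSet_fiber hX c)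
      exact fun ω (hω : X ω = c) => by simp [hω]
    -- Jensen on each fibre: the mass of the fibre times |B c| is |∫ f| over it, at most the
    -- integral of |f|, and these are summable.
    · refine Summable.of_nonneg_of_le (fun c => integral_nonneg fun _ => abs_nonneg _) ?_
        (hasSum_setIntegral_fiber hf.abs hX).summable
      intro c
      rw [hconst, ← abs_of_nonneg (measureReal_nonneg (μ := μ) (s := {ω | X ω = c})), ← abs_mul,
        ← h c]
      exact abs_integral_le_integral_abs
  refine ⟨hint, ?_⟩
  rw [← (hasSum_setIntegral_fiber hf hX).tsum_eq, ← (hasSum_setIntegral_fiber hint hX).tsum_eq]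
  congr 1
  funext c
  rw [h c, setIntegral_congr_fun (measurableSet_fiber hX c)
      (g := fun _ => B c) (fun ω (hω : X ω = c) => by simp [hω]), setIntegral_const, smul_eq_mul]

end Discrete

/-! ### Observed-data laws -/

section Law

variable {𝒜 𝒵 𝒞 : Type*} [Countable 𝒜] [Countable 𝒵] [Countable 𝒞]
    [MeasurableSpace 𝒜] [MeasurableSpace 𝒵] [MeasurableSpace 𝒞]
    [MeasurableSingletonClass 𝒜] [MeasurableSingletonClass 𝒵] [MeasurableSingletonClass 𝒞]

/-- The properties of the law of the observed data that are used below: positivity, integrable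
outcome, and independence of the outcome of the treatment given mediator and covariates. -/
structure IsBDTDLaw (P : Measure (Obs 𝒜 𝒵 𝒞)) : Prop where
  isProb : IsProbabilityMeasure P
  pos : ∀ c a z, 0 < P {x | x.1 = c ∧ x.2.1 = a ∧ x.2.2.1 = z}
  integrable : Integrable (fun x : Obs 𝒜 𝒵 𝒞 => x.2.2.2) P
  separation : ∀ c a z, ∫ x in {x | x.1 = c ∧ x.2.1 = a ∧ x.2.2.1 = z}, x.2.2.2 ∂P
    = P.real {x | x.1 = c ∧ x.2.1 = a ∧ x.2.2.1 = z} * (trueNuisance P).outcome z c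

/-- The functional `∑ z, E(Y | z, c) p(z | a, c)`. -/
noncomputable def frontDoorMean (P : Measure (Obs 𝒜 𝒵 𝒞)) (a : 𝒜) (c : 𝒞) : ℝ :=
  ∑' z, (trueNuisance P).outcome z c * (trueNuisance P).mediator z a c

lemma measurableSet_cell_C (c : 𝒞) : MeasurableSet {x : Obs 𝒜 𝒵 𝒞 | x.1 = c} :=
  measurableSet_fiber measurable_fst c

lemma measurableSet_cell_A (a : 𝒜) : MeasurableSet {x : Obs 𝒜 𝒵 𝒞 | x.2.1 = a} :=
  measurableSet_fiber (X := fun x : Obs 𝒜 𝒵 𝒞 => x.2.1) (by fun_prop) a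

lemma measurableSet_cell_Z (z : 𝒵) : MeasurableSet {x : Obs 𝒜 𝒵 𝒞 | x.2.2.1 = z} :=
  measurableSet_fiber (X := fun x : Obs 𝒜 𝒵 𝒞 => x.2.2.1) (by fun_prop) z

lemma measurableSet_cell_AC (a : 𝒜) (c : 𝒞) :
    MeasurableSet {x : Obs 𝒜 𝒵 𝒞 | x.2.1 = a ∧ x.1 = c} :=
  (measurableSet_cell_A a).inter (measurableSet_cell_C c)

lemma measurableSet_cell_ZC (z : 𝒵) (c : 𝒞) :
    MeasurableSet {x : Obs 𝒜 𝒵 𝒞 | x.2.2.1 = z ∧ x.1 = c} :=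
  (measurableSet_cell_Z z).inter (measurableSet_cell_C c)

lemma measurableSet_cell (c : 𝒞) (a : 𝒜) (z : 𝒵) :
    MeasurableSet {x : Obs 𝒜 𝒵 𝒞 | x.1 = c ∧ x.2.1 = a ∧ x.2.2.1 = z} :=
  (measurableSet_cell_C c).inter ((measurableSet_cell_A a).inter (measurableSet_cell_Z z))

namespace IsBDTDLaw

variable {P : Measure (Obs 𝒜 𝒵 𝒞)}

lemma cell_pos (h : IsBDTDLaw P) (c : 𝒞) (a : 𝒜) (z : 𝒵) :
    0 < P.real {x | x.1 = c ∧ x.2.1 = a ∧ x.2.2.1 = z} := by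
  have := h.isProb
  exact ENNReal.toReal_pos (h.pos c a z).ne' (measure_ne_top _ _)

lemma nonempty (h : IsBDTDLaw P) : Nonempty (Obs 𝒜 𝒵 𝒞) := by
  have := h.isProb
  exact P.nonempty_of_neZero

lemma cell_ZC_pos (h : IsBDTDLaw P) (z : 𝒵) (c : 𝒞) :
    0 < P.real {x | x.2.2.1 = z ∧ x.1 = c} := by
  have := h.isProb
  -- Any point of the space supplies a treatment value; positivity of the full cell with that value
  -- then suffices.
  obtain ⟨x⟩ := h.nonempty
  exact (h.cell_pos c x.2.1 z).trans_le (measureReal_mono fun y hy => ⟨hy.2.2, hy.1⟩)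

lemma cell_AC_pos (h : IsBDTDLaw P) (a : 𝒜) (c : 𝒞) :
    0 < P.real {x | x.2.1 = a ∧ x.1 = c} := by
  have := h.isProb
  obtain ⟨x⟩ := h.nonempty
  exact (h.cell_pos c a x.2.2.1).trans_le (measureReal_mono fun y hy => ⟨hy.2.1, hy.1⟩)

lemma cell_C_pos (h : IsBDTDLaw P) (c : 𝒞) : 0 < P.real {x | x.1 = c} := by
  have := h.isProb
  obtain ⟨x⟩ := h.nonempty
  exact (h.cell_AC_pos x.2.1 c).trans_le (measureReal_mono fun y hy => hy.2)

lemma setIntegral_outcome (h : IsBDTDLaw P) (z : 𝒵) (c : 𝒞) :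
    ∫ x in {x | x.2.2.1 = z ∧ x.1 = c}, x.2.2.2 ∂P
      = P.real {x | x.2.2.1 = z ∧ x.1 = c} * (trueNuisance P).outcome z c := by
  have := h.cell_ZC_pos z c
  simp only [trueNuisance, ProbabilityTheory.cond, integral_smul_measure, ENNReal.toReal_inv,
    smul_eq_mul]
  rw [← Measure.real, mul_inv_cancel_left₀ this.ne']

/-- Together with `cell_eq_treatment` this is the chain rule for cell masses, in product form so
that later computations need no conditional measures. -/
lemma cell_eq_mediator (h : IsBDTDLaw P) (c : 𝒞) (a : 𝒜) (z : 𝒵) :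
    P.real {x | x.1 = c ∧ x.2.1 = a ∧ x.2.2.1 = z}
      = P.real {x | x.2.1 = a ∧ x.1 = c} * (trueNuisance P).mediator z a c := by
  have := h.cell_AC_pos a c
  simp only [trueNuisance, Measure.real]
  rw [cond_apply (measurableSet_cell_AC a c), ENNReal.toReal_mul, ENNReal.toReal_inv]
  rw [Measure.real] at this
  rw [mul_inv_cancel_left₀ this.ne']
  congr 2; ext x; simp; tauto

lemma cell_eq_treatment (h : IsBDTDLaw P) (a : 𝒜) (c : 𝒞) :
    P.real {x | x.2.1 = a ∧ x.1 = c} = P.real {x | x.1 = c} * (trueNuisance P).treatment a c := by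
  have := h.cell_C_pos c
  simp only [trueNuisance, Measure.real]
  rw [cond_apply (measurableSet_cell_C c), ENNReal.toReal_mul, ENNReal.toReal_inv]
  rw [Measure.real] at this
  rw [mul_inv_cancel_left₀ this.ne']
  congr 2; ext x; simp; tauto

lemma mediator_pos (h : IsBDTDLaw P) (z : 𝒵) (a : 𝒜) (c : 𝒞) :
    0 < (trueNuisance P).mediator z a c := by
  have h1 := h.cell_eq_mediator c a z
  exact pos_of_mul_pos_right (h1 ▸ h.cell_pos c a z) (h.cell_AC_pos a c).le

lemma treatment_pos (h : IsBDTDLaw P) (a : 𝒜) (c : 𝒞) :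
    0 < (trueNuisance P).treatment a c := by
  have h1 := h.cell_eq_treatment a c
  exact pos_of_mul_pos_right (h1 ▸ h.cell_AC_pos a c) (h.cell_C_pos c).le

lemma hasSum_cell_Z (h : IsBDTDLaw P) (a : 𝒜) (c : 𝒞) :
    HasSum (fun z => P.real {x | x.1 = c ∧ x.2.1 = a ∧ x.2.2.1 = z})
      (P.real {x | x.2.1 = a ∧ x.1 = c}) := by
  have := h.isProb
  have h1 := hasSum_setIntegral_fiber (μ := P.restrict {x | x.2.1 = a ∧ x.1 = c})
    (integrable_const (1 : ℝ)) (X := fun x : Obs 𝒜 𝒵 𝒞 => x.2.2.1) (by fun_prop)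
  simp only [integral_const, smul_eq_mul, mul_one, measureReal_restrict_apply_univ] at h1
  refine h1.congr_fun ?_
  intro z
  rw [measureReal_restrict_apply (measurableSet_cell_Z z)]
  congr 1; ext x; simp; tauto

lemma hasSum_mediator (h : IsBDTDLaw P) (a : 𝒜) (c : 𝒞) :
    HasSum (fun z => (trueNuisance P).mediator z a c) 1 := by
  have h1 := (h.hasSum_cell_Z a c).mul_left (P.real {x | x.2.1 = a ∧ x.1 = c})⁻¹
  simp_rw [h.cell_eq_mediator c a, inv_mul_cancel_left₀ (h.cell_AC_pos a c).ne'] at h1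
  rwa [inv_mul_cancel₀ (h.cell_AC_pos a c).ne'] at h1

lemma hasSum_cell_A (h : IsBDTDLaw P) (z : 𝒵) (c : 𝒞) :
    HasSum (fun a => P.real {x | x.1 = c ∧ x.2.1 = a ∧ x.2.2.1 = z})
      (P.real {x | x.2.2.1 = z ∧ x.1 = c}) := by
  have := h.isProb
  have h1 := hasSum_setIntegral_fiber (μ := P.restrict {x | x.2.2.1 = z ∧ x.1 = c})
    (integrable_const (1 : ℝ)) (X := fun x : Obs 𝒜 𝒵 𝒞 => x.2.1) (by fun_prop)
  simp only [integral_const, smul_eq_mul, mul_one, measureReal_restrict_apply_univ] at h1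
  refine h1.congr_fun ?_
  intro a
  rw [measureReal_restrict_apply (measurableSet_cell_A a)]
  congr 1; ext x; simp; tauto

/-- The denominator of the weight is p(z | c): total probability over the treatments. -/
lemma hasSum_mix (h : IsBDTDLaw P) (z : 𝒵) (c : 𝒞) :
    HasSum (fun a => (trueNuisance P).mediator z a c * (trueNuisance P).treatment a c)
      (P.real {x | x.2.2.1 = z ∧ x.1 = c} / P.real {x | x.1 = c}) := by
  have h1 := (h.hasSum_cell_A z c).mul_left (P.real {x | x.1 = c})⁻¹
  rw [mul_comm, ← div_eq_mul_inv] at h1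
  refine h1.congr_fun fun a => ?_
  rw [h.cell_eq_mediator, h.cell_eq_treatment, mul_assoc,
    inv_mul_cancel_left₀ (h.cell_C_pos c).ne', mul_comm]

lemma hasSum_treatment (h : IsBDTDLaw P) (c : 𝒞) :
    HasSum (fun a => (trueNuisance P).treatment a c) 1 := by
  have := h.isProb
  have h1 := hasSum_setIntegral_fiber (μ := P.restrict {x | x.1 = c})
    (integrable_const (1 : ℝ)) (X := fun x : Obs 𝒜 𝒵 𝒞 => x.2.1) (by fun_prop)
  simp only [integral_const, smul_eq_mul, mul_one, measureReal_restrict_apply_univ] at h1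
  have h2 := h1.mul_left (P.real {x | x.1 = c})⁻¹
  rw [inv_mul_cancel₀ (h.cell_C_pos c).ne'] at h2
  refine h2.congr_fun fun a => ?_
  rw [measureReal_restrict_apply (measurableSet_cell_A a)]
  change _ = _ * P.real {x | x.2.1 = a ∧ x.1 = c}
  rw [h.cell_eq_treatment, inv_mul_cancel_left₀ (h.cell_C_pos c).ne']

/-- The outcome regression is summable against the mediator distribution. -/
lemma hasSum_outcome_cell (h : IsBDTDLaw P) (a : 𝒜) (c : 𝒞) :
    HasSum (fun z => P.real {x | x.1 = c ∧ x.2.1 = a ∧ x.2.2.1 = z} * (trueNuisance P).outcome z c)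
      (∫ x in {x | x.2.1 = a ∧ x.1 = c}, x.2.2.2 ∂P) := by
  have h1 := hasSum_setIntegral_fiber (μ := P.restrict {x | x.2.1 = a ∧ x.1 = c})
    h.integrable.integrableOn (X := fun x : Obs 𝒜 𝒵 𝒞 => x.2.2.1) (by fun_prop)
  refine h1.congr_fun fun z => ?_
  rw [Measure.restrict_restrict (measurableSet_cell_Z z), ← h.separation]
  congr 2; ext x; simp; tauto

/-- The mediator may take infinitely many values, so the `tsum` could be the default value 0.
Integrability of the outcome rules this out. -/
lemma hasSum_frontDoorMean (h : IsBDTDLaw P) (a : 𝒜) (c : 𝒞) :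
    HasSum (fun z => (trueNuisance P).outcome z c * (trueNuisance P).mediator z a c)
      (frontDoorMean P a c) := by
  have h1 := ((h.hasSum_outcome_cell a c).mul_left (P.real {x | x.2.1 = a ∧ x.1 = c})⁻¹).summable
  simp_rw [h.cell_eq_mediator c a, mul_assoc, inv_mul_cancel_left₀ (h.cell_AC_pos a c).ne'] at h1
  simp_rw [mul_comm] at h1
  exact h1.hasSum

/-- This is where `separation` pays off: within a cell the regression on (z, c) may replace the one
on (a, z, c), so E(Y | a, c) is a front-door mean. -/
lemma setIntegral_AC (h : IsBDTDLaw P) (a : 𝒜) (c : 𝒞) :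
    ∫ x in {x | x.2.1 = a ∧ x.1 = c}, x.2.2.2 ∂P
      = P.real {x | x.2.1 = a ∧ x.1 = c} * frontDoorMean P a c := by
  rw [← (h.hasSum_outcome_cell a c).tsum_eq, frontDoorMean, ← tsum_mul_left]
  simp_rw [h.cell_eq_mediator c a, mul_assoc]
  simp_rw [mul_comm]

/-- Every cell has positive mass, so no exceptional null set can contain one. This turns the almost
sure bounds of the theorem into pointwise ones. -/
lemma forall_of_ae (h : IsBDTDLaw P) {p : 𝒞 → 𝒜 → 𝒵 → Prop}
    (hp : ∀ᵐ x ∂P, p x.1 x.2.1 x.2.2.1) (c : 𝒞) (a : 𝒜) (z : 𝒵) : p c a z := by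
  by_contra hcon
  have h1 : P {x | x.1 = c ∧ x.2.1 = a ∧ x.2.2.1 = z} ≤ P {x | ¬ p x.1 x.2.1 x.2.2.1} := by
    refine measure_mono ?_
    rintro ⟨c', a', z', y⟩ ⟨h1, h2, h3⟩
    simp only at h1 h2 h3
    subst h1 h2 h3
    exact hcon
  have h2 : P {x | ¬ p x.1 x.2.1 x.2.2.1} = 0 := hp
  exact absurd (h.pos c a z) (by rw [not_lt]; exact h1.trans h2.le)

end IsBDTDLaw

end Law

/-! ### Identification -/

section Identification

/-- If `X` is independent of the event `E` given the event `S`, then the mean of `X` over `S ∩ E`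
is that over `S`, up to normalization. -/
lemma setIntegral_inter_of_indepFun_cond {Ω β : Type*} [MeasurableSpace Ω] [MeasurableSpace β]
    {μ : Measure Ω} [IsFiniteMeasure μ] {S : Set Ω} (hS0 : μ S ≠ 0)
    {X : Ω → ℝ} {W : Ω → β} (hX : Measurable X) (hW : Measurable W) {b : Set β}
    (hb : MeasurableSet b) (h : IndepFun X W (ProbabilityTheory.cond μ S)) :
    μ.real S * ∫ ω in S ∩ W ⁻¹' b, X ω ∂μ = μ.real (S ∩ W ⁻¹' b) * ∫ ω in S, X ω ∂μ := by
  -- Independence is used through the product formula with an indicator. That formula needs no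
  -- integrability, which matters because Y(a, z) is not assumed integrable.
  have h1 : IndepFun X ((b.indicator (1 : β → ℝ)) ∘ W) (ProbabilityTheory.cond μ S) :=
    h.comp measurable_id (measurable_one.indicator hb)
  have h2 := h1.integral_fun_mul_eq_mul_integral hX.aestronglyMeasurable
    ((measurable_one.indicator hb).comp hW).aestronglyMeasurable
  have hpos : μ.real S ≠ 0 := (ENNReal.toReal_pos hS0 (measure_ne_top _ _)).ne'
  have e1 : ∀ ω, X ω * ((b.indicator (1 : β → ℝ)) ∘ W) ω = (W ⁻¹' b).indicator X ω := by
    intro ω; by_cases hω : W ω ∈ b <;> simp [hω]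
  have e2 : ((b.indicator (1 : β → ℝ)) ∘ W) = (W ⁻¹' b).indicator 1 := by
    ext ω; by_cases hω : W ω ∈ b <;> simp [hω]
  simp_rw [e1] at h2
  rw [e2] at h2
  simp only [ProbabilityTheory.cond, integral_smul_measure, ENNReal.toReal_inv, smul_eq_mul,
    integral_indicator_one (hW hb)] at h2
  rw [integral_indicator (hW hb), Measure.restrict_restrict (hW hb),
    measureReal_ennreal_smul_apply, measureReal_restrict_apply (hW hb), ENNReal.toReal_inv,
    ← Measure.real, Set.inter_comm] at h2
  field_simp at h2
  linarith

variable {𝒜 𝒵 𝒞 : Type*} [Countable 𝒜] [Countable 𝒵] [Countable 𝒞]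
    [MeasurableSpace 𝒜] [MeasurableSpace 𝒵] [MeasurableSpace 𝒞]
    [MeasurableSingletonClass 𝒜] [MeasurableSingletonClass 𝒵] [MeasurableSingletonClass 𝒞]

namespace CausalModel

lemma measurable_obs (M : CausalModel 𝒜 𝒵 𝒞) :
    Measurable fun ω => (M.C ω, M.A ω, M.Z ω, M.Y ω) :=
  M.measurable_C.prodMk (M.measurable_A.prodMk (M.measurable_Z.prodMk M.measurable_Y))

lemma obsLaw_apply (M : CausalModel 𝒜 𝒵 𝒞) {s : Set (Obs 𝒜 𝒵 𝒞)} (hs : MeasurableSet s) :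
    M.obsLaw s = M.prob {ω | (M.C ω, M.A ω, M.Z ω, M.Y ω) ∈ s} :=
  Measure.map_apply M.measurable_obs hs

lemma obsLaw_real (M : CausalModel 𝒜 𝒵 𝒞) {s : Set (Obs 𝒜 𝒵 𝒞)} (hs : MeasurableSet s) :
    M.obsLaw.real s = M.prob.real {ω | (M.C ω, M.A ω, M.Z ω, M.Y ω) ∈ s} := by
  rw [Measure.real, M.obsLaw_apply hs, Measure.real]

instance isProbabilityMeasure_obsLaw (M : CausalModel 𝒜 𝒵 𝒞) : IsProbabilityMeasure M.obsLaw :=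
  Measure.isProbabilityMeasure_map M.measurable_obs.aemeasurable

lemma setIntegral_obsLaw (M : CausalModel 𝒜 𝒵 𝒞) {s : Set (Obs 𝒜 𝒵 𝒞)} (hs : MeasurableSet s) :
    ∫ x in s, x.2.2.2 ∂M.obsLaw = ∫ ω in {ω | (M.C ω, M.A ω, M.Z ω, M.Y ω) ∈ s}, M.Y ω ∂M.prob := by
  rw [obsLaw, setIntegral_map hs (Measurable.aestronglyMeasurable (by fun_prop))
    M.measurable_obs.aemeasurable]
  rfl

namespace IsBDTD

variable {M : CausalModel 𝒜 𝒵 𝒞}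

lemma measurableSet_C (c : 𝒞) : MeasurableSet {ω | M.C ω = c} :=
  measurableSet_fiber M.measurable_C c

lemma measurableSet_A (a : 𝒜) : MeasurableSet {ω | M.A ω = a} :=
  measurableSet_fiber M.measurable_A a

lemma measurableSet_Z (z : 𝒵) : MeasurableSet {ω | M.Z ω = z} :=
  measurableSet_fiber M.measurable_Z z

lemma prob_AC_ne_zero (h : M.IsBDTD) (a : 𝒜) (c : 𝒞) :
    M.prob {ω | M.A ω = a ∧ M.C ω = c} ≠ 0 := by
  obtain ⟨ω⟩ := M.prob.nonempty_of_neZero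
  exact ((h.positivity c a (M.Z ω)).trans_le (measure_mono (t := {ω | M.A ω = a ∧ M.C ω = c})
    fun y hy => ⟨hy.2.1, hy.1⟩)).ne'

lemma prob_C_ne_zero (h : M.IsBDTD) (c : 𝒞) : M.prob {ω | M.C ω = c} ≠ 0 := by
  obtain ⟨ω⟩ := M.prob.nonempty_of_neZero
  have h1 : {ω' | M.A ω' = M.A ω ∧ M.C ω' = c} ⊆ {ω | M.C ω = c} := fun y hy => hy.2
  exact ((pos_iff_ne_zero.2 (h.prob_AC_ne_zero (M.A ω) c)).trans_le (measure_mono h1)).ne'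

/-- The mean of the outcome over a cell, in terms of the potential outcome `Y(b, z)`. -/
lemma setIntegral_cell (h : M.IsBDTD) (c : 𝒞) (a b : 𝒜) (z : 𝒵) :
    M.prob.real {ω | M.C ω = c} * ∫ ω in {ω | M.C ω = c ∧ M.A ω = a ∧ M.Z ω = z}, M.Y ω ∂M.prob
      = M.prob.real {ω | M.C ω = c ∧ M.A ω = a ∧ M.Z ω = z}
        * ∫ ω in {ω | M.C ω = c}, M.Ypot₂ b z ω ∂M.prob := by
  have hAC := h.prob_AC_ne_zero a c
  have hC := h.prob_C_ne_zero c
  have hACpos : M.prob.real {ω | M.A ω = a ∧ M.C ω = c} ≠ 0 :=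
    (ENNReal.toReal_pos hAC (measure_ne_top _ _)).ne'
  have hms : MeasurableSet {ω | M.A ω = a ∧ M.C ω = c} :=
    (measurableSet_A a).inter (measurableSet_C c)
  have hmcell : MeasurableSet {ω | M.C ω = c ∧ M.A ω = a ∧ M.Z ω = z} :=
    (measurableSet_C c).inter ((measurableSet_A a).inter (measurableSet_Z z))
  -- On the cell, Y = Y(a, z) by consistency and Y(a, z) = Y(b, z) by exclusion.
  have e1 : ∫ ω in {ω | M.C ω = c ∧ M.A ω = a ∧ M.Z ω = z}, M.Y ω ∂M.prob
      = ∫ ω in {ω | M.C ω = c ∧ M.A ω = a ∧ M.Z ω = z}, M.Ypot₂ b z ω ∂M.prob := by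
    refine setIntegral_congr_ae hmcell ?_
    filter_upwards [h.consistency.outcome₂ a z, h.twoDoor.exclusion a b z] with ω h1 h2 h3
    rw [h1 h3.2.1 h3.2.2, h2]
  -- Where A = a, the observed mediator is Z(a), so the cell becomes an event in Z(a) inside {A = a,
  -- C = c}.
  have e2 : {ω | M.C ω = c ∧ M.A ω = a ∧ M.Z ω = z}
      =ᵐ[M.prob] ({ω | M.A ω = a ∧ M.C ω = c} ∩ M.Zpot a ⁻¹' {z} : Set M.Ω) := by
    filter_upwards [h.consistency.mediator a] with ω h1
    refine propext (show (M.C ω = c ∧ M.A ω = a ∧ M.Z ω = z) ↔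
      ((M.A ω = a ∧ M.C ω = c) ∧ M.Zpot a ω = z) from ?_)
    constructor
    · rintro ⟨h2, h3, h4⟩; exact ⟨⟨h3, h2⟩, by rw [← h1 h3, h4]⟩
    · rintro ⟨⟨h2, h3⟩, h4⟩; exact ⟨h3, h2, by rw [h1 h2, h4]⟩
  -- Conditioning is removed in two stages: first on Z(a) given (A, C), then on A given C.
  have e3 := setIntegral_inter_of_indepFun_cond hAC (M.measurable_Ypot₂ b z)
    (M.measurable_Zpot a) (measurableSet_singleton z) (h.twoDoor.outcome b a z a c hAC)
  have e4 := setIntegral_inter_of_indepFun_cond hC (M.measurable_Ypot₂ b z)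
    M.measurable_A (measurableSet_singleton a) (h.backDoor.joint b z c hC)
  have e5 : {ω | M.C ω = c} ∩ M.A ⁻¹' {a} = {ω | M.A ω = a ∧ M.C ω = c} := by
    ext ω; simp [and_comm]
  rw [e5] at e4
  rw [← setIntegral_congr_set e2, ← measureReal_congr e2] at e3
  rw [e1]
  apply mul_left_cancel₀ hACpos
  linear_combination M.prob.real {ω | M.C ω = c} * e3
    + M.prob.real {ω | M.C ω = c ∧ M.A ω = a ∧ M.Z ω = z} * e4

/-- All causal content needed about the observed law is condensed here. By `setIntegral_cell` the
mean over a cell is E(Y(b, z) | c) for a fixed b; a quantity constant in the treatment must equal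
its average over treatments, E(Y | z, c). -/
lemma isBDTDLaw (h : M.IsBDTD) : IsBDTDLaw M.obsLaw := by
  have hpos : ∀ c a z, 0 < M.obsLaw {x | x.1 = c ∧ x.2.1 = a ∧ x.2.2.1 = z} := by
    intro c a z
    rw [M.obsLaw_apply (measurableSet_cell c a z)]
    exact h.positivity c a z
  have hint : Integrable (fun x : Obs 𝒜 𝒵 𝒞 => x.2.2.2) M.obsLaw := by
    rw [obsLaw, integrable_map_measure (Measurable.aestronglyMeasurable (by fun_prop))
      M.measurable_obs.aemeasurable]
    exact h.integrable_Y
  refine ⟨inferInstance, hpos, hint, fun c a z => ?_⟩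
  -- the mean over a cell is proportional to its probability
  obtain ⟨q, hq⟩ : ∃ q : ℝ, ∀ a, ∫ x in {x | x.1 = c ∧ x.2.1 = a ∧ x.2.2.1 = z}, x.2.2.2 ∂M.obsLaw
      = M.obsLaw.real {x | x.1 = c ∧ x.2.1 = a ∧ x.2.2.1 = z} * q := by
    refine ⟨(M.prob.real {ω | M.C ω = c})⁻¹ * ∫ ω in {ω | M.C ω = c}, M.Ypot₂ a z ω ∂M.prob,
      fun b => ?_⟩
    have hCpos : M.prob.real {ω | M.C ω = c} ≠ 0 :=
      (ENNReal.toReal_pos (h.prob_C_ne_zero c) (measure_ne_top _ _)).ne'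
    rw [M.setIntegral_obsLaw (measurableSet_cell c b z), M.obsLaw_real (measurableSet_cell c b z)]
    have := h.setIntegral_cell c b a z
    simp only [Set.mem_ofPred_eq]
    field_simp
    linarith
  have hcell : 0 < M.obsLaw.real {x | x.2.2.1 = z ∧ x.1 = c} :=
    (ENNReal.toReal_pos (hpos c a z).ne' (measure_ne_top _ _)).trans_le
      (measureReal_mono fun y hy => ⟨hy.2.2, hy.1⟩)
  -- Summing outcome integrals and masses over the treatment identifies q with the mean of Y given
  -- (z, c).
  have h1 := hasSum_setIntegral_fiber (μ := M.obsLaw.restrict {x | x.2.2.1 = z ∧ x.1 = c})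
    hint.integrableOn (X := fun x : Obs 𝒜 𝒵 𝒞 => x.2.1) (by fun_prop)
  have h2 := hasSum_setIntegral_fiber (μ := M.obsLaw.restrict {x | x.2.2.1 = z ∧ x.1 = c})
    (integrable_const (1 : ℝ)) (X := fun x : Obs 𝒜 𝒵 𝒞 => x.2.1) (by fun_prop)
  have hset : ∀ b, {x : Obs 𝒜 𝒵 𝒞 | x.2.1 = b} ∩ {x | x.2.2.1 = z ∧ x.1 = c}
      = {x | x.1 = c ∧ x.2.1 = b ∧ x.2.2.1 = z} := by
    intro b; ext x; simp; tauto
  simp_rw [Measure.restrict_restrict (measurableSet_cell_A _), hset] at h1 h2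
  simp only [integral_const, smul_eq_mul, mul_one, measureReal_restrict_apply_univ] at h2
  simp_rw [hq] at h1
  have h3 := h1.unique (h2.mul_right q)
  rw [hq a]
  congr 1
  simp only [trueNuisance, ProbabilityTheory.cond, integral_smul_measure, ENNReal.toReal_inv,
    smul_eq_mul]
  rw [h3, ← Measure.real, inv_mul_cancel_left₀ hcell.ne']

/-- Identification of the mean potential outcomes given the covariates. -/
lemma setIntegral_Ypot (h : M.IsBDTD) (a : 𝒜) (c : 𝒞) :
    ∫ ω in {ω | M.C ω = c}, M.Ypot a ω ∂M.prob
      = M.prob.real {ω | M.C ω = c} * frontDoorMean M.obsLaw a c := by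
  have hAC := h.prob_AC_ne_zero a c
  have hC := h.prob_C_ne_zero c
  have hACpos : M.prob.real {ω | M.A ω = a ∧ M.C ω = c} ≠ 0 :=
    (ENNReal.toReal_pos hAC (measure_ne_top _ _)).ne'
  have hms : MeasurableSet {ω | M.A ω = a ∧ M.C ω = c} :=
    (measurableSet_A a).inter (measurableSet_C c)
  -- Back-door for the pair (Y(a), Y(a)), projected to one coordinate: the mean of Y(a) given c does
  -- not change on conditioning on A = a.
  have e4 := setIntegral_inter_of_indepFun_cond hC (M.measurable_Ypot a)
    M.measurable_A (measurableSet_singleton a)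
    ((h.backDoor.pair a a c hC).comp measurable_fst measurable_id)
  have e5 : {ω | M.C ω = c} ∩ M.A ⁻¹' {a} = {ω | M.A ω = a ∧ M.C ω = c} := by
    ext ω; simp [and_comm]
  have e6 : ∫ ω in {ω | M.A ω = a ∧ M.C ω = c}, M.Ypot a ω ∂M.prob
      = ∫ ω in {ω | M.A ω = a ∧ M.C ω = c}, M.Y ω ∂M.prob := by
    refine setIntegral_congr_ae hms ?_
    filter_upwards [h.consistency.outcome a] with ω h1 h2
    rw [h1 h2.1]
  have e7 := h.isBDTDLaw.setIntegral_AC a c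
  rw [M.setIntegral_obsLaw (measurableSet_cell_AC a c), M.obsLaw_real (measurableSet_cell_AC a c)]
    at e7
  simp only [Set.mem_ofPred_eq] at e7
  rw [e5, e6, e7] at e4
  apply mul_left_cancel₀ hACpos
  linear_combination -e4

lemma integral_Ypot (h : M.IsBDTD) (a : 𝒜) :
    Integrable (fun x : Obs 𝒜 𝒵 𝒞 => frontDoorMean M.obsLaw a x.1) M.obsLaw ∧
      ∫ x, frontDoorMean M.obsLaw a x.1 ∂M.obsLaw = ∫ ω, M.Ypot a ω ∂M.prob := by
  have h1 := integrable_comp_of_setIntegral_fiber (h.integrable_Ypot a) M.measurable_C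
    (h.setIntegral_Ypot a)
  have hm : Measurable (fun x : Obs 𝒜 𝒵 𝒞 => frontDoorMean M.obsLaw a x.1) :=
    (measurable_of_countable (frontDoorMean M.obsLaw a)).comp measurable_fst
  exact ⟨(integrable_map_measure hm.aestronglyMeasurable M.measurable_obs.aemeasurable).2 h1.1,
    (integral_map M.measurable_obs.aemeasurable hm.aestronglyMeasurable).trans h1.2⟩

/-- Identification of the average causal effect. -/
lemma ace_eq (h : M.IsBDTD) (aStar a : 𝒜) :
    Integrable (fun x : Obs 𝒜 𝒵 𝒞 => frontDoorMean M.obsLaw aStar x.1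
      - frontDoorMean M.obsLaw a x.1) M.obsLaw ∧
    ∫ x, (frontDoorMean M.obsLaw aStar x.1 - frontDoorMean M.obsLaw a x.1) ∂M.obsLaw
      = M.ace aStar a := by
  refine ⟨(h.integral_Ypot aStar).1.sub (h.integral_Ypot a).1, ?_⟩
  rw [integral_sub (h.integral_Ypot aStar).1 (h.integral_Ypot a).1, (h.integral_Ypot aStar).2,
    (h.integral_Ypot a).2, ace]

end IsBDTD

end CausalModel

end Identification

/-! ### The mean of the estimating function given the covariates -/

section Moment

variable {𝒜 𝒵 𝒞 : Type*}

/-- The estimating function with an outcome model `Q`, a weight `w` for the residual, and models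
`μ` and `π` for the mean of `Q` given treatment and covariates and for the treatment. -/
noncomputable def drScore (aStar a : 𝒜) (Q w : 𝒵 → 𝒞 → ℝ) (μ π : 𝒜 → 𝒞 → ℝ) (τ : 𝒞 → ℝ)
    (x : Obs 𝒜 𝒵 𝒞) : ℝ :=
  (x.2.2.2 - Q x.2.2.1 x.1) * w x.2.2.1 x.1
    + (Q x.2.2.1 x.1 - μ x.2.1 x.1) * ((ind aStar x.2.1 - ind a x.2.1) / π x.2.1 x.1) + τ x.1

/-- The density ratio `(p(z | a*, c) - p(z | a, c)) / p(z | c)`. -/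
noncomputable def Nuisance.weight (η : Nuisance 𝒜 𝒵 𝒞) (aStar a : 𝒜) (z : 𝒵) (c : 𝒞) : ℝ :=
  (η.mediator z aStar c - η.mediator z a c) / ∑' b, η.mediator z b c * η.treatment b c

/-- The mean of the outcome model given treatment and covariates. -/
noncomputable def Nuisance.mean (η : Nuisance 𝒜 𝒵 𝒞) (a : 𝒜) (c : 𝒞) : ℝ :=
  ∑' z, η.outcome z c * η.mediator z a c

/-- The contrast of the means of the outcome model. -/
noncomputable def Nuisance.contrast (η : Nuisance 𝒜 𝒵 𝒞) (aStar a : 𝒜) (c : 𝒞) : ℝ :=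
  ∑' z, η.outcome z c * (η.mediator z aStar c - η.mediator z a c)

/-- Separating the ingredients allows them to come from different laws; the regularity proof uses a
score with the outcome regression of one law and the weights of another. -/
lemma mBDTD_eq_drScore (aStar a : 𝒜) (η : Nuisance 𝒜 𝒵 𝒞) :
    mBDTD aStar a η = drScore aStar a η.outcome (η.weight aStar a) η.mean η.treatment
      (η.contrast aStar a) := rfl

lemma Nuisance.contrast_eq {η : Nuisance 𝒜 𝒵 𝒞} {c : 𝒞}
    (h : ∀ b, Summable fun z => η.outcome z c * η.mediator z b c) (aStar a : 𝒜) :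
    η.contrast aStar a c = η.mean aStar c - η.mean a c := by
  rw [contrast, mean, mean, ← (h aStar).tsum_sub (h a)]
  simp_rw [mul_sub]

variable [Countable 𝒜] [Countable 𝒵] [Countable 𝒞]
    [MeasurableSpace 𝒜] [MeasurableSpace 𝒵] [MeasurableSpace 𝒞]
    [MeasurableSingletonClass 𝒜] [MeasurableSingletonClass 𝒵] [MeasurableSingletonClass 𝒞]

lemma frontDoorMean_eq_mean (P : Measure (Obs 𝒜 𝒵 𝒞)) (a : 𝒜) (c : 𝒞) :
    frontDoorMean P a c = (trueNuisance P).mean a c := rfl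

namespace IsBDTDLaw

variable {P : Measure (Obs 𝒜 𝒵 𝒞)}

lemma integral_comp_mediator (h : IsBDTDLaw P) {q : 𝒵 → ℝ} {b : 𝒜} {c : 𝒞}
    (hs : Summable fun z => q z * (trueNuisance P).mediator z b c) :
    IntegrableOn (fun x => q x.2.2.1) {x | x.2.1 = b ∧ x.1 = c} P ∧
      ∫ x in {x | x.2.1 = b ∧ x.1 = c}, q x.2.2.1 ∂P
        = P.real {x | x.2.1 = b ∧ x.1 = c} * ∑' z, q z * (trueNuisance P).mediator z b c := by
  have := h.isProb
  have hZ : Measurable (fun x : Obs 𝒜 𝒵 𝒞 => x.2.2.1) := by fun_prop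
  have hset : ∀ z, {x : Obs 𝒜 𝒵 𝒞 | x.2.2.1 = z} ∩ {x | x.2.1 = b ∧ x.1 = c}
      = {x | x.1 = c ∧ x.2.1 = b ∧ x.2.2.1 = z} := by
    intro z; ext x; simp; tauto
  have key : ∀ (r : 𝒵 → ℝ) (z : 𝒵), ∫ x in {x | x.2.2.1 = z}, r x.2.2.1
      ∂(P.restrict {x | x.2.1 = b ∧ x.1 = c})
        = P.real {x | x.2.1 = b ∧ x.1 = c} * (r z * (trueNuisance P).mediator z b c) := by
    intro r z
    rw [setIntegral_congr_fun (g := fun _ => r z) (measurableSet_cell_Z z)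
      (fun x (hx : x.2.2.1 = z) => by simp [hx]), setIntegral_const,
      measureReal_restrict_apply (measurableSet_cell_Z z), hset, h.cell_eq_mediator, smul_eq_mul]
    ring
  have hint : IntegrableOn (fun x => q x.2.2.1) {x | x.2.1 = b ∧ x.1 = c} P := by
    refine integrable_iff_summable_fiber
      ((measurable_of_countable q).comp hZ).aestronglyMeasurable hZ (fun z => ?_) ?_
    · refine (integrableOn_const (C := q z) (measure_ne_top _ _)).congr_fun ?_
        (measurableSet_cell_Z z)
      exact fun x (hx : x.2.2.1 = z) => by simp [hx]
    · simp_rw [key fun z => |q z|]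
      refine (hs.abs.mul_left (P.real {x | x.2.1 = b ∧ x.1 = c})).congr fun z => ?_
      rw [abs_mul, abs_of_pos (h.mediator_pos z b c)]
  refine ⟨hint, ?_⟩
  rw [← (hasSum_setIntegral_fiber hint hZ).tsum_eq, ← tsum_mul_left]
  simp_rw [key q]

/-- Inverse-probability weighting: the indicator restricts to A = b, where the mass given c is the
true p(b | c), so a wrong treatment model only enters through the ratio of true to modelled
probability. -/
lemma setIntegral_weighted (h : IsBDTDLaw P) {Q : 𝒵 → 𝒞 → ℝ} {μ π : 𝒜 → 𝒞 → ℝ} {b : 𝒜} {c : 𝒞}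
    (hs : Summable fun z => Q z c * (trueNuisance P).mediator z b c) :
    IntegrableOn (fun x => (Q x.2.2.1 x.1 - μ x.2.1 x.1) * (ind b x.2.1 / π x.2.1 x.1))
        {x | x.1 = c} P ∧
      ∫ x in {x | x.1 = c}, (Q x.2.2.1 x.1 - μ x.2.1 x.1) * (ind b x.2.1 / π x.2.1 x.1) ∂P
        = P.real {x | x.1 = c} * ((trueNuisance P).treatment b c / π b c *
          (∑' z, Q z c * (trueNuisance P).mediator z b c - μ b c)) := by
  have := h.isProb
  obtain ⟨h1, h2⟩ := h.integral_comp_mediator hs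
  have heq : Set.EqOn (fun x : Obs 𝒜 𝒵 𝒞 =>
      (Q x.2.2.1 x.1 - μ x.2.1 x.1) * (ind b x.2.1 / π x.2.1 x.1))
      (Set.indicator {x | x.2.1 = b} fun x => (Q x.2.2.1 c - μ b c) * (π b c)⁻¹)
      {x | x.1 = c} := by
    rintro x (hx : x.1 = c)
    by_cases hb : x.2.1 = b
    · simp [hx, hb, ind]
    · simp [hb, ind]
  have hset : {x : Obs 𝒜 𝒵 𝒞 | x.1 = c} ∩ {x | x.2.1 = b} = {x | x.2.1 = b ∧ x.1 = c} := by
    ext x; simp; tauto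
  have h3 : IntegrableOn (fun x : Obs 𝒜 𝒵 𝒞 => (Q x.2.2.1 c - μ b c) * (π b c)⁻¹)
      {x | x.2.1 = b ∧ x.1 = c} P :=
    (h1.sub (integrable_const (μ b c))).mul_const _
  constructor
  · rw [integrableOn_congr_fun heq (measurableSet_cell_C c), IntegrableOn,
      integrable_indicator_iff (measurableSet_cell_A b), IntegrableOn,
      Measure.restrict_restrict (measurableSet_cell_A b), Set.inter_comm, hset]
    exact h3
  · rw [setIntegral_congr_fun (measurableSet_cell_C c) heq,
      setIntegral_indicator (measurableSet_cell_A b), hset, integral_mul_const,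
      integral_sub h1 (integrable_const _), h2, setIntegral_const, h.cell_eq_treatment, smul_eq_mul]
    ring

/-- The mean of the estimating function given the covariates. -/
lemma setIntegral_drScore (h : IsBDTDLaw P) {aStar a : 𝒜} {Q w : 𝒵 → 𝒞 → ℝ} {μ π : 𝒜 → 𝒞 → ℝ}
    {τ : 𝒞 → ℝ} (hi : Integrable (drScore aStar a Q w μ π τ) P) {c : 𝒞}
    (hs : ∀ b, Summable fun z => Q z c * (trueNuisance P).mediator z b c) :
    ∫ x in {x | x.1 = c}, drScore aStar a Q w μ π τ x ∂P = P.real {x | x.1 = c} *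
      (∑' z, ((trueNuisance P).outcome z c - Q z c) * w z c *
          ∑' b, (trueNuisance P).mediator z b c * (trueNuisance P).treatment b c
        + ((trueNuisance P).treatment aStar c / π aStar c *
            (∑' z, Q z c * (trueNuisance P).mediator z aStar c - μ aStar c)
          - (trueNuisance P).treatment a c / π a c *
            (∑' z, Q z c * (trueNuisance P).mediator z a c - μ a c)) + τ c) := by
  have := h.isProb
  have hZ : Measurable (fun x : Obs 𝒜 𝒵 𝒞 => x.2.2.1) := by fun_prop
  obtain ⟨i1, e1⟩ := h.setIntegral_weighted (μ := μ) (π := π) (hs aStar)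
  obtain ⟨i2, e2⟩ := h.setIntegral_weighted (μ := μ) (π := π) (hs a)
  have e3 : ∫ x in {x | x.1 = c}, τ x.1 ∂P = P.real {x | x.1 = c} * τ c := by
    rw [setIntegral_congr_fun (g := fun _ => τ c) (measurableSet_cell_C c)
      (fun x (hx : x.1 = c) => by simp [hx]), setIntegral_const, smul_eq_mul]
  have i3 : IntegrableOn (fun x : Obs 𝒜 𝒵 𝒞 => τ x.1) {x | x.1 = c} P := by
    refine (integrableOn_const (C := τ c) (measure_ne_top _ _)).congr_fun ?_
      (measurableSet_cell_C c)
    exact fun x (hx : x.1 = c) => by simp [hx]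
  -- The residual term is not assumed integrable by itself; on a fibre of C it is the score minus
  -- terms already known to be integrable.
  have i4 : IntegrableOn (fun x : Obs 𝒜 𝒵 𝒞 => (x.2.2.2 - Q x.2.2.1 x.1) * w x.2.2.1 x.1)
      {x | x.1 = c} P := by
    refine (((hi.integrableOn.sub i1).add i2).sub i3).congr (ae_of_all _ fun x => ?_)
    simp only [drScore, Pi.sub_apply, Pi.add_apply]
    ring
  have e4 : ∫ x in {x | x.1 = c}, (x.2.2.2 - Q x.2.2.1 x.1) * w x.2.2.1 x.1 ∂P
      = P.real {x | x.1 = c} * ∑' z, ((trueNuisance P).outcome z c - Q z c) * w z c *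
          ∑' b, (trueNuisance P).mediator z b c * (trueNuisance P).treatment b c := by
    rw [← (hasSum_setIntegral_fiber i4 hZ).tsum_eq, ← tsum_mul_left]
    congr 1
    funext z
    have hset : {x : Obs 𝒜 𝒵 𝒞 | x.2.2.1 = z} ∩ {x | x.1 = c} = {x | x.2.2.1 = z ∧ x.1 = c} := rfl
    rw [Measure.restrict_restrict (measurableSet_cell_Z z), hset,
      setIntegral_congr_fun (g := fun x => (x.2.2.2 - Q z c) * w z c) (measurableSet_cell_ZC z c)
      (fun x hx => by simp [hx.1, hx.2]), integral_mul_const,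
      integral_sub h.integrable.integrableOn (integrable_const _), h.setIntegral_outcome,
      setIntegral_const, smul_eq_mul, (h.hasSum_mix z c).tsum_eq]
    have := (h.cell_C_pos c).ne'
    field_simp
  have hsplit : ∀ x, drScore aStar a Q w μ π τ x = (x.2.2.2 - Q x.2.2.1 x.1) * w x.2.2.1 x.1
      + ((Q x.2.2.1 x.1 - μ x.2.1 x.1) * (ind aStar x.2.1 / π x.2.1 x.1)
        - (Q x.2.2.1 x.1 - μ x.2.1 x.1) * (ind a x.2.1 / π x.2.1 x.1)) + τ x.1 := by
    intro x; simp only [drScore]; ring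
  simp_rw [hsplit]
  rw [integral_add ?_ i3, integral_add i4 ?_, integral_sub i1 i2, e1, e2, e3, e4]
  rotate_left
  · exact i1.sub i2
  · exact i4.add (i1.sub i2)
  ring

/-- If the estimating function has the right conditional mean given the covariates, then its mean
is the contrast of the front-door means. -/
lemma integral_drScore (h : IsBDTDLaw P) {aStar a : 𝒜} {Q w : 𝒵 → 𝒞 → ℝ} {μ π : 𝒜 → 𝒞 → ℝ}
    {τ : 𝒞 → ℝ} (hi : Integrable (drScore aStar a Q w μ π τ) P)
    (hs : ∀ b c, Summable fun z => Q z c * (trueNuisance P).mediator z b c)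
    (heq : ∀ c, ∑' z, ((trueNuisance P).outcome z c - Q z c) * w z c *
          ∑' b, (trueNuisance P).mediator z b c * (trueNuisance P).treatment b c
        + ((trueNuisance P).treatment aStar c / π aStar c *
            (∑' z, Q z c * (trueNuisance P).mediator z aStar c - μ aStar c)
          - (trueNuisance P).treatment a c / π a c *
            (∑' z, Q z c * (trueNuisance P).mediator z a c - μ a c)) + τ c
        = frontDoorMean P aStar c - frontDoorMean P a c) :
    ∫ x, drScore aStar a Q w μ π τ x ∂P
      = ∫ x, (frontDoorMean P aStar x.1 - frontDoorMean P a x.1) ∂P := by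
  have := h.isProb
  refine (integrable_comp_of_setIntegral_fiber (X := Prod.fst)
    (B := fun c => frontDoorMean P aStar c - frontDoorMean P a c) hi measurable_fst
    fun c => ?_).2.symm
  rw [h.setIntegral_drScore hi (fun b => hs b c), heq]

/-- Triple robustness: the estimating function is unbiased if two of the three nuisance functions
are correct. -/
lemma integral_mBDTD (h : IsBDTDLaw P) {aStar a : 𝒜} {η : Nuisance 𝒜 𝒵 𝒞}
    (hsum : ∀ b c, Summable fun z => η.outcome z c * η.mediator z b c)
    (hi : Integrable (mBDTD aStar a η) P)
    (hη : η.outcome = (trueNuisance P).outcome ∧ η.treatment = (trueNuisance P).treatment ∨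
      η.outcome = (trueNuisance P).outcome ∧ η.mediator = (trueNuisance P).mediator ∨
      η.mediator = (trueNuisance P).mediator ∧ η.treatment = (trueNuisance P).treatment) :
    ∫ x, mBDTD aStar a η x ∂P
      = ∫ x, (frontDoorMean P aStar x.1 - frontDoorMean P a x.1) ∂P := by
  have hfd := fun b c => h.hasSum_frontDoorMean b c
  -- The outcome model must be summable against the true mediator law. In each case one of the two
  -- factors is true, and the matching summability is available.
  have hs : ∀ b c, Summable fun z => η.outcome z c * (trueNuisance P).mediator z b c := by
    intro b c
    rcases hη with ⟨h1, -⟩ | ⟨h1, -⟩ | ⟨h1, -⟩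
    · rw [h1]; exact (hfd b c).summable
    · rw [h1]; exact (hfd b c).summable
    · rw [← h1]; exact hsum b c
  rw [mBDTD_eq_drScore] at hi ⊢
  refine h.integral_drScore hi hs fun c => ?_
  have hπ : ∀ b, (trueNuisance P).treatment b c / (trueNuisance P).treatment b c = 1 :=
    fun b => div_self (h.treatment_pos b c).ne'
  rw [Nuisance.contrast_eq (fun b => hsum b c)]
  -- Outcome and treatment true: the residual has mean zero and the correction replaces the modelled
  -- mediator means by the true ones. Outcome and mediator true: residual and correction both
  -- vanish. Mediator and treatment true: the correction vanishes, and the weight times p(z | c) is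
  -- p(z | a*, c) - p(z | a, c), so the residual repairs the outcome model.
  rcases hη with ⟨h1, h2⟩ | ⟨h1, h2⟩ | ⟨h1, h2⟩
  · simp only [h1, h2, sub_self, zero_mul, tsum_zero, hπ, (hfd _ c).tsum_eq]
    ring
  · simp only [h1, Nuisance.mean, h2, sub_self, zero_mul, tsum_zero, (hfd _ c).tsum_eq]
    ring
  · have h3 : ∀ z, ((trueNuisance P).outcome z c - η.outcome z c) * η.weight aStar a z c *
          ∑' b, (trueNuisance P).mediator z b c * (trueNuisance P).treatment b c
        = ((trueNuisance P).outcome z c * (trueNuisance P).mediator z aStar c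
            - (trueNuisance P).outcome z c * (trueNuisance P).mediator z a c)
          - (η.outcome z c * (trueNuisance P).mediator z aStar c
            - η.outcome z c * (trueNuisance P).mediator z a c) := by
      intro z
      have hm : 0 < ∑' b, (trueNuisance P).mediator z b c * (trueNuisance P).treatment b c := by
        rw [(h.hasSum_mix z c).tsum_eq]
        exact div_pos (h.cell_ZC_pos z c) (h.cell_C_pos c)
      rw [Nuisance.weight, h1, h2, mul_assoc, div_mul_cancel₀ _ hm.ne']
      ring
    simp_rw [h3]
    rw [(((hfd aStar c).summable.sub (hfd a c).summable)).tsum_sub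
        ((hs aStar c).sub (hs a c)), (hfd aStar c).summable.tsum_sub (hfd a c).summable,
        (hs aStar c).tsum_sub (hs a c)]
    simp only [h1, h2, hπ, Nuisance.mean, (hfd _ c).tsum_eq]
    ring

end IsBDTDLaw

end Moment

/-! ### Stochastic order -/

section StochasticOrder

variable {S : ℕ → Type*} [∀ n, MeasurableSpace (S n)] {μ : ∀ n, Measure (S n)}

lemma tendsto_zero_of_eventually_le {f g : ℕ → ℝ≥0∞} (hg : Tendsto g atTop (𝓝 0))
    (h : ∀ᶠ n in atTop, f n ≤ g n) : Tendsto f atTop (𝓝 0) :=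
  tendsto_of_tendsto_of_tendsto_of_le_of_le' tendsto_const_nhds hg
    (Eventually.of_forall fun _ => zero_le) h

lemma WithProbToOne.and {p q : ∀ n, S n → Prop} (hp : WithProbToOne μ p)
    (hq : WithProbToOne μ q) : WithProbToOne μ fun n w => p n w ∧ q n w := by
  have h := hp.add hq
  rw [add_zero] at h
  refine tendsto_zero_of_eventually_le h (Eventually.of_forall fun n => ?_)
  refine le_trans (measure_mono ?_) (measure_union_le _ _)
  intro w (hw : ¬(p n w ∧ q n w))
  by_cases hpw : p n w
  · exact Or.inr fun hqw => hw ⟨hpw, hqw⟩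
  · exact Or.inl hpw

lemma withProbToOne_of_ae {p : ∀ n, S n → Prop} (h : ∀ n, ∀ᵐ w ∂μ n, p n w) :
    WithProbToOne μ p := by
  have : (fun n => μ n {w | ¬ p n w}) = fun _ => 0 := funext fun n => h n
  rw [WithProbToOne, this]
  exact tendsto_const_nhds

lemma IsLittleOP.withProbToOne {R : ∀ n, S n → ℝ≥0∞} (h : IsLittleOP μ R) {ε : ℝ≥0∞}
    (hε : 0 < ε) : WithProbToOne μ fun n w => R n w < ε := by
  have := h ε hε
  simpa only [WithProbToOne, not_lt] using this

/-- Domination is only needed on good events and for large n. Nothing is assumed measurable, since μ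
is an outer measure on arbitrary sets. -/
lemma IsLittleOP.mono {R R' : ∀ n, S n → ℝ≥0∞} (h : IsLittleOP μ R') {p : ∀ n, S n → Prop}
    (hp : WithProbToOne μ p) (hle : ∀ᶠ n in atTop, ∀ w, p n w → R n w ≤ R' n w) :
    IsLittleOP μ R := by
  intro ε hε
  have := hp.and (h.withProbToOne hε)
  refine tendsto_zero_of_eventually_le this ?_
  filter_upwards [hle] with n hn
  refine measure_mono fun w (hw : ε ≤ R n w) hpw => ?_
  exact absurd (hw.trans (hn w hpw.1)) (not_le.2 hpw.2)

lemma IsLittleOP.of_le {R R' : ∀ n, S n → ℝ≥0∞} (h : IsLittleOP μ R')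
    (hle : ∀ᶠ n in atTop, ∀ w, R n w ≤ R' n w) : IsLittleOP μ R :=
  h.mono (p := fun _ _ => True) (withProbToOne_of_ae fun n => by simp)
    (hle.mono fun n hn w _ => hn w)

lemma IsLittleOP.add {R R' : ∀ n, S n → ℝ≥0∞} (h : IsLittleOP μ R) (h' : IsLittleOP μ R') :
    IsLittleOP μ fun n w => R n w + R' n w := by
  intro ε hε
  have hε2 : 0 < ε / 2 := ENNReal.half_pos hε.ne'
  refine tendsto_zero_of_eventually_le ((h.withProbToOne hε2).and (h'.withProbToOne hε2))
    (Eventually.of_forall fun n => measure_mono fun w (hw : ε ≤ R n w + R' n w) hlt => ?_)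
  have := ENNReal.add_lt_add hlt.1 hlt.2
  rw [ENNReal.add_halves] at this
  exact absurd hw (not_le.2 this)

lemma IsLittleOP.const_mul {R : ∀ n, S n → ℝ≥0∞} (h : IsLittleOP μ R) {C : ℝ≥0∞} (hC : C ≠ ∞) :
    IsLittleOP μ fun n w => C * R n w := by
  intro ε hε
  -- Dividing by C + 1 instead of C covers C = 0.
  have hC1 : C + 1 ≠ 0 := by simp
  have hC2 : C + 1 ≠ ∞ := by simp [hC]
  have hε' : 0 < ε / (C + 1) := ENNReal.div_pos hε.ne' hC2
  refine tendsto_zero_of_eventually_le (h _ hε') (Eventually.of_forall fun n => measure_mono ?_)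
  intro w (hw : ε ≤ C * R n w)
  refine ENNReal.div_le_of_le_mul ?_
  calc ε ≤ C * R n w := hw
    _ ≤ (C + 1) * R n w := by gcongr; exact le_self_add
    _ = R n w * (C + 1) := mul_comm _ _

lemma isLittleOP_enorm_iff {r : ∀ n, S n → ℝ} :
    IsLittleOP μ (fun n w => ‖r n w‖ₑ) ↔
      ∀ ε : ℝ, 0 < ε → Tendsto (fun n => μ n {w | ε ≤ |r n w|}) atTop (𝓝 0) := by
  have key : ∀ (ε : ℝ) (u : ℝ), 0 < ε → (ENNReal.ofReal ε ≤ ‖u‖ₑ ↔ ε ≤ |u|) := by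
    intro ε u hε
    rw [← ofReal_norm, ENNReal.ofReal_le_ofReal_iff (norm_nonneg _), Real.norm_eq_abs]
  constructor
  · intro h ε hε
    have := h (ENNReal.ofReal ε) (ENNReal.ofReal_pos.2 hε)
    simpa only [key ε _ hε] using this
  · intro h ε hε
    -- The threshold ε may be infinite, so a smaller finite one is used.
    obtain ⟨δ, hδ, hδε⟩ := ENNReal.lt_iff_exists_nnreal_btwn.1 hε
    have hδ' : (0 : ℝ) < δ := by exact_mod_cast hδ
    refine tendsto_zero_of_eventually_le (h δ hδ') (Eventually.of_forall fun n => measure_mono ?_)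
    intro w (hw : ε ≤ ‖r n w‖ₑ)
    exact (key δ _ hδ').1 (by simpa using hδε.le.trans hw)

end StochasticOrder

/-! ### Averages of independent observations -/

section Sample

variable {X : Type*} [MeasurableSpace X]

instance isProbabilityMeasure_sampleLaw (P : Measure X) [IsProbabilityMeasure P] (n k : ℕ) :
    IsProbabilityMeasure (sampleLaw P n k) := by
  unfold sampleLaw; infer_instance

/-- No measurability of `s` is required; the Donsker argument applies this to an event defined by an
existential over a class of functions. -/
lemma sampleLaw_fst_le (P : Measure X) [IsProbabilityMeasure P] (n k : ℕ) (s : Set (Fin n → X)) :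
    sampleLaw P n k {w | w.1 ∈ s} ≤ Measure.pi (fun _ : Fin n => P) s := by
  have : {w : Sample X n k | w.1 ∈ s} = s ×ˢ Set.univ := by ext; simp
  rw [this, sampleLaw, Measure.prod_prod]
  simp

lemma ae_sampleLaw (P : Measure X) [IsProbabilityMeasure P] (n k : ℕ) {p : X → Prop}
    (h : ∀ᵐ x ∂P, p x) : ∀ᵐ w ∂sampleLaw P n k, ∀ i, p (w.1 i) := by
  have h1 : ∀ᵐ w ∂Measure.pi (fun _ : Fin n => P), ∀ i, p (w i) := by
    rw [ae_all_iff]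
    intro i
    exact (measurePreserving_eval (fun _ : Fin n => P) i).quasiMeasurePreserving.ae h
  exact le_antisymm ((sampleLaw_fst_le P n k {w | ¬ ∀ i, p (w i)}).trans h1.le) zero_le

/-- The strong law lives on one infinite product; this carries its conclusion back to samples of
size n. -/
lemma map_infinitePi_fin (P : Measure X) [IsProbabilityMeasure P] (n : ℕ) :
    (Measure.infinitePi fun _ : ℕ => P).map (fun ω (i : Fin n) => ω i)
      = Measure.pi fun _ : Fin n => P := by
  refine (Measure.pi_eq fun s hs => ?_).symm
  have hm : Measurable (fun (ω : ℕ → X) (i : Fin n) => ω i) :=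
    measurable_pi_lambda _ fun i => measurable_pi_apply _
  rw [Measure.map_apply hm (MeasurableSet.univ_pi hs)]
  have h1 : (fun (ω : ℕ → X) (i : Fin n) => ω i) ⁻¹' (Set.univ.pi s)
      = Set.pi (Finset.range n) fun i => if h : i < n then s ⟨i, h⟩ else Set.univ := by
    ext ω
    simp only [Set.mem_preimage, Set.mem_pi, Set.mem_univ, true_implies, Finset.coe_range,
      Set.mem_Iio]
    constructor
    · intro h i hi
      simpa [hi] using h ⟨i, hi⟩
    · intro h i
      simpa using h i i.2
  rw [h1, Measure.infinitePi_pi (μ := fun _ : ℕ => P), ← Fin.prod_univ_eq_prod_range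
    (fun i => P (if h : i < n then s ⟨i, h⟩ else Set.univ))]
  · simp
  · intro i _
    split_ifs
    · exact hs _
    · exact MeasurableSet.univ

/-- The weak law of large numbers. -/
lemma isLittleOP_average (P : Measure X) [IsProbabilityMeasure P] (k : ℕ → ℕ) {f : X → ℝ}
    (hf : Integrable f P) :
    IsLittleOP (fun n => sampleLaw P n (k n))
      fun n w => ‖(n : ℝ)⁻¹ * ∑ i, f (w.1 i) - ∫ x, f x ∂P‖ₑ := by
  wlog hfm : StronglyMeasurable f generalizing f
  · have hae := hf.1.ae_eq_mk
    have h1 := this (f := hf.1.mk f) (hf.congr hae) hf.1.stronglyMeasurable_mk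
    refine h1.mono (withProbToOne_of_ae fun n => ae_sampleLaw P n (k n) hae)
      (Eventually.of_forall fun n w hw => ?_)
    simp only [hw, integral_congr_ae hae, le_refl]
  have hmeas : ∀ i : ℕ, Measurable fun ω : ℕ → X => f (ω i) :=
    fun i => hfm.measurable.comp (measurable_pi_apply i)
  have hmp : ∀ i : ℕ, MeasurePreserving (fun ω : ℕ → X => ω i)
      (Measure.infinitePi fun _ : ℕ => P) P :=
    fun i => measurePreserving_eval_infinitePi (fun _ : ℕ => P) i
  -- Almost sure convergence for one infinite sequence implies convergence in measure, and only the
  -- law of the first n coordinates enters the latter.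
  have hslln := strong_law_ae_real (μ := Measure.infinitePi fun _ : ℕ => P)
    (fun i ω => f (ω i)) ((hmp 0).integrable_comp_of_integrable hf)
    (fun i j hij => (iIndepFun_infinitePi (P := fun _ : ℕ => P) (X := fun _ => f)
      fun _ => hfm.measurable).indepFun hij)
    (fun i => ⟨(hmeas i).aemeasurable, (hmeas 0).aemeasurable, by
      rw [← Function.comp_def f, ← Function.comp_def f, ← Measure.map_map hfm.measurable
        (measurable_pi_apply i), ← Measure.map_map hfm.measurable (measurable_pi_apply 0),
        (hmp i).map_eq, (hmp 0).map_eq]⟩)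
  have hE : ∫ ω, f (ω 0) ∂(Measure.infinitePi fun _ : ℕ => P) = ∫ x, f x ∂P := by
    conv_rhs => rw [← (hmp 0).map_eq]
    exact (integral_map (hmp 0).measurable.aemeasurable hfm.aestronglyMeasurable).symm
  rw [hE] at hslln
  have hmeasure := tendstoInMeasure_of_tendsto_ae (fun n => by
    refine Measurable.aestronglyMeasurable ?_
    exact (Finset.measurable_sum _ fun i _ => hmeas i).div_const _) hslln
  rw [isLittleOP_enorm_iff]
  intro ε hε
  have h2 := (tendstoInMeasure_iff_norm.1 hmeasure) ε hε
  refine tendsto_zero_of_eventually_le h2 (Eventually.of_forall fun n => ?_)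
  have hms : MeasurableSet {w : Fin n → X | ε ≤ |(n : ℝ)⁻¹ * ∑ i, f (w i) - ∫ x, f x ∂P|} := by
    refine measurableSet_le measurable_const (Measurable.abs ?_)
    refine ((Finset.measurable_sum _ fun i _ => ?_).const_mul _).sub_const _
    exact hfm.measurable.comp (measurable_pi_apply i)
  refine (sampleLaw_fst_le P n (k n) {w | ε ≤ |(n : ℝ)⁻¹ * ∑ i, f (w i) - ∫ x, f x ∂P|}).trans ?_
  rw [← map_infinitePi_fin P n, Measure.map_apply (measurable_pi_lambda _ fun i =>
    measurable_pi_apply _) hms]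
  refine measure_mono fun ω hω => ?_
  simp only [Set.mem_preimage, Set.mem_ofPred_eq, Real.norm_eq_abs] at hω ⊢
  rwa [div_eq_inv_mul, ← Fin.sum_univ_eq_sum_range (fun i => f (ω i))]

/-- Chebyshev's inequality for the empirical process. -/
lemma pi_empirical_chebyshev (P : Measure X) [IsProbabilityMeasure P] {n : ℕ} {f : X → ℝ}
    (hf : MemLp f 2 P) {ε : ℝ} (hε : 0 < ε) :
    Measure.pi (fun _ : Fin n => P)
        {w | ε ≤ |(√(n : ℝ))⁻¹ * ∑ i, (f (w i) - ∫ x, f x ∂P)|}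
      ≤ ENNReal.ofReal (variance f P / ε ^ 2) := by
  rcases Nat.eq_zero_or_pos n with rfl | hn
  · simp [not_le.2 hε]
  have hn' : (0 : ℝ) < n := by exact_mod_cast hn
  have hmp : ∀ i : Fin n, MeasurePreserving (fun w : Fin n → X => w i)
      (Measure.pi fun _ : Fin n => P) P := fun i => measurePreserving_eval (fun _ : Fin n => P) i
  have hL : ∀ i : Fin n, MemLp (fun w : Fin n → X => f (w i)) 2 (Measure.pi fun _ : Fin n => P) :=
    fun i => hf.comp_measurePreserving (hmp i)
  have hmean : ∀ i : Fin n, ∫ w, f (w i) ∂(Measure.pi fun _ : Fin n => P) = ∫ x, f x ∂P :=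
    fun i => integral_comp_eval (μ := fun _ : Fin n => P) hf.1
  have hvar : variance (∑ i, fun w : Fin n → X => f (w i)) (Measure.pi fun _ : Fin n => P)
      = n * variance f P := by
    rw [variance_sum_pi (μ := fun _ : Fin n => P) (X := fun _ => f) fun _ => hf]
    simp
  have hsumL : MemLp (∑ i, fun w : Fin n → X => f (w i)) 2 (Measure.pi fun _ : Fin n => P) :=
    memLp_finsetSum' _ fun i _ => hL i
  -- The sum has variance n times that of f, so the threshold √n ε cancels the n.
  have hch := meas_ge_le_variance_div_sq hsumL (c := √(n : ℝ) * ε) (by positivity)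
  rw [hvar, mul_pow, Real.sq_sqrt hn'.le, mul_div_mul_left _ _ hn'.ne'] at hch
  refine le_trans (measure_mono fun w hw => ?_) hch
  have h2 : ∫ w, (∑ i, fun w : Fin n → X => f (w i)) w ∂(Measure.pi fun _ : Fin n => P)
      = n * ∫ x, f x ∂P := by
    simp only [Finset.sum_apply]
    rw [integral_finsetSum _ fun i _ => (hL i).integrable one_le_two]
    simp [hmean]
  simp only [Set.mem_ofPred_eq] at hw ⊢
  rw [h2, Finset.sum_apply]
  simp only [Finset.sum_sub_distrib, Finset.sum_const, Finset.card_univ, Fintype.card_fin,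
    nsmul_eq_mul, abs_mul, abs_inv, abs_of_nonneg (Real.sqrt_nonneg _)] at hw
  rwa [← div_eq_inv_mul, le_div_iff₀' (by positivity)] at hw

end Sample

/-! ### Consistency -/

section Consistency

variable {𝒜 𝒵 𝒞 : Type*}

lemma SolvesEstimatingEquation.eq_average {aStar a : 𝒜} {k : ℕ → ℕ}
    {ηhat : ∀ n, Sample (Obs 𝒜 𝒵 𝒞) n (k n) → Nuisance 𝒜 𝒵 𝒞}
    {θhat : ∀ n, Sample (Obs 𝒜 𝒵 𝒞) n (k n) → ℝ}
    (h : SolvesEstimatingEquation aStar a k ηhat θhat) {n : ℕ} (hn : 0 < n)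
    (w : Sample (Obs 𝒜 𝒵 𝒞) n (k n)) :
    θhat n w = (n : ℝ)⁻¹ * ∑ i, mBDTD aStar a (ηhat n w) (w.1 i) := by
  have h1 := h n hn w
  have hn' : (n : ℝ) ≠ 0 := by exact_mod_cast hn.ne'
  simp only [phiBDTD, Finset.sum_sub_distrib, Finset.sum_const, Finset.card_univ,
    Fintype.card_fin, nsmul_eq_mul, mul_sub, inv_mul_cancel_left₀ hn'] at h1
  linarith

variable [MeasurableSpace 𝒜] [MeasurableSpace 𝒵] [MeasurableSpace 𝒞]

/-- The estimator is consistent for the mean of the limiting estimating function. -/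
lemma ConsistencyConditions.isLittleOP {E : Type*} [NormedAddCommGroup E] [NormedSpace ℝ E]
    {P : Measure (Obs 𝒜 𝒵 𝒞)} [IsProbabilityMeasure P] {aStar a : 𝒜} {k : ℕ → ℕ}
    {ηhat : ∀ n, Sample (Obs 𝒜 𝒵 𝒞) n (k n) → Nuisance 𝒜 𝒵 𝒞}
    {θhat : ∀ n, Sample (Obs 𝒜 𝒵 𝒞) n (k n) → ℝ}
    (hθ : SolvesEstimatingEquation aStar a k ηhat θhat)
    {ν : E → Nuisance 𝒜 𝒵 𝒞} {βhat : ∀ n, Sample (Obs 𝒜 𝒵 𝒞) n (k n) → E} {βbar : E}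
    (h : ConsistencyConditions P aStar a k ηhat ν βhat βbar) :
    IsLittleOP (fun n => sampleLaw P n (k n))
      fun n w => ‖θhat n w - ∫ x, mBDTD aStar a (ν βbar) x ∂P‖ₑ := by
  obtain ⟨U, hU, D, hD, hdom⟩ := h.dominated
  obtain ⟨r, hr, hrU⟩ := Metric.mem_nhds_iff.1 hU
  have hD0 : 0 ≤ ∫ x, D x ∂P := by
    refine integral_nonneg_of_ae ?_
    filter_upwards [hdom] with x hx
    exact (norm_nonneg _).trans (hx βbar (mem_of_mem_nhds hU)).2
  -- Mean value inequality on a ball: U itself need not be convex.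
  have hlip : ∀ᵐ x ∂P, ∀ β ∈ Metric.ball βbar r,
      |mBDTD aStar a (ν β) x - mBDTD aStar a (ν βbar) x| ≤ D x * ‖β - βbar‖ := by
    filter_upwards [hdom] with x hx β hβ
    exact (convex_ball βbar r).norm_image_sub_le_of_norm_fderiv_le (𝕜 := ℝ)
      (f := fun b => mBDTD aStar a (ν b) x)
      (fun b hb => (hx b (hrU hb)).1) (fun b hb => (hx b (hrU hb)).2)
      (Metric.mem_ball_self hr) hβ
  -- The average of D is at most ∫ D + 1 with probability tending to one, which makes the Lipschitz
  -- constant of the averaged estimating function deterministic.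
  have hbound := (h.convergence.const_mul (C := ENNReal.ofReal (∫ x, D x ∂P + 1))
    ENNReal.ofReal_ne_top).add (isLittleOP_average P k h.integrable)
  refine hbound.mono (p := fun n w => ((∀ i, ∀ β ∈ Metric.ball βbar r,
      |mBDTD aStar a (ν β) (w.1 i) - mBDTD aStar a (ν βbar) (w.1 i)| ≤ D (w.1 i) * ‖β - βbar‖) ∧
      ‖βhat n w - βbar‖ₑ < ENNReal.ofReal r) ∧
      ‖(n : ℝ)⁻¹ * ∑ i, D (w.1 i) - ∫ x, D x ∂P‖ₑ < 1)
    (((withProbToOne_of_ae fun n => ae_sampleLaw P n (k n) hlip).and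
      (h.convergence.withProbToOne (ENNReal.ofReal_pos.2 hr))).and
      ((isLittleOP_average P k hD).withProbToOne one_pos)) ?_
  filter_upwards [eventually_gt_atTop 0] with n hn w hw
  obtain ⟨⟨hL, hβ⟩, hDw⟩ := hw
  have hn' : (0 : ℝ) < n := by exact_mod_cast hn
  have hβ' : βhat n w ∈ Metric.ball βbar r := by
    rw [← ofReal_norm, ENNReal.ofReal_lt_ofReal_iff hr] at hβ
    rwa [mem_ball_iff_norm]
  have hDw' : (n : ℝ)⁻¹ * ∑ i, D (w.1 i) ≤ ∫ x, D x ∂P + 1 := by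
    rw [← ofReal_norm, ← ENNReal.ofReal_one, ENNReal.ofReal_lt_ofReal_iff one_pos,
      Real.norm_eq_abs] at hDw
    linarith [(abs_lt.1 hDw).2]
  have key : |θhat n w - ∫ x, mBDTD aStar a (ν βbar) x ∂P|
      ≤ (∫ x, D x ∂P + 1) * ‖βhat n w - βbar‖
        + |(n : ℝ)⁻¹ * ∑ i, mBDTD aStar a (ν βbar) (w.1 i)
          - ∫ x, mBDTD aStar a (ν βbar) x ∂P| := by
    have h1 : |(n : ℝ)⁻¹ * ∑ i, (mBDTD aStar a (ν (βhat n w)) (w.1 i)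
        - mBDTD aStar a (ν βbar) (w.1 i))| ≤ (∫ x, D x ∂P + 1) * ‖βhat n w - βbar‖ := by
      calc _ ≤ (n : ℝ)⁻¹ * ∑ i, D (w.1 i) * ‖βhat n w - βbar‖ := by
            rw [abs_mul, abs_of_pos (inv_pos.2 hn')]
            gcongr
            exact (Finset.abs_sum_le_sum_abs _ _).trans
              (Finset.sum_le_sum fun i _ => hL i _ hβ')
        _ = ((n : ℝ)⁻¹ * ∑ i, D (w.1 i)) * ‖βhat n w - βbar‖ := by
            rw [← Finset.sum_mul, mul_assoc]
        _ ≤ _ := by gcongr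
    rw [hθ.eq_average hn w, h.estimator n w]
    rw [Finset.sum_sub_distrib, mul_sub] at h1
    refine le_trans ?_ (add_le_add_left h1 _)
    refine le_trans (le_of_eq ?_) (abs_add_le _ _)
    congr 1
    ring
  rw [← ofReal_norm, ← ofReal_norm, ← ofReal_norm, ← ENNReal.ofReal_mul (by positivity),
    ← ENNReal.ofReal_add (by positivity) (by positivity)]
  exact ENNReal.ofReal_le_ofReal key

end Consistency

/-! ### Triple robustness of the estimator. -/

section Robust

variable {𝒜 𝒵 𝒞 : Type*} [Countable 𝒜] [Countable 𝒵] [Countable 𝒞]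
    [MeasurableSpace 𝒜] [MeasurableSpace 𝒵] [MeasurableSpace 𝒞]
    [MeasurableSingletonClass 𝒜] [MeasurableSingletonClass 𝒵] [MeasurableSingletonClass 𝒞]

lemma CausalModel.IsBDTD.integral_mBDTD {M : CausalModel 𝒜 𝒵 𝒞} (hM : M.IsBDTD)
    {aStar a : 𝒜} {η : Nuisance 𝒜 𝒵 𝒞}
    (hsum : ∀ b c, Summable fun z => η.outcome z c * η.mediator z b c)
    (hi : Integrable (mBDTD aStar a η) M.obsLaw)
    (hη : η.outcome = (trueNuisance M.obsLaw).outcome ∧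
        η.treatment = (trueNuisance M.obsLaw).treatment ∨
      η.outcome = (trueNuisance M.obsLaw).outcome ∧
        η.mediator = (trueNuisance M.obsLaw).mediator ∨
      η.mediator = (trueNuisance M.obsLaw).mediator ∧
        η.treatment = (trueNuisance M.obsLaw).treatment) :
    ∫ x, mBDTD aStar a η x ∂M.obsLaw = M.ace aStar a := by
  rw [hM.isBDTDLaw.integral_mBDTD hsum hi hη, (hM.ace_eq aStar a).2]

/-- Triple robustness of the estimator. -/
theorem CausalModel.IsBDTD.consistent {M : CausalModel 𝒜 𝒵 𝒞} (hM : M.IsBDTD)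
    {aStar a : 𝒜} {k : ℕ → ℕ}
    {ηhat : ∀ n, Sample (Obs 𝒜 𝒵 𝒞) n (k n) → Nuisance 𝒜 𝒵 𝒞}
    {θhat : ∀ n, Sample (Obs 𝒜 𝒵 𝒞) n (k n) → ℝ}
    (hθ : SolvesEstimatingEquation aStar a k ηhat θhat)
    {E : Type*} [NormedAddCommGroup E] [NormedSpace ℝ E]
    {ν : E → Nuisance 𝒜 𝒵 𝒞} {βhat : ∀ n, Sample (Obs 𝒜 𝒵 𝒞) n (k n) → E} {βbar : E}
    (h : ConsistencyConditions M.obsLaw aStar a k ηhat ν βhat βbar)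
    (hη : (ν βbar).outcome = (trueNuisance M.obsLaw).outcome ∧
        (ν βbar).treatment = (trueNuisance M.obsLaw).treatment ∨
      (ν βbar).outcome = (trueNuisance M.obsLaw).outcome ∧
        (ν βbar).mediator = (trueNuisance M.obsLaw).mediator ∨
      (ν βbar).mediator = (trueNuisance M.obsLaw).mediator ∧
        (ν βbar).treatment = (trueNuisance M.obsLaw).treatment) :
    IsLittleOP (fun n => sampleLaw M.obsLaw n (k n)) fun n w => ‖θhat n w - M.ace aStar a‖ₑ := by
  rw [← hM.integral_mBDTD h.summable h.integrable hη]
  exact h.isLittleOP hθ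

end Robust

/-! ### The empirical process at an estimated function -/

section EmpiricalDeviation

variable {X : Type*} [MeasurableSpace X]

/-- The empirical process `√n (Pₙ - P) f`. -/
noncomputable def empiricalDeviation (P : Measure X) {n : ℕ} (w : Fin n → X) (f : X → ℝ) : ℝ :=
  (√(n : ℝ))⁻¹ * ∑ i, (f (w i) - ∫ x, f x ∂P)

lemma empiricalDeviation_sub {P : Measure X} {n : ℕ} (w : Fin n → X) {f g : X → ℝ}
    (hf : Integrable f P) (hg : Integrable g P) :
    empiricalDeviation P w (fun x => f x - g x) = empiricalDeviation P w f - empiricalDeviation P w g := by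
  simp only [empiricalDeviation, integral_sub hf hg, ← mul_sub, ← Finset.sum_sub_distrib]
  congr 1
  exact Finset.sum_congr rfl fun i _ => by ring

lemma variance_le_eLpNorm_sq {P : Measure X} [IsProbabilityMeasure P] {f : X → ℝ}
    (hf : MemLp f 2 P) : variance f P ≤ (eLpNorm f 2 P).toReal ^ 2 := by
  refine (variance_le_expectation_sq hf.1).trans (le_of_eq ?_)
  have h1 := hf.eLpNorm_eq_integral_rpow_norm two_ne_zero ENNReal.ofNat_ne_top
  have h0 : 0 ≤ ∫ x, ‖f x‖ ^ (2 : ℝ) ∂P := integral_nonneg fun x => by positivity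
  rw [h1, ENNReal.toReal_ofReal (by positivity)]
  simp only [ENNReal.toReal_ofNat] at *
  rw [← Real.rpow_natCast, ← Real.rpow_mul h0]
  simp [sq_abs]

lemma pi_empiricalDeviation_le (P : Measure X) [IsProbabilityMeasure P] {n : ℕ} {f : X → ℝ}
    (hf : MemLp f 2 P) {ε δ : ℝ} (hε : 0 < ε) (hδ : eLpNorm f 2 P ≤ ENNReal.ofReal δ)
    (hδ0 : 0 ≤ δ) :
    Measure.pi (fun _ : Fin n => P) {w | ε ≤ |empiricalDeviation P w f|}
      ≤ ENNReal.ofReal ((δ / ε) ^ 2) := by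
  refine (pi_empirical_chebyshev P hf hε).trans (ENNReal.ofReal_le_ofReal ?_)
  rw [div_pow]
  gcongr
  refine (variance_le_eLpNorm_sq hf).trans ?_
  gcongr
  exact ENNReal.toReal_le_of_le_ofReal hδ0 hδ

/-- Sample splitting: the empirical process at a function that is estimated from independent
data. -/
lemma isLittleOP_empiricalDeviation_of_split (P : Measure X) [IsProbabilityMeasure P] {k : ℕ → ℕ}
    {G : ∀ n, (Fin (k n) → X) → X → ℝ} (hG : ∀ n, Measurable (Function.uncurry (G n)))
    (h : IsLittleOP (fun n => sampleLaw P n (k n)) fun n w => eLpNorm (G n w.2) 2 P) :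
    IsLittleOP (fun n => sampleLaw P n (k n))
      fun n w => ‖empiricalDeviation P w.1 (G n w.2)‖ₑ := by
  rw [isLittleOP_enorm_iff]
  intro ε hε
  rw [ENNReal.tendsto_nhds_zero]
  intro η hη
  obtain ⟨δ, hδ, hδη⟩ : ∃ δ : ℝ, 0 < δ ∧ ENNReal.ofReal ((δ / ε) ^ 2) < η := by
    have : Tendsto (fun δ : ℝ => ENNReal.ofReal ((δ / ε) ^ 2)) (𝓝[>] 0) (𝓝 0) := by
      have h1 : Continuous fun δ : ℝ => ENNReal.ofReal ((δ / ε) ^ 2) :=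
        ENNReal.continuous_ofReal.comp (by fun_prop)
      have h2 := h1.tendsto 0
      simp only [zero_div, ne_eq, OfNat.ofNat_ne_zero, not_false_eq_true, zero_pow,
        ENNReal.ofReal_zero] at h2
      exact h2.mono_left nhdsWithin_le_nhds
    have := (this.eventually (gt_mem_nhds hη)).and self_mem_nhdsWithin
    obtain ⟨δ, h1, h2⟩ := this.exists
    exact ⟨δ, h2, h1⟩
  have hGn : ∀ n v, Measurable (G n v) := fun n v => (hG n).comp measurable_prodMk_left
  have hnorm : ∀ n, Measurable fun v : Fin (k n) → X => eLpNorm (G n v) 2 P := by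
    intro n
    simp_rw [eLpNorm_eq_lintegral_rpow_enorm_toReal two_ne_zero ENNReal.ofNat_ne_top]
    exact (Measurable.lintegral_prod_right' (f := fun p : (Fin (k n) → X) × X =>
      ‖G n p.1 p.2‖ₑ ^ (2 : ℝ≥0∞).toReal) ((hG n).enorm.pow_const _)).pow_const _
  have hint : ∀ n, Measurable fun v : Fin (k n) → X => ∫ x, G n v x ∂P := by
    intro n
    exact (StronglyMeasurable.integral_prod_right (hG n).stronglyMeasurable).measurable
  have hproc : ∀ n, Measurable fun w : Sample X n (k n) => empiricalDeviation P w.1 (G n w.2) := by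
    intro n
    refine (Finset.measurable_sum _ fun i _ => Measurable.sub ?_ ?_).const_mul _
    · exact (hG n).comp (measurable_snd.prodMk ((measurable_pi_apply i).comp measurable_fst))
    · exact (hint n).comp measurable_snd
  -- The bad event is cut down to auxiliary samples for which the estimated function has small norm.
  -- The result is measurable, so Fubini applies: with the auxiliary sample held fixed, Chebyshev's
  -- inequality bounds its sections.
  set B : ∀ n, Set (Sample X n (k n)) := fun n =>
    {w | eLpNorm (G n w.2) 2 P ≤ ENNReal.ofReal δ ∧ ε ≤ |empiricalDeviation P w.1 (G n w.2)|} with hB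
  have hBm : ∀ n, MeasurableSet (B n) := fun n =>
    (measurableSet_le ((hnorm n).comp measurable_snd) measurable_const).inter
      (measurableSet_le measurable_const (hproc n).abs)
  have hBle : ∀ n, sampleLaw P n (k n) (B n) ≤ ENNReal.ofReal ((δ / ε) ^ 2) := by
    intro n
    rw [sampleLaw, Measure.prod_apply_symm (hBm n)]
    calc _ ≤ ∫⁻ _ : Fin (k n) → X, ENNReal.ofReal ((δ / ε) ^ 2) ∂(Measure.pi fun _ => P) := by
          refine lintegral_mono fun v => ?_
          by_cases hv : eLpNorm (G n v) 2 P ≤ ENNReal.ofReal δ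
          · have hmem : MemLp (G n v) 2 P :=
              ⟨(hGn n v).aestronglyMeasurable, hv.trans_lt ENNReal.ofReal_lt_top⟩
            exact (measure_mono fun w hw => hw.2).trans (pi_empiricalDeviation_le P hmem hε hv hδ.le)
          · have : (fun x : Fin n → X => (x, v)) ⁻¹' B n = ∅ := by
              ext w
              simp [hB, hv]
            simp [this]
      _ = _ := by simp
  have h2 := (h.withProbToOne (ENNReal.ofReal_pos.2 hδ))
  have h3 : Tendsto (fun n => sampleLaw P n (k n) {w | ¬ eLpNorm (G n w.2) 2 P < ENNReal.ofReal δ}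
      + ENNReal.ofReal ((δ / ε) ^ 2)) atTop (𝓝 (0 + ENNReal.ofReal ((δ / ε) ^ 2))) :=
    Tendsto.add h2 tendsto_const_nhds
  rw [zero_add] at h3
  filter_upwards [h3.eventually (gt_mem_nhds hδη)] with n hn
  refine le_trans ?_ hn.le
  calc _ ≤ sampleLaw P n (k n) ({w | ¬ eLpNorm (G n w.2) 2 P < ENNReal.ofReal δ} ∪ B n) := by
        refine measure_mono fun w hw => ?_
        by_cases hlt : eLpNorm (G n w.2) 2 P < ENNReal.ofReal δ
        · exact Or.inr ⟨hlt.le, hw⟩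
        · exact Or.inl hlt
    _ ≤ _ := (measure_union_le _ _).trans (by gcongr; exact hBle n)

/-- The oscillation of a bounded function over pairs at distance less than `δ`. -/
noncomputable def modulus {ι : Type*} (ρ : ι → ι → ℝ) (δ : ℝ) (z : EllInf ι) : ℝ :=
  ⨆ p : {p : ι × ι // ρ p.1 p.2 < δ}, |z p.1.1 - z p.1.2|

section Oscillation

variable {ι : Type*} {ρ : ι → ι → ℝ} {δ : ℝ}

lemma abs_sub_le_two_norm (z : EllInf ι) (i j : ι) : |z i - z j| ≤ 2 * ‖z‖ := by
  have hi := lp.norm_apply_le_norm ENNReal.top_ne_zero z i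
  have hj := lp.norm_apply_le_norm ENNReal.top_ne_zero z j
  rw [Real.norm_eq_abs] at hi hj
  linarith [abs_sub (z i) (z j)]

lemma le_modulus (z : EllInf ι) {i j : ι} (hij : ρ i j < δ) :
    |z i - z j| ≤ modulus ρ δ z :=
  le_ciSup (f := fun p : {p : ι × ι // ρ p.1 p.2 < δ} => |z p.1.1 - z p.1.2|)
    ⟨2 * ‖z‖, by rintro _ ⟨p, rfl⟩; exact abs_sub_le_two_norm z _ _⟩ ⟨(i, j), hij⟩

lemma modulus_nonneg (z : EllInf ι) : 0 ≤ modulus ρ δ z :=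
  Real.iSup_nonneg fun _ => abs_nonneg _

lemma modulus_le {z : EllInf ι} {ε : ℝ} (hε : 0 ≤ ε) (h : ∀ i j, ρ i j < δ → |z i - z j| ≤ ε) :
    modulus ρ δ z ≤ ε :=
  Real.iSup_le (fun p => h _ _ p.2) hε

/-- Weak convergence in ℓ^∞ is tested on continuous functions only; the oscillation qualifies
because it is 2-Lipschitz for the supremum norm. -/
lemma continuous_modulus : Continuous (modulus ρ δ) := by
  have key : ∀ z z' : EllInf ι, modulus ρ δ z ≤ modulus ρ δ z' + 2 * dist z z' := by
    intro z z'
    refine modulus_le (add_nonneg (modulus_nonneg z') (by positivity)) fun i j hij => ?_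
    have h1 := le_modulus (δ := δ) z' hij
    have h2 := abs_sub_le_two_norm (z - z') i j
    rw [← dist_eq_norm] at h2
    have h3 : z i - z j = (z' i - z' j) + ((z - z') i - (z - z') j) := by
      simp only [lp.coeFn_sub, Pi.sub_apply]; ring
    rw [h3]
    exact (abs_add_le _ _).trans (add_le_add h1 h2)
  exact (LipschitzWith.of_le_add_mul 2 key).continuous

end Oscillation

/-- Markov's inequality for outer expectations, without measurability of `s` or `f`. -/
lemma outerExp_ge_measure {α : Type*} [MeasurableSpace α] (μ : Measure α) {f : α → ℝ≥0∞}
    {s : Set α} (h : ∀ x ∈ s, 1 ≤ f x) : μ s ≤ outerExp μ f := by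
  refine le_iInf fun g => le_iInf fun hg => le_iInf fun hfg => ?_
  calc μ s ≤ μ {x | 1 ≤ g x} := measure_mono fun x hx => (h x hx).trans (hfg x)
    _ ≤ ∫⁻ x, g x ∂μ := by simpa using mul_meas_ge_le_lintegral (μ := μ) hg 1

/-- The empirical process over a Donsker class is asymptotically equicontinuous. -/
lemma IsDonsker.equicontinuous {P : Measure X} {𝓕 : Set (X → ℝ)} (h : IsDonsker P 𝓕) {ε : ℝ}
    (hε : 0 < ε) {η : ℝ≥0∞} (hη : 0 < η) :
    ∃ δ : ℝ, 0 < δ ∧ ∀ᶠ n in atTop, Measure.pi (fun _ : Fin n => P)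
      {w | ∃ f ∈ 𝓕, ∃ g ∈ 𝓕, √(variance (fun x => f x - g x) P) < δ ∧
        ε ≤ |empiricalDeviation P w f - empiricalDeviation P w g|} ≤ η := by
  obtain ⟨-, G, hG, μ, hμ, -, -, huc, hweak⟩ := h
  set ρ : 𝓕 → 𝓕 → ℝ := fun f g => √(variance (fun x => f.1 x - g.1 x) P) with hρ
  -- A bounded continuous substitute for the indicator that the oscillation reaches ε: it equals 1
  -- there.
  set H : ℝ → EllInf 𝓕 → ℝ≥0 := fun δ z => Real.toNNReal (min 1 (modulus ρ δ z / ε)) with hH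
  have hHc : ∀ δ, Continuous (H δ) := fun δ =>
    continuous_real_toNNReal.comp (continuous_const.min (continuous_modulus.div_const _))
  have hH1 : ∀ δ z, H δ z ≤ 1 := by
    intro δ z
    rw [hH, Real.toNNReal_le_one]
    exact min_le_left _ _
  -- Under the limit process almost every path is uniformly continuous, so its oscillation tends to
  -- 0 with δ; H ≤ 1 gives the domination.
  have hlim : Tendsto (fun m : ℕ => ∫⁻ z, (H (1 / (m + 1 : ℝ)) z : ℝ≥0∞) ∂μ) atTop (𝓝 0) := by
    have h0 : ∫⁻ _ : EllInf 𝓕, (0 : ℝ≥0∞) ∂μ = 0 := by simp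
    rw [← h0]
    refine tendsto_lintegral_of_dominated_convergence (fun _ => 1)
      (fun m => (measurable_coe_nnreal_ennreal.comp (hHc _).measurable))
      (fun m => ae_of_all _ fun z => ?_) (by simp) ?_
    · exact ENNReal.coe_le_one_iff.2 (hH1 _ z)
    filter_upwards [huc] with z hz
    rw [← ENNReal.coe_zero, ENNReal.tendsto_coe]
    have h1 : Tendsto (fun m : ℕ => modulus ρ (1 / (m + 1 : ℝ)) z) atTop (𝓝 0) := by
      rw [Metric.tendsto_atTop]
      intro e he
      obtain ⟨δ, hδ, hδz⟩ := hz (e / 2) (by positivity)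
      obtain ⟨N, hN⟩ := exists_nat_one_div_lt hδ
      refine ⟨N, fun m hm => ?_⟩
      rw [Real.dist_eq, sub_zero, abs_of_nonneg (modulus_nonneg z)]
      refine (modulus_le (ε := e / 2) (by positivity) fun f g hfg => ?_).trans_lt
        (by linarith)
      refine (hδz f g (hfg.trans (lt_of_le_of_lt ?_ hN))).le
      exact one_div_le_one_div_of_le (by positivity) (by exact_mod_cast Nat.succ_le_succ hm)
    have h2 : Tendsto (fun m : ℕ => H (1 / (m + 1 : ℝ)) z) atTop
        (𝓝 (Real.toNNReal (min 1 (0 / ε)))) :=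
      (continuous_real_toNNReal.tendsto _).comp (tendsto_const_nhds.min (h1.div_const _))
    simpa using h2
  obtain ⟨m, hm⟩ := (hlim.eventually (gt_mem_nhds hη)).exists
  refine ⟨1 / (m + 1 : ℝ), by positivity, ?_⟩
  filter_upwards [(hweak _ (hHc (1 / (m + 1 : ℝ))) ⟨1, hH1 _⟩).eventually (gt_mem_nhds hm)]
    with n hn
  refine le_trans (outerExp_ge_measure _ ?_) hn.le
  rintro w ⟨f, hf, g, hg, hfg, hle⟩
  have h1 := le_modulus (ρ := ρ) (G n w) (i := ⟨f, hf⟩) (j := ⟨g, hg⟩) hfg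
  rw [hG, hG] at h1
  have h2 : ε ≤ modulus ρ (1 / (m + 1 : ℝ)) (G n w) := hle.trans h1
  have h3 : H (1 / (m + 1 : ℝ)) (G n w) = 1 := by
    simp only [hH]
    rw [min_eq_left ((one_le_div hε).2 h2), Real.toNNReal_one]
  simp only [h3, ENNReal.coe_one, le_refl]

/-- The empirical process at a function estimated within a Donsker class. -/
lemma isLittleOP_empiricalDeviation_of_donsker (P : Measure X) [IsProbabilityMeasure P] {k : ℕ → ℕ}
    {𝓕 : Set (X → ℝ)} (h𝓕 : IsDonsker P 𝓕) {f : ∀ n, Sample X n (k n) → X → ℝ} {f₀ : X → ℝ}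
    (hf₀ : MemLp f₀ 2 P)
    (hmem : WithProbToOne (fun n => sampleLaw P n (k n)) fun n w => f n w ∈ 𝓕)
    (h : IsLittleOP (fun n => sampleLaw P n (k n))
      fun n w => eLpNorm (fun x => f n w x - f₀ x) 2 P) :
    IsLittleOP (fun n => sampleLaw P n (k n))
      fun n w => ‖empiricalDeviation P w.1 (fun x => f n w x - f₀ x)‖ₑ := by
  rw [isLittleOP_enorm_iff]
  intro ε hε
  rw [ENNReal.tendsto_nhds_zero]
  intro η hη
  have hη3 : 0 < η / 3 := ENNReal.div_pos hη.ne' (by simp)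
  obtain ⟨δ, hδ, hequi⟩ := h𝓕.equicontinuous (half_pos hε) hη3
  obtain ⟨r, hr, hrη⟩ : ∃ r : ℝ, 0 < r ∧ ENNReal.ofReal ((r / (ε / 2)) ^ 2) ≤ η / 3 := by
    have h1 : Continuous fun r : ℝ => ENNReal.ofReal ((r / (ε / 2)) ^ 2) :=
      ENNReal.continuous_ofReal.comp (by fun_prop)
    have h2 := (h1.tendsto 0).mono_left (nhdsWithin_le_nhds (s := Set.Ioi 0))
    simp only [zero_div, ne_eq, OfNat.ofNat_ne_zero, not_false_eq_true, zero_pow,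
      ENNReal.ofReal_zero] at h2
    obtain ⟨r, hr1, hr2⟩ := ((h2.eventually (gt_mem_nhds hη3)).and self_mem_nhdsWithin).exists
    exact ⟨r, hr2, hr1.le⟩
  -- The bound r serves Chebyshev's inequality for `g - f₀`; the bound δ / 3 makes 2s < δ, so two
  -- functions within s of `f₀` lie within the equicontinuity radius.
  set s : ℝ := min r (δ / 3) with hs
  have hs0 : 0 < s := lt_min hr (by positivity)
  have hgood := hmem.and (h.withProbToOne (ENNReal.ofReal_pos.2 hs0))
  -- The limit `f₀` need not belong to 𝓕, so equicontinuity cannot be used at `f₀`. A fixed member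
  -- of 𝓕 near it takes its place; one exists because the good event has positive probability for
  -- some n.
  obtain ⟨g, hg, hgs⟩ : ∃ g ∈ 𝓕, eLpNorm (fun x => g x - f₀ x) 2 P < ENNReal.ofReal s := by
    obtain ⟨n, hn⟩ := (hgood.eventually (gt_mem_nhds one_pos)).exists
    by_contra! hcon
    have : {w : Sample X n (k n) | ¬(f n w ∈ 𝓕 ∧
        eLpNorm (fun x => f n w x - f₀ x) 2 P < ENNReal.ofReal s)} = Set.univ := by
      ext w
      simpa using fun hw => hcon _ hw
    rw [this, measure_univ] at hn
    exact lt_irrefl _ hn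
  have hgL : MemLp (fun x => g x - f₀ x) 2 P := (h𝓕.1 g hg).2.sub hf₀
  filter_upwards [hequi, (ENNReal.tendsto_nhds_zero.1 hgood) _ hη3] with n hn1 hn2
  set E : Set (Fin n → X) := {w | ∃ f ∈ 𝓕, ∃ g ∈ 𝓕, √(variance (fun x => f x - g x) P) < δ ∧
        ε / 2 ≤ |empiricalDeviation P w f - empiricalDeviation P w g|} with hE
  set E' : Set (Fin n → X) := {w | ε / 2 ≤ |empiricalDeviation P w fun x => g x - f₀ x|} with hE'
  have hE'le : Measure.pi (fun _ : Fin n => P) E' ≤ η / 3 := by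
    refine (pi_empiricalDeviation_le P hgL (half_pos hε) (δ := r) ?_ hr.le).trans hrη
    exact hgs.le.trans (ENNReal.ofReal_le_ofReal (min_le_left _ _))
  have hsub : {w : Sample X n (k n) | ε ≤ |empiricalDeviation P w.1 fun x => f n w x - f₀ x|} ⊆
      {w | ¬(f n w ∈ 𝓕 ∧ eLpNorm (fun x => f n w x - f₀ x) 2 P < ENNReal.ofReal s)} ∪
        ({w | w.1 ∈ E} ∪ {w | w.1 ∈ E'}) := by
    intro w hw
    by_cases hgw : f n w ∈ 𝓕 ∧ eLpNorm (fun x => f n w x - f₀ x) 2 P < ENNReal.ofReal s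
    swap
    · exact Or.inl hgw
    right
    have hfL := (h𝓕.1 _ hgw.1).2
    have hgL' := (h𝓕.1 _ hg).2
    have e1 := empiricalDeviation_sub w.1 (hfL.integrable one_le_two) (hf₀.integrable one_le_two)
    have e2 := empiricalDeviation_sub w.1 (hgL'.integrable one_le_two) (hf₀.integrable one_le_two)
    by_contra hcon
    simp only [Set.mem_union, Set.mem_ofPred_eq, not_or] at hcon hw
    have h2 : |empiricalDeviation P w.1 fun x => g x - f₀ x| < ε / 2 := not_le.1 hcon.2
    have h1 : |empiricalDeviation P w.1 (f n w) - empiricalDeviation P w.1 g| < ε / 2 := by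
      by_contra hle
      refine hcon.1 ⟨f n w, hgw.1, g, hg, ?_, not_lt.1 hle⟩
      have hfgL : MemLp (fun x => f n w x - g x) 2 P := hfL.sub hgL'
      have hv := Real.sqrt_le_sqrt (variance_le_eLpNorm_sq hfgL)
      rw [Real.sqrt_sq ENNReal.toReal_nonneg] at hv
      refine hv.trans_lt ?_
      have htri : eLpNorm (fun x => f n w x - g x) 2 P
          ≤ ENNReal.ofReal s + ENNReal.ofReal s := by
        have : (fun x => f n w x - g x)
            = (fun x => f n w x - f₀ x) - fun x => g x - f₀ x := by
          ext x; simp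
        rw [this]
        refine (eLpNorm_sub_le (hfL.sub hf₀).1 hgL.1 one_le_two).trans ?_
        exact add_le_add hgw.2.le hgs.le
      rw [← ENNReal.ofReal_add hs0.le hs0.le] at htri
      have := ENNReal.toReal_le_of_le_ofReal (by positivity) htri
      have : s ≤ δ / 3 := min_le_right _ _
      linarith
    rw [e1] at hw
    rw [e2] at h2
    have : empiricalDeviation P w.1 (f n w) - empiricalDeviation P w.1 f₀
        = (empiricalDeviation P w.1 (f n w) - empiricalDeviation P w.1 g)
          + (empiricalDeviation P w.1 g - empiricalDeviation P w.1 f₀) := by ring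
    rw [this] at hw
    linarith [abs_add_le (empiricalDeviation P w.1 (f n w) - empiricalDeviation P w.1 g)
      (empiricalDeviation P w.1 g - empiricalDeviation P w.1 f₀)]
  calc _ ≤ _ := measure_mono hsub
    _ ≤ η / 3 + (η / 3 + η / 3) := by
        refine (measure_union_le _ _).trans (add_le_add hn2 ?_)
        refine (measure_union_le _ _).trans (add_le_add ?_ ?_)
        · exact (sampleLaw_fst_le P n (k n) E).trans hn1
        · exact (sampleLaw_fst_le P n (k n) E').trans hE'le
    _ = η := by rw [← add_assoc, ENNReal.add_thirds]

end EmpiricalDeviation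

/-! ### Bounds for the estimating function -/

section Bounds

/-- The terms of a convergent series tend to 0 along the cofinite filter. Applied to p(z | a, c) and
p(a | c), this makes 𝒵 and 𝒜 finite in the second part of the theorem. -/
lemma finite_of_hasSum_of_le {ι : Type*} {f : ι → ℝ} {s ε : ℝ} (h : HasSum f s) (hε : 0 < ε)
    (hle : ∀ i, ε ≤ f i) : Finite ι := by
  have h1 := h.summable.tendsto_cofinite_zero.eventually (gt_mem_nhds hε)
  rw [eventually_cofinite] at h1
  have h2 : {i | ¬ f i < ε} = Set.univ := by
    ext i; simp [hle i]
  rw [h2] at h1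
  exact Set.finite_univ_iff.1 h1

lemma lintegral_enorm_mul_le {X : Type*} [MeasurableSpace X] {P : Measure X} {f g : X → ℝ}
    (hf : AEMeasurable f P) (hg : AEMeasurable g P) :
    ∫⁻ x, ‖f x‖ₑ * ‖g x‖ₑ ∂P ≤ eLpNorm f 2 P * eLpNorm g 2 P := by
  have h := ENNReal.lintegral_mul_le_Lp_mul_Lq P Real.HolderConjugate.two_two hf.enorm hg.enorm
  simp_rw [eLpNorm_eq_lintegral_rpow_enorm_toReal two_ne_zero ENNReal.ofNat_ne_top]
  simpa using h

variable {𝒜 𝒵 𝒞 : Type*}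

lemma abs_ind_sub_ind_le (aStar a b : 𝒜) : |ind aStar b - ind a b| ≤ 1 := by
  have h1 : ∀ a : 𝒜, ind a b = 0 ∨ ind a b = 1 := by
    intro a
    by_cases h : b ∈ ({a} : Set 𝒜) <;> simp [ind, h]
  rcases h1 aStar with h | h <;> rcases h1 a with h' | h' <;> simp [h, h']

/-- Only the residual involves y, and linearly; so square integrability of Y is all that a bounded
nuisance needs. -/
lemma abs_drScore_le {aStar a : 𝒜} {Q w : 𝒵 → 𝒞 → ℝ} {μ π : 𝒜 → 𝒞 → ℝ} {τ : 𝒞 → ℝ}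
    {q W δ : ℝ} (hQ : ∀ z c, |Q z c| ≤ q) (hw : ∀ z c, |w z c| ≤ W) (hμ : ∀ b c, |μ b c| ≤ q)
    (hδ : 0 < δ) (hπ : ∀ b c, δ ≤ π b c) (hτ : ∀ c, |τ c| ≤ 2 * q) (x : Obs 𝒜 𝒵 𝒞) :
    |drScore aStar a Q w μ π τ x| ≤ (W + q * W + 2 * q / δ + 2 * q) * (1 + |x.2.2.2|) := by
  obtain ⟨c, b, z, y⟩ := x
  have hq : 0 ≤ q := (abs_nonneg _).trans (hQ z c)
  have hW : 0 ≤ W := (abs_nonneg _).trans (hw z c)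
  have hπ0 : 0 < π b c := hδ.trans_le (hπ b c)
  have h1 : |(y - Q z c) * w z c| ≤ (|y| + q) * W := by
    rw [abs_mul]
    gcongr
    · exact (abs_sub _ _).trans (by gcongr; exact hQ z c)
    · exact hw z c
  have h2 : |(Q z c - μ b c) * ((ind aStar b - ind a b) / π b c)| ≤ 2 * q / δ := by
    rw [abs_mul, abs_div, abs_of_pos hπ0, mul_div_assoc']
    calc _ ≤ (q + q) * 1 / δ := by
          gcongr
          · exact (abs_sub _ _).trans (add_le_add (hQ z c) (hμ b c))
          · exact abs_ind_sub_ind_le _ _ _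
          · exact hπ b c
      _ = _ := by ring
  have h3 := hτ c
  have h4 : |drScore aStar a Q w μ π τ (c, b, z, y)| ≤ (|y| + q) * W + 2 * q / δ + 2 * q := by
    simp only [drScore]
    exact (abs_add_le _ _).trans (add_le_add ((abs_add_le _ _).trans (add_le_add h1 h2)) h3)
  refine h4.trans ?_
  have h5 : 0 ≤ 2 * q / δ := by positivity
  have h6 := mul_nonneg (mul_nonneg hq hW) (abs_nonneg y)
  have h7 := mul_nonneg h5 (abs_nonneg y)
  have h8 := mul_nonneg hq (abs_nonneg y)
  simp only
  nlinarith

variable [Fintype 𝒜] [Fintype 𝒵]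

lemma Nuisance.weight_mul_mix {η : Nuisance 𝒜 𝒵 𝒞} {z : 𝒵} {c : 𝒞}
    (hmix : 0 < ∑ b, η.mediator z b c * η.treatment b c) (aStar a : 𝒜) :
    η.weight aStar a z c * ∑ b, η.mediator z b c * η.treatment b c
      = η.mediator z aStar c - η.mediator z a c := by
  rw [weight, tsum_fintype, div_mul_cancel₀ _ hmix.ne']

/-- The mixture contains the summand g(z | b, c) π(b | c) ≥ δ g(z | b, c) for b = a* and b = a.
Numerator and denominator therefore shrink together, and no lower bound on the mixture is needed
beyond positivity. -/
lemma Nuisance.abs_weight_le {η : Nuisance 𝒜 𝒵 𝒞} {aStar a : 𝒜} {z : 𝒵} {c : 𝒞} {δ : ℝ}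
    (hδ : 0 < δ) (hmix : 0 < ∑ b, η.mediator z b c * η.treatment b c)
    (hg : ∀ b, 0 ≤ η.mediator z b c) (hπ : ∀ b, 0 ≤ η.treatment b c)
    (hs : δ ≤ η.treatment aStar c) (ha : δ ≤ η.treatment a c) :
    |η.weight aStar a z c| ≤ 1 / δ := by
  have key : ∀ b, δ ≤ η.treatment b c →
      η.mediator z b c ≤ (∑ b, η.mediator z b c * η.treatment b c) / δ := by
    intro b hb
    rw [le_div_iff₀ hδ]
    calc η.mediator z b c * δ ≤ η.mediator z b c * η.treatment b c := by
          gcongr; exact hg b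
      _ ≤ _ := Finset.single_le_sum (f := fun b => η.mediator z b c * η.treatment b c)
          (fun b _ => mul_nonneg (hg b) (hπ b)) (Finset.mem_univ b)
  rw [weight, tsum_fintype, abs_div, abs_of_pos hmix, div_le_iff₀ hmix, one_div_mul_eq_div,
    abs_le]
  constructor <;> linarith [key aStar hs, key a ha, hg aStar, hg a]

lemma Nuisance.contrast_eq_sub (η : Nuisance 𝒜 𝒵 𝒞) (aStar a : 𝒜) (c : 𝒞) :
    η.contrast aStar a c = η.mean aStar c - η.mean a c :=
  Nuisance.contrast_eq (fun _ => (hasSum_fintype _).summable) aStar a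

variable [MeasurableSpace 𝒜] [MeasurableSpace 𝒵] [MeasurableSpace 𝒞]
    [MeasurableSingletonClass 𝒜] [MeasurableSingletonClass 𝒵] [MeasurableSingletonClass 𝒞]
    [Countable 𝒞]

lemma measurable_of_discrete_param {ι S T : Type*} [MeasurableSpace ι] [MeasurableSpace S]
    [MeasurableSpace T] [MeasurableSingletonClass ι] [Countable ι] {f : S → ι → ℝ}
    (hf : ∀ i, Measurable fun s => f s i) {s : T → S} {i : T → ι} (hs : Measurable s)
    (hi : Measurable i) : Measurable fun t => f (s t) (i t) := by
  have h1 : Measurable (Function.uncurry f) := measurable_from_prod_countable_left hf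
  exact h1.comp (hs.prodMk hi)

/-- Joint measurability of the estimating function in the parameter and the observation. -/
lemma measurable_mBDTD {S : Type*} [MeasurableSpace S] {η : S → Nuisance 𝒜 𝒵 𝒞} {aStar a : 𝒜}
    (hQ : ∀ z c, Measurable fun s => (η s).outcome z c)
    (hg : ∀ z b c, Measurable fun s => (η s).mediator z b c)
    (hπ : ∀ b c, Measurable fun s => (η s).treatment b c) :
    Measurable fun p : S × Obs 𝒜 𝒵 𝒞 => mBDTD aStar a (η p.1) p.2 := by
  have hC : Measurable fun p : S × Obs 𝒜 𝒵 𝒞 => p.2.1 := by fun_prop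
  have hA : Measurable fun p : S × Obs 𝒜 𝒵 𝒞 => p.2.2.1 := by fun_prop
  have hZ : Measurable fun p : S × Obs 𝒜 𝒵 𝒞 => p.2.2.2.1 := by fun_prop
  have hY : Measurable fun p : S × Obs 𝒜 𝒵 𝒞 => p.2.2.2.2 := by fun_prop
  have h1 : Measurable fun p : S × Obs 𝒜 𝒵 𝒞 => (η p.1).outcome p.2.2.2.1 p.2.1 :=
    measurable_of_discrete_param (f := fun s (i : 𝒵 × 𝒞) => (η s).outcome i.1 i.2)
      (fun i => hQ i.1 i.2) measurable_fst (hZ.prodMk hC)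
  have h2 : Measurable fun p : S × Obs 𝒜 𝒵 𝒞 => (η p.1).weight aStar a p.2.2.2.1 p.2.1 := by
    refine measurable_of_discrete_param (f := fun s (i : 𝒵 × 𝒞) => (η s).weight aStar a i.1 i.2)
      (fun i => ?_) measurable_fst (hZ.prodMk hC)
    simp only [Nuisance.weight, tsum_fintype]
    exact ((hg _ _ _).sub (hg _ _ _)).div
      (Finset.measurable_sum _ fun b _ => (hg _ _ _).mul (hπ _ _))
  have h3 : Measurable fun p : S × Obs 𝒜 𝒵 𝒞 => (η p.1).mean p.2.2.1 p.2.1 := by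
    refine measurable_of_discrete_param (f := fun s (i : 𝒜 × 𝒞) => (η s).mean i.1 i.2)
      (fun i => ?_) measurable_fst (hA.prodMk hC)
    simp only [Nuisance.mean, tsum_fintype]
    exact Finset.measurable_sum _ fun z _ => (hQ _ _).mul (hg _ _ _)
  have h4 : Measurable fun p : S × Obs 𝒜 𝒵 𝒞 => (η p.1).treatment p.2.2.1 p.2.1 :=
    measurable_of_discrete_param (f := fun s (i : 𝒜 × 𝒞) => (η s).treatment i.1 i.2)
      (fun i => hπ i.1 i.2) measurable_fst (hA.prodMk hC)
  have h5 : Measurable fun p : S × Obs 𝒜 𝒵 𝒞 => (η p.1).contrast aStar a p.2.1 := by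
    refine measurable_of_discrete_param (f := fun s (c : 𝒞) => (η s).contrast aStar a c)
      (fun c => ?_) measurable_fst hC
    simp only [Nuisance.contrast, tsum_fintype]
    exact Finset.measurable_sum _ fun z _ => (hQ _ _).mul ((hg _ _ _).sub (hg _ _ _))
  have h6 : Measurable fun p : S × Obs 𝒜 𝒵 𝒞 => ind aStar p.2.2.1 - ind a p.2.2.1 :=
    (measurable_of_countable fun b : 𝒜 => ind aStar b - ind a b).comp hA
  exact (((hY.sub h1).mul h2).add ((h1.sub h3).mul (h6.div h4))).add h5

lemma measurable_drScore (aStar a : 𝒜) (Q w : 𝒵 → 𝒞 → ℝ) (μ π : 𝒜 → 𝒞 → ℝ) (τ : 𝒞 → ℝ) :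
    Measurable (drScore aStar a Q w μ π τ) := by
  have hC : Measurable fun p : Obs 𝒜 𝒵 𝒞 => p.1 := by fun_prop
  have hA : Measurable fun p : Obs 𝒜 𝒵 𝒞 => p.2.1 := by fun_prop
  have hZ : Measurable fun p : Obs 𝒜 𝒵 𝒞 => p.2.2.1 := by fun_prop
  have hY : Measurable fun p : Obs 𝒜 𝒵 𝒞 => p.2.2.2 := by fun_prop
  have h1 := (measurable_of_countable fun i : 𝒵 × 𝒞 => Q i.1 i.2).comp (hZ.prodMk hC)
  have h2 := (measurable_of_countable fun i : 𝒵 × 𝒞 => w i.1 i.2).comp (hZ.prodMk hC)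
  have h3 := (measurable_of_countable fun i : 𝒜 × 𝒞 => μ i.1 i.2).comp (hA.prodMk hC)
  have h4 := (measurable_of_countable fun i : 𝒜 × 𝒞 => π i.1 i.2).comp (hA.prodMk hC)
  have h5 := (measurable_of_countable τ).comp hC
  have h6 := (measurable_of_countable fun b : 𝒜 => ind aStar b - ind a b).comp hA
  exact (((hY.sub h1).mul h2).add ((h1.sub h3).mul (h6.div h4))).add h5

lemma memLp_drScore {P : Measure (Obs 𝒜 𝒵 𝒞)} [IsProbabilityMeasure P]
    (hY : MemLp (fun x : Obs 𝒜 𝒵 𝒞 => x.2.2.2) 2 P) {aStar a : 𝒜} {Q w : 𝒵 → 𝒞 → ℝ}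
    {μ π : 𝒜 → 𝒞 → ℝ} {τ : 𝒞 → ℝ} {K : ℝ}
    (h : ∀ x, |drScore aStar a Q w μ π τ x| ≤ K * (1 + |x.2.2.2|)) :
    MemLp (drScore aStar a Q w μ π τ) 2 P := by
  have h0 : MemLp (fun x : Obs 𝒜 𝒵 𝒞 => 1 + ‖x.2.2.2‖) 2 P :=
    (memLp_const (1 : ℝ)).add hY.norm
  have h1 : MemLp (fun x : Obs 𝒜 𝒵 𝒞 => K * (1 + ‖x.2.2.2‖)) 2 P := h0.const_mul K
  refine h1.mono (measurable_drScore _ _ _ _ _ _ _).aestronglyMeasurable (ae_of_all _ fun x => ?_)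
  rw [Real.norm_eq_abs]
  exact (h x).trans (le_abs_self _)

namespace IsBDTDLaw

variable {P : Measure (Obs 𝒜 𝒵 𝒞)}

lemma sum_mediator (h : IsBDTDLaw P) (b : 𝒜) (c : 𝒞) :
    ∑ z, (trueNuisance P).mediator z b c = 1 := by
  exact (hasSum_fintype _).unique (h.hasSum_mediator b c)

lemma sum_treatment (h : IsBDTDLaw P) (c : 𝒞) :
    ∑ b, (trueNuisance P).treatment b c = 1 := by
  exact (hasSum_fintype _).unique (h.hasSum_treatment c)

lemma treatment_le_one (h : IsBDTDLaw P) (b : 𝒜) (c : 𝒞) :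
    (trueNuisance P).treatment b c ≤ 1 := by
  rw [← h.sum_treatment c]
  exact Finset.single_le_sum (f := fun b => (trueNuisance P).treatment b c)
    (fun b _ => (h.treatment_pos b c).le) (Finset.mem_univ b)

lemma mix_pos (h : IsBDTDLaw P) (z : 𝒵) (c : 𝒞) :
    0 < ∑ b, (trueNuisance P).mediator z b c * (trueNuisance P).treatment b c := by
  rw [(hasSum_fintype _).unique (h.hasSum_mix z c)]
  exact div_pos (h.cell_ZC_pos z c) (h.cell_C_pos c)

lemma abs_frontDoorMean_le (h : IsBDTDLaw P) {Q : 𝒵 → 𝒞 → ℝ} {q : ℝ}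
    (hQ : ∀ z c, |Q z c| ≤ q) (b : 𝒜) (c : 𝒞) :
    |∑ z, Q z c * (trueNuisance P).mediator z b c| ≤ q := by
  calc _ ≤ ∑ z, |Q z c * (trueNuisance P).mediator z b c| := Finset.abs_sum_le_sum_abs _ _
    _ ≤ ∑ z, q * (trueNuisance P).mediator z b c := by
        refine Finset.sum_le_sum fun z _ => ?_
        rw [abs_mul, abs_of_pos (h.mediator_pos z b c)]
        gcongr
        · exact (h.mediator_pos z b c).le
        · exact hQ z c
    _ = q := by rw [← Finset.mul_sum, h.sum_mediator, mul_one]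

/-- Averages over cells with probabilities bounded away from zero. -/
lemma lintegral_sum_cells_le (h : IsBDTDLaw P) {ε : ℝ} (hε : 0 < ε)
    (hg : ∀ z b c, ε ≤ (trueNuisance P).mediator z b c)
    (hπ : ∀ b c, ε ≤ (trueNuisance P).treatment b c) (Φ : 𝒵 → 𝒜 → 𝒞 → ℝ≥0∞) :
    ∫⁻ x, ∑ z, ∑ b, Φ z b x.1 ∂P
      ≤ ENNReal.ofReal (1 / ε ^ 2) * ∫⁻ x, Φ x.2.2.1 x.2.1 x.1 ∂P := by
  have hprob := h.isProb
  have hC : Measurable fun p : Obs 𝒜 𝒵 𝒞 => p.1 := by fun_prop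
  have hAZ : Measurable fun p : Obs 𝒜 𝒵 𝒞 => (p.2.2.1, p.2.1) := by fun_prop
  rw [lintegral_eq_tsum_fiber _ hC, lintegral_eq_tsum_fiber (X := fun x : Obs 𝒜 𝒵 𝒞 => x.1) _ hC,
    ← ENNReal.tsum_mul_left]
  refine ENNReal.tsum_le_tsum fun c => ?_
  rw [setLIntegral_congr_fun (g := fun _ => ∑ z, ∑ b, Φ z b c) (measurableSet_cell_C c)
    (fun x (hx : x.1 = c) => by simp [hx]), setLIntegral_const,
    lintegral_eq_tsum_fiber _ hAZ, tsum_fintype, Fintype.sum_prod_type, Finset.mul_sum,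
    Finset.sum_mul]
  refine Finset.sum_le_sum fun z _ => ?_
  rw [Finset.mul_sum, Finset.sum_mul]
  refine Finset.sum_le_sum fun b _ => ?_
  have hm : MeasurableSet {x : Obs 𝒜 𝒵 𝒞 | (x.2.2.1, x.2.1) = (z, b)} := measurableSet_fiber hAZ _
  have hset : {x : Obs 𝒜 𝒵 𝒞 | (x.2.2.1, x.2.1) = (z, b)} ∩ {x | x.1 = c}
      = {x | x.1 = c ∧ x.2.1 = b ∧ x.2.2.1 = z} := by
    ext x; simp; tauto
  rw [Measure.restrict_restrict hm, hset,
    setLIntegral_congr_fun (g := fun _ => Φ z b c) (measurableSet_cell c b z)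
    (fun x hx => by simp [hx.1, hx.2.1, hx.2.2]), setLIntegral_const, mul_left_comm]
  gcongr
  -- The cell has mass p(c) p(b | c) p(z | b, c), and each conditional factor is at least ε.
  have h1 : P.real {x | x.1 = c} ≤ 1 / ε ^ 2 * P.real {x | x.1 = c ∧ x.2.1 = b ∧ x.2.2.1 = z} := by
    rw [h.cell_eq_mediator, h.cell_eq_treatment, one_div_mul_eq_div, le_div_iff₀ (by positivity)]
    have := h.cell_C_pos c
    calc P.real {x | x.1 = c} * ε ^ 2 = P.real {x | x.1 = c} * ε * ε := by ring
      _ ≤ _ := by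
          gcongr
          · exact mul_nonneg this.le (h.treatment_pos b c).le
          · exact hπ b c
          · exact hg z b c
  rw [← ofReal_measureReal, ← ofReal_measureReal, ← ENNReal.ofReal_mul (by positivity)]
  exact ENNReal.ofReal_le_ofReal h1

end IsBDTDLaw

end Bounds

/-! ### The bias of the plug-in estimating function -/

section Bias

variable {𝒜 𝒵 𝒞 : Type*}

/-- The pointwise bound for the bias of the estimating function. -/
noncomputable def biasBound (η η₀ : Nuisance 𝒜 𝒵 𝒞) (aStar a : 𝒜) (z : 𝒵) (b : 𝒜) (c : 𝒞) : ℝ :=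
  |η.outcome z c - η₀.outcome z c| * |η.mediator z b c - η₀.mediator z b c|
    + |η.outcome z c - η₀.outcome z c| * |η.treatment b c - η₀.treatment b c|
    + ((|η.outcome z c - η₀.outcome z c| * |η.mediator z aStar c - η₀.mediator z aStar c|
      + |η.mediator z aStar c - η₀.mediator z aStar c|
        * |η.treatment aStar c - η₀.treatment aStar c|)
    + (|η.outcome z c - η₀.outcome z c| * |η.mediator z a c - η₀.mediator z a c|
      + |η.mediator z a c - η₀.mediator z a c| * |η.treatment a c - η₀.treatment a c|))

variable [Fintype 𝒜] [Fintype 𝒵]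

/-- With the estimated mixture in place of the true one, the weight reproduces the difference of
estimated densities exactly. What is left is a bounded weight times the error of the mixture, plus
two density errors, all first order in the mediator and treatment models. -/
lemma abs_weight_mul_mix_sub_le {η η₀ : Nuisance 𝒜 𝒵 𝒞} {aStar a : 𝒜} {z : 𝒵} {c : 𝒞} {δ : ℝ}
    (hδ : 0 < δ) (hmix : 0 < ∑ b, η.mediator z b c * η.treatment b c)
    (hg : ∀ b, η.mediator z b c ∈ Set.Icc (0 : ℝ) 1)
    (hπ : ∀ b, η.treatment b c ∈ Set.Icc (0 : ℝ) 1)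
    (hπ₀ : ∀ b, η₀.treatment b c ∈ Set.Icc (0 : ℝ) 1)
    (hs : δ ≤ η.treatment aStar c) (ha : δ ≤ η.treatment a c) :
    |η.weight aStar a z c * ∑ b, η₀.mediator z b c * η₀.treatment b c
        - (η₀.mediator z aStar c - η₀.mediator z a c)|
      ≤ 1 / δ * ∑ b, (|η.mediator z b c - η₀.mediator z b c|
          + |η.treatment b c - η₀.treatment b c|)
        + (|η.mediator z aStar c - η₀.mediator z aStar c|
          + |η.mediator z a c - η₀.mediator z a c|) := by
  have h1 := η.weight_mul_mix hmix aStar a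
  have h2 := η.abs_weight_le hδ hmix (fun b => (hg b).1) (fun b => (hπ b).1) hs ha
  have h3 : |∑ b, η₀.mediator z b c * η₀.treatment b c
      - ∑ b, η.mediator z b c * η.treatment b c|
      ≤ ∑ b, (|η.mediator z b c - η₀.mediator z b c|
          + |η.treatment b c - η₀.treatment b c|) := by
    rw [← Finset.sum_sub_distrib]
    refine (Finset.abs_sum_le_sum_abs _ _).trans (Finset.sum_le_sum fun b _ => ?_)
    have e : η₀.mediator z b c * η₀.treatment b c - η.mediator z b c * η.treatment b c
        = -((η.mediator z b c - η₀.mediator z b c) * η₀.treatment b c)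
          - η.mediator z b c * (η.treatment b c - η₀.treatment b c) := by ring
    rw [e]
    refine (abs_sub _ _).trans ?_
    rw [abs_neg, abs_mul, abs_mul, abs_of_nonneg (hπ₀ b).1, abs_of_nonneg (hg b).1]
    exact add_le_add (mul_le_of_le_one_right (abs_nonneg _) (hπ₀ b).2)
      (mul_le_of_le_one_left (abs_nonneg _) (hg b).2)
  have e : η.weight aStar a z c * ∑ b, η₀.mediator z b c * η₀.treatment b c
        - (η₀.mediator z aStar c - η₀.mediator z a c)
      = η.weight aStar a z c * (∑ b, η₀.mediator z b c * η₀.treatment b c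
          - ∑ b, η.mediator z b c * η.treatment b c)
        + ((η.mediator z aStar c - η₀.mediator z aStar c)
          - (η.mediator z a c - η₀.mediator z a c)) := by
    linear_combination h1
  rw [e]
  refine (abs_add_le _ _).trans (add_le_add ?_ (abs_sub _ _))
  rw [abs_mul]
  gcongr

/-- The factor p₀ / p - 1 is itself an error in p. Writing Q = (Q - Q₀) + Q₀, the first part already
contains a product of errors, so |p - p₀| ≤ 1 suffices there; in the second, Q₀ is bounded by q and
the product of mediator and treatment errors remains. -/
lemma abs_treatment_term_le {p p₀ Q Q₀ g g₀ δ q : ℝ} (hδ : 0 < δ) (hp : δ ≤ p)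
    (hp1 : p ≤ 1) (hp₀ : p₀ ∈ Set.Icc (0 : ℝ) 1) (hQ : |Q₀| ≤ q) :
    |(p₀ / p - 1) * (Q * (g₀ - g))| ≤ 1 / δ * (|Q - Q₀| * |g - g₀|)
      + q / δ * (|g - g₀| * |p - p₀|) := by
  have hp0 : 0 < p := hδ.trans_le hp
  have e : (p₀ / p - 1) * (Q * (g₀ - g))
      = (p - p₀) / p * ((Q - Q₀) * (g - g₀)) + (p - p₀) / p * (Q₀ * (g - g₀)) := by
    field_simp
    ring
  have h1 : |(p - p₀) / p| ≤ 1 / δ := by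
    rw [abs_div, abs_of_pos hp0]
    have : |p - p₀| ≤ 1 := by rw [abs_le]; constructor <;> linarith [hp₀.1, hp₀.2]
    gcongr
  have h2 : |(p - p₀) / p| ≤ |p - p₀| / δ := by
    rw [abs_div, abs_of_pos hp0]
    gcongr
  rw [e]
  refine (abs_add_le _ _).trans (add_le_add ?_ ?_)
  · rw [abs_mul, abs_mul]; gcongr
  · rw [abs_mul, abs_mul]
    calc _ ≤ |p - p₀| / δ * (q * |g - g₀|) := by gcongr
      _ = _ := by ring

/-- The heart of the second-order bias. After regrouping by z, the outcome error meets only the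
error of the weighted mixture, and the mediator error meets only that of the treatment ratio. The
constant collects 1 / δ from the weight and the ratio, 1 from the density errors and q / δ from the
bounded outcome regression. -/
lemma abs_bias_le {η η₀ : Nuisance 𝒜 𝒵 𝒞} {aStar a : 𝒜} {c : 𝒞} {δ q : ℝ}
    (hδ : 0 < δ) (hq : 0 ≤ q) (hmix : ∀ z, 0 < ∑ b, η.mediator z b c * η.treatment b c)
    (hg : ∀ z b, η.mediator z b c ∈ Set.Icc (0 : ℝ) 1)
    (hπ : ∀ b, η.treatment b c ∈ Set.Icc (0 : ℝ) 1)
    (hπ₀ : ∀ b, η₀.treatment b c ∈ Set.Icc (0 : ℝ) 1)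
    (hs : δ ≤ η.treatment aStar c) (ha : δ ≤ η.treatment a c)
    (hQ : ∀ z, |η₀.outcome z c| ≤ q) :
    |∑ z, (η₀.outcome z c - η.outcome z c) * η.weight aStar a z c *
          ∑ b, η₀.mediator z b c * η₀.treatment b c
        + (η₀.treatment aStar c / η.treatment aStar c *
            (∑ z, η.outcome z c * η₀.mediator z aStar c - η.mean aStar c)
          - η₀.treatment a c / η.treatment a c *
            (∑ z, η.outcome z c * η₀.mediator z a c - η.mean a c)) + η.contrast aStar a c
        - (η₀.mean aStar c - η₀.mean a c)|
      ≤ (1 / δ + 1 + q / δ) * ∑ z, ∑ b, biasBound η η₀ aStar a z b c := by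
  have hsum : ∑ z, (η₀.outcome z c - η.outcome z c) * η.weight aStar a z c *
          ∑ b, η₀.mediator z b c * η₀.treatment b c
        + (η₀.treatment aStar c / η.treatment aStar c *
            (∑ z, η.outcome z c * η₀.mediator z aStar c - η.mean aStar c)
          - η₀.treatment a c / η.treatment a c *
            (∑ z, η.outcome z c * η₀.mediator z a c - η.mean a c)) + η.contrast aStar a c
        - (η₀.mean aStar c - η₀.mean a c)
      = ∑ z, ((η₀.outcome z c - η.outcome z c) * (η.weight aStar a z c *
          ∑ b, η₀.mediator z b c * η₀.treatment b c
            - (η₀.mediator z aStar c - η₀.mediator z a c))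
        + ((η₀.treatment aStar c / η.treatment aStar c - 1)
            * (η.outcome z c * (η₀.mediator z aStar c - η.mediator z aStar c))
          - (η₀.treatment a c / η.treatment a c - 1)
            * (η.outcome z c * (η₀.mediator z a c - η.mediator z a c)))) := by
    simp only [Nuisance.contrast_eq_sub, Nuisance.mean, tsum_fintype, mul_sub, sub_mul,
      Finset.sum_add_distrib, Finset.sum_sub_distrib, Finset.mul_sum, mul_assoc, one_mul]
    ring
  rw [hsum, Finset.mul_sum]
  refine (Finset.abs_sum_le_sum_abs _ _).trans (Finset.sum_le_sum fun z _ => ?_)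
  have h1 := abs_weight_mul_mix_sub_le (η₀ := η₀) hδ (hmix z) (hg z) hπ hπ₀ hs ha
  have h2 := abs_treatment_term_le (Q := η.outcome z c) (g := η.mediator z aStar c)
    (g₀ := η₀.mediator z aStar c) hδ hs (hπ aStar).2 (hπ₀ aStar) (hQ z)
  have h3 := abs_treatment_term_le (Q := η.outcome z c) (g := η.mediator z a c)
    (g₀ := η₀.mediator z a c) hδ ha (hπ a).2 (hπ₀ a) (hQ z)
  set dQ := |η.outcome z c - η₀.outcome z c| with hdQ
  set R := ((dQ * |η.mediator z aStar c - η₀.mediator z aStar c|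
      + |η.mediator z aStar c - η₀.mediator z aStar c|
        * |η.treatment aStar c - η₀.treatment aStar c|)
    + (dQ * |η.mediator z a c - η₀.mediator z a c|
      + |η.mediator z a c - η₀.mediator z a c| * |η.treatment a c - η₀.treatment a c|)) with hR
  have hR0 : 0 ≤ R := by positivity
  have h4 : dQ * ∑ b, (|η.mediator z b c - η₀.mediator z b c|
      + |η.treatment b c - η₀.treatment b c|) + R ≤ ∑ b, biasBound η η₀ aStar a z b c := by
    have : ∀ b, biasBound η η₀ aStar a z b c = dQ * (|η.mediator z b c - η₀.mediator z b c|
      + |η.treatment b c - η₀.treatment b c|) + R := by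
      intro b; simp only [biasBound, hR, hdQ]; ring
    have e2 : ∀ F : 𝒜 → ℝ, ∑ b, (dQ * F b + R)
        = dQ * ∑ b, F b + (Finset.univ : Finset 𝒜).card * R := fun F => by
      rw [Finset.sum_add_distrib, ← Finset.mul_sum, Finset.sum_const, nsmul_eq_mul]
    rw [Finset.sum_congr rfl fun b _ => this b, e2]
    gcongr
    -- R does not depend on b, so the sum over b counts it card 𝒜 times; once is enough.
    have : (1 : ℝ) ≤ (Finset.univ : Finset 𝒜).card := by
      exact_mod_cast Finset.card_pos.2 ⟨a, Finset.mem_univ a⟩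
    nlinarith
  have hS0 : 0 ≤ dQ * ∑ b, (|η.mediator z b c - η₀.mediator z b c|
      + |η.treatment b c - η₀.treatment b c|) := by positivity
  have h5 : |(η₀.outcome z c - η.outcome z c) * (η.weight aStar a z c *
          ∑ b, η₀.mediator z b c * η₀.treatment b c
            - (η₀.mediator z aStar c - η₀.mediator z a c))|
      ≤ dQ * (1 / δ * ∑ b, (|η.mediator z b c - η₀.mediator z b c|
          + |η.treatment b c - η₀.treatment b c|)
        + (|η.mediator z aStar c - η₀.mediator z aStar c|
          + |η.mediator z a c - η₀.mediator z a c|)) := by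
    rw [abs_mul, abs_sub_comm, ← hdQ]
    gcongr
  refine (abs_add_le _ _).trans ((add_le_add h5 ((abs_sub _ _).trans (add_le_add h2 h3))).trans ?_)
  refine le_trans ?_ (mul_le_mul_of_nonneg_left h4 (by positivity))
  have hδ' : 0 ≤ 1 / δ := by positivity
  have hqδ : 0 ≤ q / δ := by positivity
  have k1 : 0 ≤ dQ * |η.mediator z aStar c - η₀.mediator z aStar c| := by positivity
  have k2 : 0 ≤ dQ * |η.mediator z a c - η₀.mediator z a c| := by positivity
  have k3 : 0 ≤ |η.mediator z aStar c - η₀.mediator z aStar c|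
        * |η.treatment aStar c - η₀.treatment aStar c| := by positivity
  have k4 : 0 ≤ |η.mediator z a c - η₀.mediator z a c|
        * |η.treatment a c - η₀.treatment a c| := by positivity
  have m1 := mul_nonneg hδ' k3
  have m2 := mul_nonneg hδ' k4
  have m3 := mul_nonneg hqδ k1
  have m4 := mul_nonneg hqδ k2
  have m5 := mul_nonneg hqδ hS0
  rw [hR]
  nlinarith

variable [Countable 𝒞] [MeasurableSpace 𝒜] [MeasurableSpace 𝒵] [MeasurableSpace 𝒞]
    [MeasurableSingletonClass 𝒜] [MeasurableSingletonClass 𝒵] [MeasurableSingletonClass 𝒞]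

/-- The `L²` norm of the error of the outcome regression. -/
noncomputable def outcomeError (P : Measure (Obs 𝒜 𝒵 𝒞)) (η : Nuisance 𝒜 𝒵 𝒞) : ℝ≥0∞ :=
  eLpNorm (fun x => η.outcome x.2.2.1 x.1 - (trueNuisance P).outcome x.2.2.1 x.1) 2 P

/-- The sum of the products of `L²` errors that bounds the bias. -/
noncomputable def errorProducts (P : Measure (Obs 𝒜 𝒵 𝒞)) (aStar a : 𝒜) (η : Nuisance 𝒜 𝒵 𝒞) :
    ℝ≥0∞ :=
  outcomeError P η * eLpNorm (fun x => η.mediator x.2.2.1 x.2.1 x.1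
      - (trueNuisance P).mediator x.2.2.1 x.2.1 x.1) 2 P
    + outcomeError P η * eLpNorm (fun x => η.treatment x.2.1 x.1
      - (trueNuisance P).treatment x.2.1 x.1) 2 P
    + ((outcomeError P η * eLpNorm (fun x => η.mediator x.2.2.1 aStar x.1
      - (trueNuisance P).mediator x.2.2.1 aStar x.1) 2 P
      + eLpNorm (fun x => η.mediator x.2.2.1 aStar x.1
        - (trueNuisance P).mediator x.2.2.1 aStar x.1) 2 P
        * eLpNorm (fun x => η.treatment aStar x.1 - (trueNuisance P).treatment aStar x.1) 2 P)
    + (outcomeError P η * eLpNorm (fun x => η.mediator x.2.2.1 a x.1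
      - (trueNuisance P).mediator x.2.2.1 a x.1) 2 P
      + eLpNorm (fun x => η.mediator x.2.2.1 a x.1
        - (trueNuisance P).mediator x.2.2.1 a x.1) 2 P
        * eLpNorm (fun x => η.treatment a x.1 - (trueNuisance P).treatment a x.1) 2 P))

/-- Cauchy-Schwarz for each product of errors separately. -/
lemma lintegral_biasBound_le (P : Measure (Obs 𝒜 𝒵 𝒞)) (aStar a : 𝒜) (η : Nuisance 𝒜 𝒵 𝒞) :
    ∫⁻ x, ENNReal.ofReal (biasBound η (trueNuisance P) aStar a x.2.2.1 x.2.1 x.1) ∂P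
      ≤ errorProducts P aStar a η := by
  have hC : Measurable fun p : Obs 𝒜 𝒵 𝒞 => p.1 := by fun_prop
  have hA : Measurable fun p : Obs 𝒜 𝒵 𝒞 => p.2.1 := by fun_prop
  have hZ : Measurable fun p : Obs 𝒜 𝒵 𝒞 => p.2.2.1 := by fun_prop
  have hm : ∀ f : 𝒞 × 𝒜 × 𝒵 → ℝ, Measurable fun x : Obs 𝒜 𝒵 𝒞 => f (x.1, x.2.1, x.2.2.1) :=
    fun f => (measurable_of_countable f).comp (hC.prodMk (hA.prodMk hZ))
  set dQ : 𝒞 × 𝒜 × 𝒵 → ℝ := fun i => η.outcome i.2.2 i.1 - (trueNuisance P).outcome i.2.2 i.1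
  set dg : 𝒜 → 𝒞 × 𝒜 × 𝒵 → ℝ := fun b i =>
    η.mediator i.2.2 b i.1 - (trueNuisance P).mediator i.2.2 b i.1
  set dp : 𝒜 → 𝒞 × 𝒜 × 𝒵 → ℝ := fun b i =>
    η.treatment b i.1 - (trueNuisance P).treatment b i.1
  have hprod : ∀ f g : 𝒞 × 𝒜 × 𝒵 → ℝ,
      Measurable (fun x : Obs 𝒜 𝒵 𝒞 => ‖f (x.1, x.2.1, x.2.2.1)‖ₑ * ‖g (x.1, x.2.1, x.2.2.1)‖ₑ) ∧
      ∫⁻ x, ‖f (x.1, x.2.1, x.2.2.1)‖ₑ * ‖g (x.1, x.2.1, x.2.2.1)‖ₑ ∂P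
      ≤ eLpNorm (fun x => f (x.1, x.2.1, x.2.2.1)) 2 P
        * eLpNorm (fun x => g (x.1, x.2.1, x.2.2.1)) 2 P :=
    fun f g => ⟨(hm f).enorm.mul (hm g).enorm,
      lintegral_enorm_mul_le (hm f).aemeasurable (hm g).aemeasurable⟩
  have hadd : ∀ {f g : Obs 𝒜 𝒵 𝒞 → ℝ≥0∞} {A B : ℝ≥0∞}, (Measurable f ∧ ∫⁻ x, f x ∂P ≤ A) →
      (Measurable g ∧ ∫⁻ x, g x ∂P ≤ B) →
      (Measurable (fun x => f x + g x) ∧ ∫⁻ x, f x + g x ∂P ≤ A + B) := by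
    intro f g A B hf hg
    refine ⟨hf.1.add hg.1, ?_⟩
    rw [lintegral_add_left hf.1]
    exact add_le_add hf.2 hg.2
  have heq : ∀ x : Obs 𝒜 𝒵 𝒞,
      ENNReal.ofReal (biasBound η (trueNuisance P) aStar a x.2.2.1 x.2.1 x.1)
      = ‖dQ (x.1, x.2.1, x.2.2.1)‖ₑ * ‖(fun i => dg i.2.1 i) (x.1, x.2.1, x.2.2.1)‖ₑ
        + ‖dQ (x.1, x.2.1, x.2.2.1)‖ₑ * ‖(fun i => dp i.2.1 i) (x.1, x.2.1, x.2.2.1)‖ₑ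
        + ((‖dQ (x.1, x.2.1, x.2.2.1)‖ₑ * ‖dg aStar (x.1, x.2.1, x.2.2.1)‖ₑ
          + ‖dg aStar (x.1, x.2.1, x.2.2.1)‖ₑ * ‖dp aStar (x.1, x.2.1, x.2.2.1)‖ₑ)
        + (‖dQ (x.1, x.2.1, x.2.2.1)‖ₑ * ‖dg a (x.1, x.2.1, x.2.2.1)‖ₑ
          + ‖dg a (x.1, x.2.1, x.2.2.1)‖ₑ * ‖dp a (x.1, x.2.1, x.2.2.1)‖ₑ)) := by
    intro x
    simp only [biasBound, dQ, dg, dp, ← ofReal_norm, Real.norm_eq_abs]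
    rw [ENNReal.ofReal_add (by positivity) (by positivity),
      ENNReal.ofReal_add (by positivity) (by positivity),
      ENNReal.ofReal_add (by positivity) (by positivity),
      ENNReal.ofReal_add (by positivity) (by positivity),
      ENNReal.ofReal_add (by positivity) (by positivity)]
    simp only [ENNReal.ofReal_mul (abs_nonneg _)]
  simp_rw [heq]
  exact (hadd (hadd (hprod dQ fun i => dg i.2.1 i) (hprod dQ fun i => dp i.2.1 i))
    (hadd (hadd (hprod dQ (dg aStar)) (hprod (dg aStar) (dp aStar)))
      (hadd (hprod dQ (dg a)) (hprod (dg a) (dp a))))).2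

/-- The bias of the plug-in estimating function is bounded by products of errors. -/
lemma IsBDTDLaw.enorm_bias_le {P : Measure (Obs 𝒜 𝒵 𝒞)} (h : IsBDTDLaw P) {ε δ q : ℝ}
    (hε : 0 < ε) (hδ : 0 < δ) (hq : 0 ≤ q) (hg₀ : ∀ z b c, ε ≤ (trueNuisance P).mediator z b c)
    (hπ₀ : ∀ b c, ε ≤ (trueNuisance P).treatment b c)
    (hQ : ∀ z c, |(trueNuisance P).outcome z c| ≤ q) {aStar a : 𝒜}
    (hfd : Integrable (fun x : Obs 𝒜 𝒵 𝒞 => frontDoorMean P aStar x.1 - frontDoorMean P a x.1) P)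
    {η : Nuisance 𝒜 𝒵 𝒞}
    (hmix : ∀ z c, 0 < ∑ b, η.mediator z b c * η.treatment b c)
    (hg : ∀ z b c, η.mediator z b c ∈ Set.Icc (0 : ℝ) 1)
    (hπ : ∀ b c, η.treatment b c ∈ Set.Icc (0 : ℝ) 1)
    (hs : ∀ c, δ ≤ η.treatment aStar c) (ha : ∀ c, δ ≤ η.treatment a c)
    (hi : Integrable (mBDTD aStar a η) P) :
    ‖∫ x, mBDTD aStar a η x ∂P
        - ∫ x, (frontDoorMean P aStar x.1 - frontDoorMean P a x.1) ∂P‖ₑ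
      ≤ ENNReal.ofReal (1 / δ + 1 + q / δ) * ENNReal.ofReal (1 / ε ^ 2)
        * errorProducts P aStar a η := by
  have hprob := h.isProb
  have hs' : ∀ (f : 𝒵 → ℝ), Summable f := fun f => (hasSum_fintype f).summable
  have hfdc : ∀ c, ∫ x in {x | x.1 = c}, (frontDoorMean P aStar x.1 - frontDoorMean P a x.1) ∂P
      = P.real {x | x.1 = c} * (frontDoorMean P aStar c - frontDoorMean P a c) := by
    intro c
    rw [setIntegral_congr_fun (g := fun _ => frontDoorMean P aStar c - frontDoorMean P a c)
      (measurableSet_cell_C c) (fun x (hx : x.1 = c) => by simp [hx]), setIntegral_const,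
      smul_eq_mul]
  have hi' := hi
  rw [mBDTD_eq_drScore] at hi'
  -- Conditioning on C first lets the exact cancellation of `abs_bias_le` take place for each c
  -- before absolute values are taken.
  obtain ⟨h1, h2⟩ := integrable_comp_of_setIntegral_fiber (hi.sub hfd) measurable_fst
    (B := fun c => ∑ z, ((trueNuisance P).outcome z c - η.outcome z c) * η.weight aStar a z c *
          ∑ b, (trueNuisance P).mediator z b c * (trueNuisance P).treatment b c
        + ((trueNuisance P).treatment aStar c / η.treatment aStar c *
            (∑ z, η.outcome z c * (trueNuisance P).mediator z aStar c - η.mean aStar c)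
          - (trueNuisance P).treatment a c / η.treatment a c *
            (∑ z, η.outcome z c * (trueNuisance P).mediator z a c - η.mean a c))
        + η.contrast aStar a c
        - ((trueNuisance P).mean aStar c - (trueNuisance P).mean a c)) (fun c => by
      have e1 := h.setIntegral_drScore hi' (c := c) fun b => hs' _
      rw [← mBDTD_eq_drScore] at e1
      simp only [Pi.sub_apply]
      rw [integral_sub hi.integrableOn hfd.integrableOn, e1, hfdc]
      simp only [tsum_fintype, frontDoorMean_eq_mean]
      ring)
  simp only [Pi.sub_apply] at h2
  rw [← integral_sub hi hfd, ← h2]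
  refine (enorm_integral_le_lintegral_enorm _).trans ?_
  calc _ ≤ ∫⁻ x : Obs 𝒜 𝒵 𝒞, ENNReal.ofReal (1 / δ + 1 + q / δ) * ∑ z, ∑ b,
        ENNReal.ofReal (biasBound η (trueNuisance P) aStar a z b x.1) ∂P := by
        refine lintegral_mono fun x => ?_
        have hb := abs_bias_le (η := η) (η₀ := trueNuisance P) (aStar := aStar) (a := a)
          (c := x.1) hδ hq (fun z => hmix z x.1) (fun z b => hg z b x.1) (fun b => hπ b x.1)
          (fun b => ⟨(h.treatment_pos b x.1).le, h.treatment_le_one b x.1⟩) (hs x.1) (ha x.1)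
          (fun z => hQ z x.1)
        have hnn : ∀ z b, 0 ≤ biasBound η (trueNuisance P) aStar a z b x.1 := by
          intro z b; unfold biasBound; positivity
        rw [← ofReal_norm, Real.norm_eq_abs]
        simp_rw [← ENNReal.ofReal_sum_of_nonneg fun b _ => hnn _ b]
        rw [← ENNReal.ofReal_sum_of_nonneg fun z _ => Finset.sum_nonneg fun b _ => hnn z b,
          ← ENNReal.ofReal_mul (by positivity)]
        exact ENNReal.ofReal_le_ofReal hb
    _ ≤ _ := by
        rw [lintegral_const_mul' _ _ ENNReal.ofReal_ne_top, mul_assoc]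
        refine mul_le_mul' le_rfl
          ((h.lintegral_sum_cells_le hε hg₀ hπ₀
          fun z b c => ENNReal.ofReal (biasBound η (trueNuisance P) aStar a z b c)).trans ?_)
        exact mul_le_mul' le_rfl (lintegral_biasBound_le P aStar a η)

end Bias

/-! ### Asymptotic linearity -/

section AsymptoticLinearity

variable {𝒜 𝒵 𝒞 : Type*} [Fintype 𝒜] [Fintype 𝒵] [Countable 𝒞] [MeasurableSpace 𝒜]
    [MeasurableSpace 𝒵] [MeasurableSpace 𝒞] [MeasurableSingletonClass 𝒜]
    [MeasurableSingletonClass 𝒵] [MeasurableSingletonClass 𝒞]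

/-- The outcome regression is bounded by `q`, and the conditional probabilities are bounded below
by `ε`. -/
structure IsBoundedLaw (P : Measure (Obs 𝒜 𝒵 𝒞)) (ε q : ℝ) : Prop where
  pos : 0 < ε
  nonneg : 0 ≤ q
  outcome : ∀ z c, |(trueNuisance P).outcome z c| ≤ q
  mediator : ∀ z b c, ε ≤ (trueNuisance P).mediator z b c
  treatment : ∀ b c, ε ≤ (trueNuisance P).treatment b c

lemma IsBDTDLaw.abs_weight_le {P : Measure (Obs 𝒜 𝒵 𝒞)} (h : IsBDTDLaw P) {ε : ℝ} (hε : 0 < ε)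
    (hπ : ∀ b c, ε ≤ (trueNuisance P).treatment b c) (aStar a : 𝒜) (z : 𝒵) (c : 𝒞) :
    |(trueNuisance P).weight aStar a z c| ≤ 1 / ε :=
  Nuisance.abs_weight_le hε (h.mix_pos z c) (fun b => (h.mediator_pos z b c).le)
    (fun b => (h.treatment_pos b c).le) (hπ _ _) (hπ _ _)

/-- The growth bound for the estimating functions with the outcome regression of a bounded law. -/
noncomputable def growthConst (ε q : ℝ) : ℝ := 1 / ε + q * (1 / ε) + 2 * q / ε + 2 * q

/-- The weight and the treatment model are free, so that one bound also covers the mixed scores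
along a submodel. -/
lemma IsBoundedLaw.abs_drScore_le {P : Measure (Obs 𝒜 𝒵 𝒞)} {ε q : ℝ} (hb : IsBoundedLaw P ε q)
    (h : IsBDTDLaw P) {aStar a : 𝒜} {w : 𝒵 → 𝒞 → ℝ} {π : 𝒜 → 𝒞 → ℝ} (hw : ∀ z c, |w z c| ≤ 1 / ε)
    (hπ : ∀ b c, ε ≤ π b c) (x : Obs 𝒜 𝒵 𝒞) :
    |drScore aStar a (trueNuisance P).outcome w (trueNuisance P).mean π
      ((trueNuisance P).contrast aStar a) x| ≤ growthConst ε q * (1 + |x.2.2.2|) := by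
  have hmean : ∀ b c, |(trueNuisance P).mean b c| ≤ q := by
    intro b c
    rw [Nuisance.mean, tsum_fintype]
    exact h.abs_frontDoorMean_le hb.outcome b c
  refine _root_.abs_drScore_le hb.outcome hw hmean hb.pos hπ (fun c => ?_) x
  rw [Nuisance.contrast_eq_sub]
  exact (abs_sub _ _).trans (by linarith [hmean aStar c, hmean a c])

lemma IsBoundedLaw.abs_mBDTD_le {P : Measure (Obs 𝒜 𝒵 𝒞)} {ε q : ℝ} (hb : IsBoundedLaw P ε q)
    (h : IsBDTDLaw P) (aStar a : 𝒜) (x : Obs 𝒜 𝒵 𝒞) :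
    |mBDTD aStar a (trueNuisance P) x| ≤ growthConst ε q * (1 + |x.2.2.2|) := by
  rw [mBDTD_eq_drScore]
  exact hb.abs_drScore_le h (h.abs_weight_le hb.pos hb.treatment aStar a) hb.treatment x

lemma IsBoundedLaw.memLp_mBDTD {P : Measure (Obs 𝒜 𝒵 𝒞)} {ε q : ℝ} (hb : IsBoundedLaw P ε q)
    (h : IsBDTDLaw P) (hY : MemLp (fun x : Obs 𝒜 𝒵 𝒞 => x.2.2.2) 2 P) (aStar a : 𝒜) :
    MemLp (mBDTD aStar a (trueNuisance P)) 2 P := by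
  have := h.isProb
  have h1 := hb.abs_mBDTD_le h aStar a
  rw [mBDTD_eq_drScore] at h1 ⊢
  exact memLp_drScore hY h1

lemma CausalModel.memLp_obsLaw {M : CausalModel 𝒜 𝒵 𝒞} (hY : MemLp M.Y 2 M.prob) :
    MemLp (fun x : Obs 𝒜 𝒵 𝒞 => x.2.2.2) 2 M.obsLaw := by
  rw [CausalModel.obsLaw, memLp_map_measure_iff (Measurable.aestronglyMeasurable (by fun_prop))
    M.measurable_obs.aemeasurable]
  exact hY

lemma BoundednessConditions.isBoundedLaw {P : Measure (Obs 𝒜 𝒵 𝒞)} (h : IsBDTDLaw P)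
    {aStar a : 𝒜} {k : ℕ → ℕ} {ηhat : ∀ n, Sample (Obs 𝒜 𝒵 𝒞) n (k n) → Nuisance 𝒜 𝒵 𝒞}
    (hB : BoundednessConditions P aStar a k ηhat) : ∃ ε q, IsBoundedLaw P ε q := by
  obtain ⟨q, hq⟩ := hB.outcome_bdd
  obtain ⟨ε₂, h2, hε₂⟩ := hB.mediator_pos
  obtain ⟨ε₅, h5, hε₅⟩ := hB.treatment_pos
  have hq' := h.forall_of_ae (p := fun c _ z => |(trueNuisance P).outcome z c| < q) hq
  have h2' := h.forall_of_ae (p := fun c b z => ε₂ < (trueNuisance P).mediator z b c) hε₂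
  have h5' := h.forall_of_ae (p := fun c b _ => ε₅ < (trueNuisance P).treatment b c) hε₅
  obtain ⟨x⟩ := h.nonempty
  exact ⟨min ε₂ ε₅, q, lt_min h2 h5, (abs_nonneg _).trans (hq' x.1 x.2.1 x.2.2.1).le,
    fun z c => (hq' c x.2.1 z).le, fun z b c => (min_le_left _ _).trans (h2' c b z).le,
    fun b c => (min_le_right _ _).trans (h5' c b x.2.2.1).le⟩

lemma ProductRateConditions.isLittleOP {P : Measure (Obs 𝒜 𝒵 𝒞)} {aStar a : 𝒜} {k : ℕ → ℕ}
    {ηhat : ∀ n, Sample (Obs 𝒜 𝒵 𝒞) n (k n) → Nuisance 𝒜 𝒵 𝒞}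
    (h : ProductRateConditions P aStar a k ηhat) :
    IsLittleOP (fun n => sampleLaw P n (k n)) fun n w =>
      ENNReal.ofReal √(n : ℝ) * errorProducts P aStar a (ηhat n w) := by
  simp only [errorProducts, outcomeError, mul_add]
  exact (h.outcome_mediator.add h.outcome_treatment).add
    (((h.outcome_mediator_at aStar (by simp)).add (h.mediator_treatment_at aStar (by simp))).add
      ((h.outcome_mediator_at a (by simp)).add (h.mediator_treatment_at a (by simp))))

lemma IsNuisanceEstimator.measurable_mBDTD {k : ℕ → ℕ}
    {ηhat : ∀ n, Sample (Obs 𝒜 𝒵 𝒞) n (k n) → Nuisance 𝒜 𝒵 𝒞} (h : IsNuisanceEstimator k ηhat)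
    (aStar a : 𝒜) (n : ℕ) : Measurable fun p : Sample (Obs 𝒜 𝒵 𝒞) n (k n) × Obs 𝒜 𝒵 𝒞 =>
      mBDTD aStar a (ηhat n p.1) p.2 :=
  _root_.measurable_mBDTD (h.measurable_outcome n) (h.measurable_mediator n)
    (h.measurable_treatment n)

/-- The empirical process at the estimated function is negligible. -/
lemma AsymptoticNormalityConditions.isLittleOP {P : Measure (Obs 𝒜 𝒵 𝒞)} (h : IsBDTDLaw P)
    {aStar a : 𝒜} {k : ℕ → ℕ} {ηhat : ∀ n, Sample (Obs 𝒜 𝒵 𝒞) n (k n) → Nuisance 𝒜 𝒵 𝒞}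
    (hη : IsNuisanceEstimator k ηhat) (hA : AsymptoticNormalityConditions P aStar a k ηhat)
    (hm : MemLp (mBDTD aStar a (trueNuisance P)) 2 P) :
    IsLittleOP (fun n => sampleLaw P n (k n)) fun n w => ‖empiricalDeviation P w.1 (fun x =>
      mBDTD aStar a (ηhat n w) x - mBDTD aStar a (trueNuisance P) x)‖ₑ := by
  have hprob := h.isProb
  rcases hA.splitting_or_donsker with hs | ⟨𝓕, h𝓕, hmem⟩
  · obtain ⟨x₀⟩ := h.nonempty
    -- Under sample splitting the averaged sample may be frozen at an arbitrary point, which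
    -- exhibits η̂ as a measurable function of the auxiliary sample.
    have heq : ∀ n w, ηhat n w = ηhat n (fun _ => x₀, w.2) := fun n w => hs n _ _ rfl
    have h1 := hA.l2_consistent
    have h2 := isLittleOP_empiricalDeviation_of_split P (k := k) (G := fun n v x =>
      mBDTD aStar a (ηhat n (fun _ => x₀, v)) x - mBDTD aStar a (trueNuisance P) x) (fun n => ?_) ?_
    · refine h2.of_le (Eventually.of_forall fun n w => ?_)
      rw [heq n w]
    · refine Measurable.sub ?_ ?_
      · exact (hη.measurable_mBDTD aStar a n).comp
          ((measurable_const.prodMk measurable_fst).prodMk measurable_snd)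
      · rw [mBDTD_eq_drScore]
        exact (measurable_drScore _ _ _ _ _ _ _).comp measurable_snd
    · refine h1.of_le (Eventually.of_forall fun n w => ?_)
      rw [heq n w]
  · exact isLittleOP_empiricalDeviation_of_donsker P h𝓕 hm hmem hA.l2_consistent

namespace CausalModel.IsBDTD

variable {M : CausalModel 𝒜 𝒵 𝒞} {aStar a : 𝒜}

lemma integral_mBDTD_trueNuisance (hM : M.IsBDTD)
    (hi : Integrable (mBDTD aStar a (trueNuisance M.obsLaw)) M.obsLaw) :
    ∫ x, mBDTD aStar a (trueNuisance M.obsLaw) x ∂M.obsLaw = M.ace aStar a :=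
  hM.integral_mBDTD (fun _ _ => (hasSum_fintype _).summable) hi (Or.inl ⟨rfl, rfl⟩)

theorem isAsymptoticallyLinear (hM : M.IsBDTD) {k : ℕ → ℕ}
    {ηhat : ∀ n, Sample (Obs 𝒜 𝒵 𝒞) n (k n) → Nuisance 𝒜 𝒵 𝒞}
    {θhat : ∀ n, Sample (Obs 𝒜 𝒵 𝒞) n (k n) → ℝ}
    (hθ : SolvesEstimatingEquation aStar a k ηhat θhat) (hη : IsNuisanceEstimator k ηhat)
    (hY : MemLp M.Y 2 M.prob) (hA : AsymptoticNormalityConditions M.obsLaw aStar a k ηhat)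
    (hB : BoundednessConditions M.obsLaw aStar a k ηhat)
    (hR : ProductRateConditions M.obsLaw aStar a k ηhat) :
    IsAsymptoticallyLinear M.obsLaw (M.ace aStar a)
      (phiBDTD aStar a (trueNuisance M.obsLaw) (M.ace aStar a)) k θhat := by
  have h := hM.isBDTDLaw
  obtain ⟨ε, q, hb⟩ := hB.isBoundedLaw h
  have hm := hb.memLp_mBDTD h (memLp_obsLaw hY) aStar a
  have hm1 := hm.integrable one_le_two
  have hmean := hM.integral_mBDTD_trueNuisance hm1
  refine ⟨hm.sub (memLp_const _), ?_, ?_⟩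
  · have : ∫ x, phiBDTD aStar a (trueNuisance M.obsLaw) (M.ace aStar a) x ∂M.obsLaw
        = ∫ x, mBDTD aStar a (trueNuisance M.obsLaw) x ∂M.obsLaw - M.ace aStar a := by
      simp only [phiBDTD]
      rw [integral_sub hm1 (integrable_const _)]
      simp
    rw [this, hmean, sub_self]
  obtain ⟨δ₁, hδ₁, hest₁⟩ := hB.treatment_est_pos aStar (by simp)
  obtain ⟨δ₂, hδ₂, hest₂⟩ := hB.treatment_est_pos a (by simp)
  set δ := min δ₁ δ₂ with hδ
  have hδ0 : 0 < δ := lt_min hδ₁ hδ₂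
  set K : ℝ≥0∞ := ENNReal.ofReal (1 / δ + 1 + q / δ) * ENNReal.ofReal (1 / ε ^ 2) with hK
  have hKtop : K ≠ ∞ := ENNReal.mul_ne_top ENNReal.ofReal_ne_top ENNReal.ofReal_ne_top
  have hsmall := (hA.isLittleOP h hη hm).add (hR.isLittleOP.const_mul hKtop)
  -- The bound 1 on the norm of m̂ - m₀ serves only to make m̂ integrable.
  refine hsmall.mono (((hB.mix_est_pos.and hest₁).and hest₂).and
    (hA.l2_consistent.withProbToOne (ε := 1) one_pos)) ?_
  filter_upwards [eventually_gt_atTop 0] with n hn w hw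
  obtain ⟨⟨⟨hw1, hw2⟩, hw3⟩, hw4⟩ := hw
  have hn' : (0 : ℝ) < n := by exact_mod_cast hn
  obtain ⟨x₀⟩ := h.nonempty
  have hmix := h.forall_of_ae (p := fun c _ z =>
    0 < ∑' b, (ηhat n w).mediator z b c * (ηhat n w).treatment b c) hw1
  have hp1 := h.forall_of_ae (p := fun c _ _ => δ₁ < (ηhat n w).treatment aStar c) hw2
  have hp2 := h.forall_of_ae (p := fun c _ _ => δ₂ < (ηhat n w).treatment a c) hw3
  have hmeas : Measurable (mBDTD aStar a (ηhat n w)) := by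
    rw [mBDTD_eq_drScore]; exact measurable_drScore _ _ _ _ _ _ _
  have hdiff : MemLp (fun x => mBDTD aStar a (ηhat n w) x
      - mBDTD aStar a (trueNuisance M.obsLaw) x) 2 M.obsLaw :=
    ⟨hmeas.aestronglyMeasurable.sub hm.1, hw4.trans ENNReal.one_lt_top⟩
  have hi : Integrable (mBDTD aStar a (ηhat n w)) M.obsLaw := by
    have := (hdiff.integrable one_le_two).add hm1
    refine this.congr (ae_of_all _ fun x => ?_)
    simp
  have hbias := h.enorm_bias_le hb.pos hδ0 hb.nonneg hb.mediator hb.treatment hb.outcome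
    (hM.ace_eq aStar a).1 (η := ηhat n w)
    (fun z c => by simpa only [tsum_fintype] using hmix c x₀.2.1 z)
    (fun z b c => hη.mediator_mem n w z b c) (fun b c => hη.treatment_mem n w b c)
    (fun c => (min_le_left _ _).trans (hp1 c x₀.2.1 x₀.2.2.1).le)
    (fun c => (min_le_right _ _).trans (hp2 c x₀.2.1 x₀.2.2.1).le) hi
  rw [(hM.ace_eq aStar a).2] at hbias
  have hsq : √(n : ℝ) * √(n : ℝ) = n := Real.mul_self_sqrt hn'.le
  have hsq0 : 0 < √(n : ℝ) := Real.sqrt_pos.2 hn'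
  -- Exact identity: empirical process at m̂ - m₀ plus √n times the bias of m̂.
  have hdecomp : √(n : ℝ) * (θhat n w - M.ace aStar a) - (√(n : ℝ))⁻¹ *
      ∑ i, phiBDTD aStar a (trueNuisance M.obsLaw) (M.ace aStar a) (w.1 i)
      = empiricalDeviation M.obsLaw w.1 (fun x =>
          mBDTD aStar a (ηhat n w) x - mBDTD aStar a (trueNuisance M.obsLaw) x)
        + √(n : ℝ) * (∫ x, mBDTD aStar a (ηhat n w) x ∂M.obsLaw - M.ace aStar a) := by
    have e1 : ∫ x, (mBDTD aStar a (ηhat n w) x - mBDTD aStar a (trueNuisance M.obsLaw) x) ∂M.obsLaw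
        = ∫ x, mBDTD aStar a (ηhat n w) x ∂M.obsLaw - M.ace aStar a := by
      rw [integral_sub hi hm1, hmean]
    rw [hθ.eq_average hn w, empiricalDeviation, e1]
    simp only [phiBDTD, Finset.sum_sub_distrib, Finset.sum_const, Finset.card_univ,
      Fintype.card_fin, nsmul_eq_mul]
    field_simp
    rw [Real.sq_sqrt hn'.le]
    ring
  rw [hdecomp]
  refine (enorm_add_le _ _).trans (add_le_add le_rfl ?_)
  rw [enorm_mul, ← ofReal_norm, Real.norm_of_nonneg hsq0.le, mul_left_comm]
  exact mul_le_mul' le_rfl hbias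

end CausalModel.IsBDTD

end AsymptoticLinearity

/-! ### Differentiability in quadratic mean along local sequences -/

section LocalDensities

variable {X : Type*} [MeasurableSpace X]

/-- Root densities `s n` whose rescaled increments `√n (s n - s₀)` are asymptotically `g n * s₀`,
with `|g n| ≤ D` and `D * s₀` square integrable. -/
structure LocalDensities (μ : Measure X) (s : ℕ → X → ℝ) (s₀ : X → ℝ) (g : ℕ → X → ℝ)
    (D : X → ℝ) : Prop where
  measurable_s : ∀ n, Measurable (s n)
  measurable_s₀ : Measurable s₀
  measurable_g : ∀ n, Measurable (g n)
  measurable_D : Measurable D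
  nonneg : ∀ n x, 0 ≤ s n x
  nonneg₀ : ∀ x, 0 ≤ s₀ x
  abs_g_le : ∀ n x, |g n x| ≤ D x
  memLp_D : MemLp (fun x => D x * s₀ x) 2 μ
  remainder : Tendsto (fun n : ℕ => eLpNorm (fun x => √(n : ℝ) * (s n x - s₀ x) - g n x * s₀ x) 2 μ)
    atTop (𝓝 0)

lemma lintegral_enorm_sq_eq {μ : Measure X} (f : X → ℝ) :
    eLpNorm f 2 μ ^ 2 = ∫⁻ x, ENNReal.ofReal (f x ^ 2) ∂μ := by
  rw [eLpNorm_eq_lintegral_rpow_enorm_toReal two_ne_zero ENNReal.ofNat_ne_top, ← ENNReal.rpow_natCast,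
    ← ENNReal.rpow_mul]
  simp only [ENNReal.toReal_ofNat, Nat.cast_ofNat, one_div, ne_eq, OfNat.ofNat_ne_zero,
    not_false_eq_true, inv_mul_cancel₀, ENNReal.rpow_one]
  refine lintegral_congr fun x => ?_
  rw [← ofReal_norm, ENNReal.ofReal_rpow_of_nonneg (norm_nonneg _) (by norm_num)]
  simp

lemma eLpNorm_eq_one {μ : Measure X} {f : X → ℝ} (h : ∫⁻ x, ENNReal.ofReal (f x ^ 2) ∂μ = 1) :
    eLpNorm f 2 μ = 1 := by
  rw [← lintegral_enorm_sq_eq] at h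
  exact le_antisymm ((pow_le_one_iff two_ne_zero).1 h.le) ((one_le_pow_iff two_ne_zero).1 h.ge)

namespace LocalDensities

variable {μ : Measure X} {s : ℕ → X → ℝ} {s₀ : X → ℝ} {g : ℕ → X → ℝ} {D : X → ℝ}

lemma eLpNorm_increment_le (h : LocalDensities μ s s₀ g D) : ∀ᶠ n : ℕ in atTop,
    eLpNorm (fun x => √(n : ℝ) * (s n x - s₀ x)) 2 μ ≤ 1 + eLpNorm (fun x => D x * s₀ x) 2 μ := by
  filter_upwards [h.remainder.eventually (gt_mem_nhds one_pos)] with n hr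
  have hm : Measurable fun x => √(n : ℝ) * (s n x - s₀ x) :=
    ((h.measurable_s n).sub h.measurable_s₀).const_mul _
  have : (fun x => √(n : ℝ) * (s n x - s₀ x))
      = (fun x => √(n : ℝ) * (s n x - s₀ x) - g n x * s₀ x) + fun x => g n x * s₀ x := by
    ext x; simp
  rw [this]
  refine (eLpNorm_add_le (hm.sub ((h.measurable_g n).mul h.measurable_s₀)).aestronglyMeasurable
    ((h.measurable_g n).mul h.measurable_s₀).aestronglyMeasurable one_le_two).trans
    (add_le_add hr.le (eLpNorm_mono fun x => ?_))
  rw [Pi.mul_apply, norm_mul, norm_mul]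
  gcongr
  exact (h.abs_g_le n x).trans (le_abs_self _)

lemma eLpNorm_mul_add_le (h : LocalDensities μ s s₀ g D) {V : X → ℝ} (hV : Measurable V) {C : ℝ≥0∞}
    (hV₀ : eLpNorm (fun x => V x * s₀ x) 2 μ ≤ C)
    (hVn : ∀ᶠ n in atTop, eLpNorm (fun x => V x * s n x) 2 μ ≤ C) :
    ∀ᶠ n in atTop, eLpNorm (fun x => V x * (s n x + s₀ x)) 2 μ ≤ 2 * C := by
  filter_upwards [hVn] with n hn
  simp_rw [mul_add]
  refine (eLpNorm_add_le (hV.mul (h.measurable_s n)).aestronglyMeasurable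
    (hV.mul h.measurable_s₀).aestronglyMeasurable one_le_two).trans ?_
  rw [two_mul]
  exact add_le_add hn hV₀

/-- The increments of the measures are of order `1 / √n`. -/
lemma lintegral_increment_bounded (h : LocalDensities μ s s₀ g D) {V : X → ℝ} (hV : Measurable V)
    {C : ℝ≥0∞} (hC : C ≠ ∞) (hV₀ : eLpNorm (fun x => V x * s₀ x) 2 μ ≤ C)
    (hVn : ∀ᶠ n in atTop, eLpNorm (fun x => V x * s n x) 2 μ ≤ C) :
    ∃ K : ℝ≥0∞, K ≠ ∞ ∧ ∀ᶠ n : ℕ in atTop,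
      ∫⁻ x, ‖V x‖ₑ * ‖√(n : ℝ) * (s n x ^ 2 - s₀ x ^ 2)‖ₑ ∂μ ≤ K := by
  refine ⟨(1 + eLpNorm (fun x => D x * s₀ x) 2 μ) * (2 * C), ?_, ?_⟩
  · exact ENNReal.mul_ne_top (ENNReal.add_ne_top.2 ⟨ENNReal.one_ne_top, h.memLp_D.2.ne⟩)
      (ENNReal.mul_ne_top ENNReal.ofNat_ne_top hC)
  filter_upwards [h.eLpNorm_mul_add_le hV hV₀ hVn, h.eLpNorm_increment_le] with n hn hr
  have hm1 : Measurable fun x => √(n : ℝ) * (s n x - s₀ x) :=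
    ((h.measurable_s n).sub h.measurable_s₀).const_mul _
  have hm2 : Measurable fun x => V x * (s n x + s₀ x) :=
    hV.mul ((h.measurable_s n).add h.measurable_s₀)
  -- Factor the difference of squares and apply Cauchy-Schwarz: root increments are O(1 / √n) in L²,
  -- and V times the root densities is bounded in L².
  calc _ = ∫⁻ x, ‖√(n : ℝ) * (s n x - s₀ x)‖ₑ * ‖V x * (s n x + s₀ x)‖ₑ ∂μ := by
        refine lintegral_congr fun x => ?_
        rw [← enorm_mul, ← enorm_mul]
        congr 1
        ring
    _ ≤ _ := lintegral_enorm_mul_le hm1.aemeasurable hm2.aemeasurable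
    _ ≤ _ := mul_le_mul' hr hn

/-- Integrals of dominated functions that tend to zero have increments of order `o(1 / √n)`. -/
lemma tendsto_lintegral_increment (h : LocalDensities μ s s₀ g D) {V : X → ℝ} (hV : Measurable V)
    (hV1 : ∀ x, 1 ≤ V x) {C : ℝ≥0∞} (hC : C ≠ ∞) (hV₀ : eLpNorm (fun x => V x * s₀ x) 2 μ ≤ C)
    (hVn : ∀ᶠ n in atTop, eLpNorm (fun x => V x * s n x) 2 μ ≤ C) {u : ℕ → X → ℝ}
    (hum : ∀ n, Measurable (u n)) (huV : ∀ᶠ n in atTop, ∀ x, |u n x| ≤ V x)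
    (hu : ∀ᵐ x ∂μ, s₀ x ≠ 0 → Tendsto (fun n => u n x) atTop (𝓝 0)) :
    Tendsto (fun n : ℕ => ∫⁻ x, ‖u n x‖ₑ * ‖√(n : ℝ) * (s n x ^ 2 - s₀ x ^ 2)‖ₑ ∂μ)
      atTop (𝓝 0) := by
  have hV0 : ∀ x, 0 < V x := fun x => one_pos.trans_le (hV1 x)
  -- Dividing by V makes the factor at most 1, so D s₀ dominates in L²; the factor V is restored
  -- next to s n + s₀.
  have hdom : Tendsto (fun n => eLpNorm (fun x => D x * s₀ x * (u n x / V x)) 2 μ)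
      atTop (𝓝 0) := by
    have h1 : Tendsto (fun n => ∫⁻ x, ENNReal.ofReal ((D x * s₀ x * (u n x / V x)) ^ 2) ∂μ)
        atTop (𝓝 0) := by
      have e0 : ∫⁻ _ : X, (0 : ℝ≥0∞) ∂μ = 0 := by simp
      rw [← e0]
      refine tendsto_lintegral_filter_of_dominated_convergence
        (fun x => ENNReal.ofReal ((D x * s₀ x) ^ 2)) ?_ ?_ ?_ ?_
      · refine Eventually.of_forall fun n => Measurable.ennreal_ofReal ?_
        exact ((h.measurable_D.mul h.measurable_s₀).mul ((hum n).div hV)).pow_const _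
      · filter_upwards [huV] with n hn
        refine ae_of_all _ fun x => ENNReal.ofReal_le_ofReal ?_
        rw [mul_pow]
        refine mul_le_of_le_one_right (sq_nonneg _) ?_
        rw [sq_le_one_iff_abs_le_one, abs_div, abs_of_pos (hV0 x), div_le_one (hV0 x)]
        exact hn x
      · rw [← lintegral_enorm_sq_eq]
        exact ENNReal.pow_ne_top h.memLp_D.2.ne
      · filter_upwards [hu] with x hx
        rw [← ENNReal.ofReal_zero]
        refine (ENNReal.continuous_ofReal.tendsto _).comp ?_
        by_cases hs : s₀ x = 0
        · simp [hs]
        · have h2 := ((((hx hs).div_const (V x)).const_mul (D x * s₀ x)).pow 2)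
          simpa using h2
    simp_rw [← lintegral_enorm_sq_eq] at h1
    have h2 := h1.ennrpow_const (1 / 2 : ℝ)
    rw [ENNReal.zero_rpow_of_pos (by norm_num)] at h2
    refine h2.congr fun n => ?_
    rw [← ENNReal.rpow_natCast, ← ENNReal.rpow_mul]
    norm_num
  have hlim : Tendsto (fun n : ℕ => (eLpNorm (fun x => √(n : ℝ) * (s n x - s₀ x) - g n x * s₀ x) 2 μ
      + eLpNorm (fun x => D x * s₀ x * (u n x / V x)) 2 μ) * (2 * C)) atTop (𝓝 0) := by
    have := ENNReal.Tendsto.mul_const (b := 2 * C) (h.remainder.add hdom)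
      (Or.inr (ENNReal.mul_ne_top ENNReal.ofNat_ne_top hC))
    simpa using this
  refine tendsto_zero_of_eventually_le hlim ?_
  filter_upwards [huV, h.eLpNorm_mul_add_le hV hV₀ hVn] with n hn hb
  have hmR : Measurable fun x => √(n : ℝ) * (s n x - s₀ x) - g n x * s₀ x :=
    (((h.measurable_s n).sub h.measurable_s₀).const_mul _).sub
      ((h.measurable_g n).mul h.measurable_s₀)
  have hmD : Measurable fun x => D x * s₀ x * (u n x / V x) :=
    (h.measurable_D.mul h.measurable_s₀).mul ((hum n).div hV)
  have hm2 : Measurable fun x => V x * (s n x + s₀ x) :=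
    hV.mul ((h.measurable_s n).add h.measurable_s₀)
  calc _ ≤ ∫⁻ x, ‖√(n : ℝ) * (s n x - s₀ x) - g n x * s₀ x‖ₑ * ‖V x * (s n x + s₀ x)‖ₑ
        + ‖D x * s₀ x * (u n x / V x)‖ₑ * ‖V x * (s n x + s₀ x)‖ₑ ∂μ := by
        refine lintegral_mono fun x => ?_
        have hs : 0 ≤ s n x + s₀ x := add_nonneg (h.nonneg n x) (h.nonneg₀ x)
        have hD : 0 ≤ D x := (abs_nonneg _).trans (h.abs_g_le n x)
        rw [← enorm_mul, ← enorm_mul, ← enorm_mul]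
        simp only [← ofReal_norm, Real.norm_eq_abs]
        rw [← ENNReal.ofReal_add (abs_nonneg _) (abs_nonneg _)]
        refine ENNReal.ofReal_le_ofReal ?_
        have e : u n x * (√(n : ℝ) * (s n x ^ 2 - s₀ x ^ 2))
            = (√(n : ℝ) * (s n x - s₀ x) - g n x * s₀ x) * (u n x * (s n x + s₀ x))
              + g n x * s₀ x * (u n x * (s n x + s₀ x)) := by ring
        rw [e]
        refine (abs_add_le _ _).trans (add_le_add ?_ ?_)
        · rw [abs_mul, abs_mul _ (V x * _), abs_mul (u n x), abs_mul (V x), abs_of_pos (hV0 x)]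
          gcongr
          exact hn x
        · have e2 : D x * s₀ x * (u n x / V x) * (V x * (s n x + s₀ x))
              = D x * s₀ x * (u n x * (s n x + s₀ x)) := by
            have := (hV0 x).ne'
            field_simp
          rw [e2, abs_mul, abs_mul (D x * s₀ x), abs_mul, abs_mul (D x), abs_of_nonneg hD]
          gcongr
          exact h.abs_g_le n x
    _ = _ := lintegral_add_left (hmR.enorm.mul hm2.enorm) _
    _ ≤ _ := by
        rw [add_mul]
        exact add_le_add
          ((lintegral_enorm_mul_le hmR.aemeasurable hm2.aemeasurable).trans (mul_le_mul' le_rfl hb))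
          ((lintegral_enorm_mul_le hmD.aemeasurable hm2.aemeasurable).trans (mul_le_mul' le_rfl hb))

end LocalDensities

end LocalDensities

/-! ### Contiguity of product measures -/

section Contiguity

variable {X : Type*} [MeasurableSpace X] {ι : Type*} [Fintype ι]

lemma lintegral_pi_prod {P : Measure X} [IsProbabilityMeasure P] {f : ι → X → ℝ≥0∞}
    (hf : ∀ i, Measurable (f i)) :
    ∫⁻ x, ∏ i, f i (x i) ∂(Measure.pi fun _ : ι => P) = ∏ i, ∫⁻ x, f i x ∂P := by
  have h := lintegral_prod_eq_prod_lintegral_of_indepFun Finset.univ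
    (fun i (x : ι → X) => f i (x i))
    (iIndepFun_pi (μ := fun _ : ι => P) fun i => (hf i).aemeasurable)
    (fun i => (hf i).comp (measurable_pi_apply i))
  rw [h]
  exact Finset.prod_congr rfl fun i _ =>
    (measurePreserving_eval (fun _ : ι => P) i).lintegral_comp (hf i)

lemma pi_withDensity {P : Measure X} [IsProbabilityMeasure P] {f : X → ℝ≥0∞} (hf : Measurable f)
    [IsFiniteMeasure (P.withDensity f)] :
    (Measure.pi fun _ : ι => P.withDensity f)
      = (Measure.pi fun _ : ι => P).withDensity fun x => ∏ i, f (x i) := by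
  refine Measure.pi_eq fun s hs => ?_
  rw [withDensity_apply _ (MeasurableSet.univ_pi hs),
    ← lintegral_indicator (MeasurableSet.univ_pi hs)]
  have e : ∀ x : ι → X, (Set.univ.pi s).indicator (fun x => ∏ i, f (x i)) x
      = ∏ i, (s i).indicator f (x i) := by
    intro x
    by_cases hx : x ∈ Set.univ.pi s
    · rw [Set.indicator_of_mem hx]
      exact Finset.prod_congr rfl fun i _ => (Set.indicator_of_mem (hx i (Set.mem_univ i)) _).symm
    · rw [Set.indicator_of_notMem hx]
      obtain ⟨i, hi⟩ : ∃ i, x i ∉ s i := by simpa using hx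
      exact (Finset.prod_eq_zero (Finset.mem_univ i) (Set.indicator_of_notMem hi _)).symm
  simp_rw [e]
  rw [lintegral_pi_prod fun i => hf.indicator (hs i)]
  refine Finset.prod_congr rfl fun i _ => ?_
  rw [withDensity_apply _ (hs i), lintegral_indicator (hs i)]

/-- Cauchy-Schwarz against the indicator; the second moment of the product density factorizes. -/
lemma pi_withDensity_sq_le {P : Measure X} [IsProbabilityMeasure P] {f : X → ℝ≥0∞}
    (hf : Measurable f) [IsFiniteMeasure (P.withDensity f)] (s : Set (ι → X)) :
    (Measure.pi fun _ : ι => P.withDensity f) s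
      ≤ (Measure.pi (fun _ : ι => P) s) ^ (1 / 2 : ℝ)
        * ((∫⁻ x, f x ^ 2 ∂P) ^ Fintype.card ι) ^ (1 / 2 : ℝ) := by
  set t := toMeasurable (Measure.pi fun _ : ι => P) s with ht
  have htm : MeasurableSet t := measurableSet_toMeasurable _ _
  refine (measure_mono (subset_toMeasurable (Measure.pi fun _ : ι => P) s)).trans ?_
  rw [← measure_toMeasurable s, ← ht, pi_withDensity hf, withDensity_apply _ htm,
    ← lintegral_indicator htm]
  have hp : Measurable fun x : ι → X => ∏ i, f (x i) :=
    Finset.measurable_prod _ fun i _ => hf.comp (measurable_pi_apply i)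
  have h := ENNReal.lintegral_mul_le_Lp_mul_Lq (Measure.pi fun _ : ι => P)
    Real.HolderConjugate.two_two ((measurable_one.indicator htm).aemeasurable
      (μ := Measure.pi fun _ : ι => P)) hp.aemeasurable
  calc _ = ∫⁻ x : ι → X, t.indicator 1 x * ∏ i, f (x i) ∂(Measure.pi fun _ : ι => P) := by
        refine lintegral_congr fun x => ?_
        by_cases hx : x ∈ t <;> simp [hx]
    _ ≤ _ := h
    _ = _ := ?_
  · congr 2
    · rw [← lintegral_indicator_one htm]
      refine lintegral_congr fun x => ?_
      by_cases hx : x ∈ t <;> simp [hx]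
    · have : ∀ x : ι → X, (∏ i, f (x i)) ^ (2 : ℝ) = ∏ i, f (x i) ^ 2 := by
        intro x
        rw [ENNReal.rpow_ofNat, Finset.prod_pow]
      simp_rw [this]
      rw [lintegral_pi_prod (f := fun _ x => f x ^ 2) fun _ => hf.pow_const 2]
      simp

/-- A truncated likelihood ratio bounds product measures by product measures. -/
lemma pi_withDensity_le {μ : Measure X} {s s₀ : X → ℝ} (hs : Measurable s) (hs₀ : Measurable s₀)
    (hn : ∀ x, 0 ≤ s x) (hn₀ : ∀ x, 0 ≤ s₀ x) {P P₀ : Measure X} [IsProbabilityMeasure P]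
    [IsProbabilityMeasure P₀] (hP : P = μ.withDensity fun x => ENNReal.ofReal (s x ^ 2))
    (hP₀ : P₀ = μ.withDensity fun x => ENNReal.ofReal (s₀ x ^ 2)) (A : Set (ι → X)) :
    Measure.pi (fun _ : ι => P) A ≤ Fintype.card ι * P {x | 2 * s₀ x < s x}
      + (Measure.pi (fun _ : ι => P₀) A) ^ (1 / 2 : ℝ)
        * ((1 + 9 * eLpNorm (fun x => s x - s₀ x) 2 μ ^ 2) ^ Fintype.card ι) ^ (1 / 2 : ℝ) := by
  -- Off B the likelihood ratio is at most 4, so it has a second moment; B also contains the part of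
  -- P singular to P₀.
  set B : Set X := {x | 2 * s₀ x < s x} with hB
  have hBm : MeasurableSet B := measurableSet_lt (hs₀.const_mul 2) hs
  set L : X → ℝ≥0∞ := Bᶜ.indicator fun x => ENNReal.ofReal ((s x / s₀ x) ^ 2) with hL
  have hLm : Measurable L := ((hs.div hs₀).pow_const 2).ennreal_ofReal.indicator hBm.compl
  have hzero : ∀ x ∉ B, s₀ x = 0 → s x = 0 := by
    intro x hx h0
    simp only [hB, Set.mem_ofPred_eq, not_lt, h0, mul_zero] at hx
    exact le_antisymm hx (hn x)
  have hd₀ : Measurable fun x => ENNReal.ofReal (s₀ x ^ 2) := (hs₀.pow_const 2).ennreal_ofReal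
  have hd : Measurable fun x => ENNReal.ofReal (s x ^ 2) := (hs.pow_const 2).ennreal_ofReal
  have hrestrict : P.restrict Bᶜ = P₀.withDensity L := by
    rw [hP, hP₀, restrict_withDensity hBm.compl, ← withDensity_indicator hBm.compl,
      ← withDensity_mul μ hd₀ hLm]
    congr 1
    ext x
    by_cases hx : x ∈ B
    · simp [hL, hx]
    · have hx' : x ∈ Bᶜ := hx
      simp only [hL, Pi.mul_apply, Set.indicator_of_mem hx']
      rw [← ENNReal.ofReal_mul (sq_nonneg _), ← mul_pow]
      by_cases h0 : s₀ x = 0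
      · simp [h0, hzero x hx h0]
      · rw [mul_div_cancel₀ _ h0]
  have hfin : IsFiniteMeasure (P₀.withDensity L) := by rw [← hrestrict]; infer_instance
  have hmoment : ∫⁻ x, L x ^ 2 ∂P₀ ≤ 1 + 9 * eLpNorm (fun x => s x - s₀ x) 2 μ ^ 2 := by
    have hpt : ∀ x, ENNReal.ofReal (s₀ x ^ 2) * L x ^ 2 + ENNReal.ofReal (s₀ x ^ 2)
        ≤ 2 * ENNReal.ofReal (s x ^ 2) + 9 * ENNReal.ofReal ((s x - s₀ x) ^ 2) := by
      intro x
      have e2 : (2 : ℝ≥0∞) = ENNReal.ofReal 2 := by simp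
      have e9 : (9 : ℝ≥0∞) = ENNReal.ofReal 9 := by simp
      by_cases hx : x ∈ B
      · have hx2 : 2 * s₀ x < s x := hx
        rw [hL, Set.indicator_of_notMem (by simpa using hx)]
        have h1 : ENNReal.ofReal (s₀ x ^ 2) ≤ 9 * ENNReal.ofReal ((s x - s₀ x) ^ 2) := by
          rw [e9, ← ENNReal.ofReal_mul (by norm_num)]
          refine ENNReal.ofReal_le_ofReal ?_
          have := hn₀ x
          nlinarith
        calc _ = ENNReal.ofReal (s₀ x ^ 2) := by simp
          _ ≤ _ := h1.trans le_add_self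
      · have hx' : x ∈ Bᶜ := hx
        have hx2 : s x ≤ 2 * s₀ x := not_lt.1 hx
        rw [hL, Set.indicator_of_mem hx', ← ENNReal.ofReal_pow (sq_nonneg _),
          ← ENNReal.ofReal_mul (sq_nonneg _), ← ENNReal.ofReal_add (by positivity) (by positivity),
          e2, e9, ← ENNReal.ofReal_mul (by norm_num), ← ENNReal.ofReal_mul (by norm_num),
          ← ENNReal.ofReal_add (by positivity) (by positivity)]
        refine ENNReal.ofReal_le_ofReal ?_
        by_cases h0 : s₀ x = 0
        · simp [h0, hzero x hx h0]
        · obtain ⟨r, hr⟩ : ∃ r, s x = r * s₀ x := ⟨s x / s₀ x, (div_mul_cancel₀ _ h0).symm⟩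
          have hpos : 0 < s₀ x := lt_of_le_of_ne (hn₀ x) (Ne.symm h0)
          rw [hr, mul_div_cancel_right₀ _ h0]
          have hr0 : 0 ≤ r := by
            have := hn x; rw [hr] at this; exact nonneg_of_mul_nonneg_left this hpos
          have hr2 : r ≤ 2 := by
            rw [hr] at hx2; exact le_of_mul_le_mul_right hx2 hpos
          -- The difference of the two sides is (r - 1)² (9 - (r + 1)²) = (r - 1)² (2 - r)(r + 4),
          -- nonnegative for 0 ≤ r ≤ 2. This is the origin of the 9.
          have key : (r ^ 2) ^ 2 + 1 ≤ 2 * r ^ 2 + 9 * (r - 1) ^ 2 := by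
            nlinarith [mul_nonneg (mul_nonneg (by linarith : 0 ≤ 2 - r) (by linarith : 0 ≤ r + 4))
              (sq_nonneg (r - 1))]
          nlinarith [mul_le_mul_of_nonneg_left key (sq_nonneg (s₀ x))]
    have hint := lintegral_mono (μ := μ) hpt
    have hdiff : Measurable fun x => ENNReal.ofReal ((s x - s₀ x) ^ 2) :=
      ((hs.sub hs₀).pow_const 2).ennreal_ofReal
    have i1 : ∫⁻ x, ENNReal.ofReal (s₀ x ^ 2) ∂μ = 1 := by
      have : P₀ Set.univ = 1 := measure_univ
      rwa [hP₀, withDensity_apply _ MeasurableSet.univ, setLIntegral_univ] at this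
    have i2 : ∫⁻ x, ENNReal.ofReal (s x ^ 2) ∂μ = 1 := by
      have : P Set.univ = 1 := measure_univ
      rwa [hP, withDensity_apply _ MeasurableSet.univ, setLIntegral_univ] at this
    have i3 : ∫⁻ x, L x ^ 2 ∂P₀ = ∫⁻ x, ENNReal.ofReal (s₀ x ^ 2) * L x ^ 2 ∂μ := by
      rw [hP₀, lintegral_withDensity_eq_lintegral_mul _ hd₀ (hLm.pow_const 2)]
      rfl
    rw [lintegral_add_right _ hd₀, lintegral_add_left (hd.const_mul 2), lintegral_const_mul _ hd,
      lintegral_const_mul _ hdiff, i1, i2, ← i3,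
      ← lintegral_enorm_sq_eq, mul_one] at hint
    have e : (2 : ℝ≥0∞) + 9 * eLpNorm (fun x => s x - s₀ x) 2 μ ^ 2
        = (1 + 9 * eLpNorm (fun x => s x - s₀ x) 2 μ ^ 2) + 1 := by
      rw [add_right_comm, one_add_one_eq_two]
    rw [e] at hint
    exact (ENNReal.add_le_add_iff_right ENNReal.one_ne_top).1 hint
  have hsplit : A ⊆ (⋃ i, {w : ι → X | w i ∈ B}) ∪ (A ∩ Set.univ.pi fun _ => Bᶜ) := by
    intro w hw
    by_cases h : ∃ i, w i ∈ B
    · exact Or.inl (Set.mem_iUnion.2 h)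
    · exact Or.inr ⟨hw, fun i _ hi => h ⟨i, hi⟩⟩
  refine (measure_mono hsplit).trans ((measure_union_le _ _).trans (add_le_add ?_ ?_))
  · refine (measure_iUnion_fintype_le _ _).trans ?_
    have : ∀ i : ι, Measure.pi (fun _ : ι => P) {w : ι → X | w i ∈ B} = P B := fun i =>
      (measurePreserving_eval (fun _ : ι => P) i).measure_preimage hBm.nullMeasurableSet
    simp [this]
  · rw [← Measure.restrict_apply' (MeasurableSet.univ_pi fun _ => hBm.compl),
      Measure.restrict_pi_pi, hrestrict]
    refine (pi_withDensity_sq_le hLm A).trans ?_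
    gcongr

/-- Contiguity must cover all n + k observations, so both samples are merged into one product. -/
lemma sampleLaw_eq_pi (P : Measure X) [IsProbabilityMeasure P] (n k : ℕ) (A : Set (Sample X n k)) :
    sampleLaw P n k A = Measure.pi (fun _ : Fin n ⊕ Fin k => P)
      (MeasurableEquiv.sumPiEquivProdPi (fun _ : Fin n ⊕ Fin k => X) ⁻¹' A) := by
  rw [sampleLaw, ← (measurePreserving_sumPiEquivProdPi (fun _ : Fin n ⊕ Fin k => P)).map_eq,
    MeasurableEquiv.map_apply]

namespace LocalDensities

variable {μ : Measure X} {s : ℕ → X → ℝ} {s₀ : X → ℝ} {g : ℕ → X → ℝ} {D : X → ℝ}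

lemma mul_sq_eLpNorm_eq (n : ℕ) (f : X → ℝ) :
    (n : ℝ≥0∞) * eLpNorm f 2 μ ^ 2 = eLpNorm (fun x => √(n : ℝ) * f x) 2 μ ^ 2 := by
  have : (fun x => √(n : ℝ) * f x) = √(n : ℝ) • f := rfl
  rw [this, eLpNorm_const_smul, mul_pow]
  congr 1
  rw [← ofReal_norm, Real.norm_of_nonneg (Real.sqrt_nonneg _),
    ← ENNReal.ofReal_pow (Real.sqrt_nonneg _), Real.sq_sqrt (Nat.cast_nonneg n),
    ENNReal.ofReal_natCast]

lemma exists_sq_eLpNorm_le (h : LocalDensities μ s s₀ g D) :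
    ∃ c : ℝ, 0 ≤ c ∧ ∀ᶠ n : ℕ in atTop,
      eLpNorm (fun x => s n x - s₀ x) 2 μ ^ 2 ≤ ENNReal.ofReal (c / n) := by
  set K : ℝ≥0∞ := (1 + eLpNorm (fun x => D x * s₀ x) 2 μ) ^ 2
  have hK : K ≠ ∞ :=
    ENNReal.pow_ne_top (ENNReal.add_ne_top.2 ⟨ENNReal.one_ne_top, h.memLp_D.2.ne⟩)
  refine ⟨K.toReal, ENNReal.toReal_nonneg, ?_⟩
  filter_upwards [h.eLpNorm_increment_le, eventually_gt_atTop 0] with n hn hpos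
  have hpos' : (0 : ℝ) < n := by exact_mod_cast hpos
  rw [ENNReal.ofReal_div_of_pos hpos', ENNReal.ofReal_toReal hK, ENNReal.ofReal_natCast,
    ENNReal.le_div_iff_mul_le (Or.inl (by simpa using hpos.ne')) (Or.inl (by simp)), mul_comm,
    mul_sq_eLpNorm_eq]
  exact pow_le_pow_left' hn 2

/-- On the truncation set, s n < 2 (s n - s₀), so n times its mass is at most 4 times the squared L²
norm of √n (s n - s₀) there. This splits into the vanishing remainder and D s₀ restricted to the
set. Since s₀ < s n - s₀ there as well, the set has vanishing P₀-mass, and absolute continuity of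
the integral disposes of D s₀. -/
lemma tendsto_measure_truncation (h : LocalDensities μ s s₀ g D) {P : ℕ → Measure X}
    {P₀ : Measure X} (hP : ∀ᶠ n in atTop, P n = μ.withDensity fun x => ENNReal.ofReal (s n x ^ 2))
    (hP₀ : P₀ = μ.withDensity fun x => ENNReal.ofReal (s₀ x ^ 2)) :
    Tendsto (fun n : ℕ => (n : ℝ≥0∞) * P n {x | 2 * s₀ x < s n x}) atTop (𝓝 0) := by
  set B : ℕ → Set X := fun n => {x | 2 * s₀ x < s n x}
  have hBm : ∀ n, MeasurableSet (B n) := fun n =>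
    measurableSet_lt (h.measurable_s₀.const_mul 2) (h.measurable_s n)
  obtain ⟨c, -, hc⟩ := h.exists_sq_eLpNorm_le
  have hlim : Tendsto (fun n : ℕ => ENNReal.ofReal (c / n)) atTop (𝓝 0) := by
    rw [← ENNReal.ofReal_zero]
    exact (ENNReal.continuous_ofReal.tendsto _).comp (tendsto_const_div_atTop_nhds_zero_nat c)
  have hP₀B : Tendsto (fun n => P₀ (B n)) atTop (𝓝 0) := by
    refine tendsto_zero_of_eventually_le hlim ?_
    filter_upwards [hc] with n hn
    refine le_trans ?_ hn
    rw [hP₀, withDensity_apply _ (hBm n), lintegral_enorm_sq_eq]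
    refine (setLIntegral_mono' (hBm n) fun x (hx : 2 * s₀ x < s n x) => ?_).trans
      (setLIntegral_le_lintegral (B n) _)
    refine ENNReal.ofReal_le_ofReal ?_
    have := h.nonneg₀ x
    nlinarith
  have hDB : Tendsto (fun n => eLpNorm ((B n).indicator fun x => D x * s₀ x) 2 μ ^ 2)
      atTop (𝓝 0) := by
    have hDm : Measurable fun x => ENNReal.ofReal (D x ^ 2) :=
      (h.measurable_D.pow_const 2).ennreal_ofReal
    have hd₀ : Measurable fun x => ENNReal.ofReal (s₀ x ^ 2) :=
      (h.measurable_s₀.pow_const 2).ennreal_ofReal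
    have e : ∀ t, MeasurableSet t → ∫⁻ x in t, ENNReal.ofReal (D x ^ 2) ∂P₀
        = eLpNorm (t.indicator fun x => D x * s₀ x) 2 μ ^ 2 := by
      intro t ht
      rw [eLpNorm_indicator_eq_eLpNorm_restrict ht, lintegral_enorm_sq_eq, hP₀,
        restrict_withDensity ht, lintegral_withDensity_eq_lintegral_mul _ hd₀ hDm]
      refine lintegral_congr fun x => ?_
      rw [Pi.mul_apply, ← ENNReal.ofReal_mul (sq_nonneg _), mul_pow, mul_comm]
    have hfin : ∫⁻ x, ENNReal.ofReal (D x ^ 2) ∂P₀ ≠ ∞ := by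
      have := e Set.univ MeasurableSet.univ
      rw [setLIntegral_univ, Set.indicator_univ] at this
      rw [this]
      exact ENNReal.pow_ne_top h.memLp_D.2.ne
    exact (tendsto_setLIntegral_zero hfin hP₀B).congr fun n => e _ (hBm n)
  have hDB' : Tendsto (fun n => eLpNorm ((B n).indicator fun x => D x * s₀ x) 2 μ)
      atTop (𝓝 0) := by
    have h2 := hDB.ennrpow_const (1 / 2 : ℝ)
    rw [ENNReal.zero_rpow_of_pos (by norm_num)] at h2
    refine h2.congr fun n => ?_
    rw [← ENNReal.rpow_natCast, ← ENNReal.rpow_mul]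
    norm_num
  have htot : Tendsto (fun n : ℕ => 4 * (eLpNorm (fun x => √(n : ℝ) * (s n x - s₀ x)
      - g n x * s₀ x) 2 μ + eLpNorm ((B n).indicator fun x => D x * s₀ x) 2 μ) ^ 2)
      atTop (𝓝 0) := by
    have h1 := ENNReal.Tendsto.pow (n := 2) (h.remainder.add hDB')
    have h2 := ENNReal.Tendsto.const_mul (a := 4) h1 (Or.inr (by simp))
    simpa using h2
  refine tendsto_zero_of_eventually_le htot ?_
  filter_upwards [hP] with n hPn
  have hmR : Measurable fun x => √(n : ℝ) * (s n x - s₀ x) - g n x * s₀ x :=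
    (((h.measurable_s n).sub h.measurable_s₀).const_mul _).sub
      ((h.measurable_g n).mul h.measurable_s₀)
  have step1 : P n (B n) ≤ 4 * eLpNorm ((B n).indicator fun x => s n x - s₀ x) 2 μ ^ 2 := by
    rw [hPn, withDensity_apply _ (hBm n), eLpNorm_indicator_eq_eLpNorm_restrict (hBm n),
      lintegral_enorm_sq_eq, ← lintegral_const_mul]
    · refine setLIntegral_mono' (hBm n) fun x (hx : 2 * s₀ x < s n x) => ?_
      have e4 : (4 : ℝ≥0∞) = ENNReal.ofReal 4 := by simp
      rw [e4, ← ENNReal.ofReal_mul (by norm_num)]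
      refine ENNReal.ofReal_le_ofReal ?_
      have := h.nonneg₀ x
      nlinarith
    · exact (((h.measurable_s n).sub h.measurable_s₀).pow_const 2).ennreal_ofReal
  refine (mul_le_mul_right step1 _).trans ?_
  rw [mul_left_comm, mul_sq_eLpNorm_eq]
  gcongr
  have e : (fun x => √(n : ℝ) * (B n).indicator (fun x => s n x - s₀ x) x)
      = (B n).indicator (fun x => √(n : ℝ) * (s n x - s₀ x) - g n x * s₀ x)
        + (B n).indicator fun x => g n x * s₀ x := by
    ext x
    by_cases hx : x ∈ B n <;> simp [hx]
  rw [e]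
  refine (eLpNorm_add_le (hmR.indicator (hBm n)).aestronglyMeasurable
    (((h.measurable_g n).mul h.measurable_s₀).indicator (hBm n)).aestronglyMeasurable
    one_le_two).trans (add_le_add (eLpNorm_indicator_le _) (eLpNorm_mono fun x => ?_))
  rw [norm_indicator_eq_indicator_norm, norm_indicator_eq_indicator_norm]
  refine Set.indicator_le_indicator ?_
  rw [Pi.mul_apply, norm_mul, norm_mul]
  gcongr
  exact (h.abs_g_le n x).trans (le_abs_self _)

/-- Contiguity of the local alternatives. -/
lemma contiguous (h : LocalDensities μ s s₀ g D) {P : ℕ → Measure X} {P₀ : Measure X}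
    [∀ n, IsProbabilityMeasure (P n)] [IsProbabilityMeasure P₀]
    (hP : ∀ᶠ n in atTop, P n = μ.withDensity fun x => ENNReal.ofReal (s n x ^ 2))
    (hP₀ : P₀ = μ.withDensity fun x => ENNReal.ofReal (s₀ x ^ 2)) {k : ℕ → ℕ} {K : ℕ}
    (hk : ∀ n, k n ≤ K * (n + 1)) {A : ∀ n, Set (Sample X n (k n))}
    (hA : Tendsto (fun n => sampleLaw P₀ n (k n) (A n)) atTop (𝓝 0)) :
    Tendsto (fun n => sampleLaw (P n) n (k n) (A n)) atTop (𝓝 0) := by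
  obtain ⟨c, hc0, hc⟩ := h.exists_sq_eLpNorm_le
  -- For n > 0, n + 1 ≤ 2n.
  have hcard : ∀ n : ℕ, 0 < n → n + k n ≤ (2 * K + 1) * n := by
    intro n hn
    have := hk n
    nlinarith
  have hlim : Tendsto (fun n : ℕ => ((2 * K + 1 : ℕ) : ℝ≥0∞) * ((n : ℝ≥0∞) *
      P n {x | 2 * s₀ x < s n x}) + sampleLaw P₀ n (k n) (A n) ^ (1 / 2 : ℝ)
        * (ENNReal.ofReal (Real.exp (9 * c * (2 * K + 1)))) ^ (1 / 2 : ℝ)) atTop (𝓝 0) := by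
    have h1 := ENNReal.Tendsto.const_mul (a := ((2 * K + 1 : ℕ) : ℝ≥0∞))
      (h.tendsto_measure_truncation hP hP₀) (Or.inr (ENNReal.natCast_ne_top _))
    have h2 := hA.ennrpow_const (1 / 2 : ℝ)
    rw [ENNReal.zero_rpow_of_pos (by norm_num)] at h2
    have h3 := ENNReal.Tendsto.mul_const
      (b := (ENNReal.ofReal (Real.exp (9 * c * (2 * K + 1)))) ^ (1 / 2 : ℝ)) h2
      (Or.inr (by finiteness))
    simpa using h1.add h3
  refine tendsto_zero_of_eventually_le hlim ?_
  filter_upwards [hP, hc, eventually_gt_atTop 0] with n hPn hn hpos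
  rw [sampleLaw_eq_pi, sampleLaw_eq_pi]
  refine (pi_withDensity_le (h.measurable_s n) h.measurable_s₀ (h.nonneg n) h.nonneg₀ hPn hP₀
    _).trans ?_
  have hpos' : (0 : ℝ) < n := by exact_mod_cast hpos
  rw [Fintype.card_sum, Fintype.card_fin, Fintype.card_fin]
  refine add_le_add ?_ ?_
  · rw [← mul_assoc]
    gcongr
    exact_mod_cast hcard n hpos
  · gcongr
    -- Squared root distances are O(1 / n) and there are O(n) factors, so 1 + x ≤ exp x keeps the
    -- product bounded.
    calc (1 + 9 * eLpNorm (fun x => s n x - s₀ x) 2 μ ^ 2) ^ (n + k n)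
        ≤ (ENNReal.ofReal (1 + 9 * (c / n))) ^ (n + k n) := by
          have e9 : (9 : ℝ≥0∞) = ENNReal.ofReal 9 := by simp
          rw [ENNReal.ofReal_add one_pos.le (by positivity), ENNReal.ofReal_mul (by norm_num), ← e9,
            ENNReal.ofReal_one]
          gcongr
      _ ≤ ENNReal.ofReal (Real.exp (9 * (c / n))) ^ (n + k n) := by
          gcongr
          rw [add_comm]
          exact Real.add_one_le_exp _
      _ ≤ _ := by
          rw [← ENNReal.ofReal_pow (Real.exp_pos _).le, ← Real.exp_nat_mul]
          refine ENNReal.ofReal_le_ofReal (Real.exp_le_exp.2 ?_)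
          have h1 : ((n + k n : ℕ) : ℝ) ≤ (2 * K + 1) * n := by exact_mod_cast hcard n hpos
          calc ((n + k n : ℕ) : ℝ) * (9 * (c / n)) ≤ (2 * K + 1) * n * (9 * (c / n)) := by gcongr
            _ = _ := by field_simp

end LocalDensities

end Contiguity

/-! ### Local sequences in regular submodels -/

section Submodel

universe uA uZ uC uΩ

variable {𝒜 : Type uA} {𝒵 : Type uZ} {𝒞 : Type uC}
  [MeasurableSpace 𝒜] [MeasurableSpace 𝒵] [MeasurableSpace 𝒞]

/-- The remainder of the expansion of the root density at the origin. -/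
noncomputable def rootRemainder {X : Type*} {d : ℕ} (p : EuclideanSpace ℝ (Fin d) → X → ℝ)
    (S : X → EuclideanSpace ℝ (Fin d)) (α : EuclideanSpace ℝ (Fin d)) (x : X) : ℝ :=
  √(p α x) - √(p 0 x) - 1 / 2 * inner ℝ α (S x) * √(p 0 x)

/-- Quadratic-mean differentiability already forces a square integrable score. In each coordinate
direction, for one small t, the linear term is a difference of root densities minus a remainder, all
in L²; dividing by t isolates the coordinate. -/
lemma memLp_score {X : Type*} [MeasurableSpace X] {d : ℕ} {μ : Measure X}
    {p : EuclideanSpace ℝ (Fin d) → X → ℝ} {S : X → EuclideanSpace ℝ (Fin d)}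
    (hS : Measurable S) (hp : ∀ α, Measurable (p α))
    (hL2 : ∀ᶠ α in 𝓝 0, MemLp (fun x => √(p α x)) 2 μ)
    (hrem : ∀ᶠ α in 𝓝[≠] 0, eLpNorm (rootRemainder p S α) 2 μ ^ 2 < ∞) :
    MemLp (fun x => ‖S x‖ * √(p 0 x)) 2 μ := by
  have hvec : MemLp (fun x => √(p 0 x) • S x) 2 μ := by
    refine MemLp.of_eval_piLp fun i => ?_
    have hcurve : Tendsto (fun t : ℝ => t • EuclideanSpace.single i (1 : ℝ)) (𝓝[≠] 0) (𝓝[≠] 0) := by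
      refine tendsto_nhdsWithin_iff.2 ⟨?_, ?_⟩
      · have : Continuous fun t : ℝ => t • EuclideanSpace.single i (1 : ℝ) := by fun_prop
        simpa using (this.tendsto 0).mono_left nhdsWithin_le_nhds
      · filter_upwards [self_mem_nhdsWithin] with t ht
        simpa using ht
    obtain ⟨t, ht0, ht, ht2⟩ := ((eventually_mem_nhdsWithin (a := (0 : ℝ)) (s := {0}ᶜ)).and
      ((hcurve.eventually hrem).and
        (hcurve.eventually (hL2.filter_mono nhdsWithin_le_nhds)))).exists
    set α := t • EuclideanSpace.single i (1 : ℝ) with hα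
    have hrm : Measurable (rootRemainder p S α) :=
      ((hp α).sqrt.sub (hp 0).sqrt).sub
        (((measurable_const.inner hS).const_mul _).mul (hp 0).sqrt)
    have hr : MemLp (rootRemainder p S α) 2 μ := by
      refine ⟨hrm.aestronglyMeasurable, ?_⟩
      exact (ENNReal.pow_lt_top_iff.1 ht).resolve_right two_ne_zero
    refine (((ht2.sub hL2.self_of_nhds).sub hr).const_mul (2 / t)).congr_norm ?_ ?_
    · exact ((hp 0).sqrt.mul ((EuclideanSpace.proj i).measurable.comp hS)).aestronglyMeasurable
    · refine ae_of_all _ fun x => ?_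
      congr 1
      have hi : inner ℝ α (S x) = t * S x i := by
        rw [hα, real_inner_smul_left, EuclideanSpace.inner_single_left]
        simp
      have ht0' : t ≠ 0 := ht0
      simp only [Pi.sub_apply, rootRemainder, hi, PiLp.smul_apply, smul_eq_mul]
      field_simp
      ring
  refine hvec.norm.congr_norm ?_ (ae_of_all _ fun x => ?_)
  · exact (hS.norm.mul (hp 0).sqrt).aestronglyMeasurable
  · simp [norm_smul, mul_comm]

variable [Countable 𝒜] [Countable 𝒵] [Countable 𝒞]
  [MeasurableSingletonClass 𝒜] [MeasurableSingletonClass 𝒵] [MeasurableSingletonClass 𝒞]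

/-- Along local sequences, regular submodels have root densities with the increments required by
`LocalDensities`. -/
lemma IsRegularSubmodel.exists_localDensities {M : CausalModel.{uA, uZ, uC, uΩ} 𝒜 𝒵 𝒞} {d : ℕ}
    {F : EuclideanSpace ℝ (Fin d) → CausalModel.{uA, uZ, uC, uΩ} 𝒜 𝒵 𝒞}
    (hF : IsRegularSubmodel M F) {α : ℕ → EuclideanSpace ℝ (Fin d)} {B : ℝ}
    (hB : ∀ n : ℕ, √(n : ℝ) * ‖α n‖ ≤ B) (hα : Tendsto α atTop (𝓝 0)) :
    ∃ (μ : Measure (Obs 𝒜 𝒵 𝒞)) (s : ℕ → Obs 𝒜 𝒵 𝒞 → ℝ) (s₀ : Obs 𝒜 𝒵 𝒞 → ℝ)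
      (g : ℕ → Obs 𝒜 𝒵 𝒞 → ℝ) (D : Obs 𝒜 𝒵 𝒞 → ℝ), LocalDensities μ s s₀ g D ∧
      (∀ᶠ n in atTop, (F (α n)).obsLaw = μ.withDensity fun x => ENNReal.ofReal (s n x ^ 2)) ∧
      M.obsLaw = μ.withDensity fun x => ENNReal.ofReal (s₀ x ^ 2) := by
  obtain ⟨μ, p, S, -, hS, hp, hp0, hlaw, hqmd⟩ := hF.qmd
  have hB0 : 0 ≤ B := by simpa using hB 0
  have hsq : ∀ α x, √(p α x) ^ 2 = p α x := fun α x => Real.sq_sqrt (hp0 α x)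
  have hnorm : ∀ᶠ α in 𝓝 0, ∫⁻ x, ENNReal.ofReal (√(p α x) ^ 2) ∂μ = 1 := by
    filter_upwards [hlaw] with α hα
    have : (F α).obsLaw Set.univ = 1 := measure_univ
    simp_rw [hsq]
    rwa [hα, withDensity_apply _ MeasurableSet.univ, setLIntegral_univ] at this
  have hrem : ∀ α, ∫⁻ x, ENNReal.ofReal
      ((√(p α x) - √(p 0 x) - 1 / 2 * inner ℝ α (S x) * √(p 0 x)) ^ 2) ∂μ
      = eLpNorm (rootRemainder p S α) 2 μ ^ 2 := fun α => (lintegral_enorm_sq_eq _).symm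
  simp_rw [hrem] at hqmd
  refine ⟨μ, fun n x => √(p (α n) x), fun x => √(p 0 x),
    fun n x => 1 / 2 * inner ℝ (√(n : ℝ) • α n) (S x), fun x => B / 2 * ‖S x‖, ?_, ?_, ?_⟩
  · refine ⟨fun n => (hp _).sqrt, (hp 0).sqrt, fun n => (measurable_const.inner hS).const_mul _,
      hS.norm.const_mul _, fun n x => Real.sqrt_nonneg _, fun x => Real.sqrt_nonneg _,
      ?_, ?_, ?_⟩
    · intro n x
      rw [abs_mul, abs_of_pos (by norm_num)]
      calc 1 / 2 * |inner ℝ (√(n : ℝ) • α n) (S x)|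
          ≤ 1 / 2 * (‖√(n : ℝ) • α n‖ * ‖S x‖) := by gcongr; exact abs_real_inner_le_norm _ _
        _ ≤ 1 / 2 * (B * ‖S x‖) := by
            gcongr
            rw [norm_smul, Real.norm_of_nonneg (Real.sqrt_nonneg _)]
            exact hB n
        _ = _ := by ring
    · have hL2 : ∀ᶠ α in 𝓝 0, MemLp (fun x => √(p α x)) 2 μ := by
        filter_upwards [hnorm] with α hα
        exact ⟨(hp α).sqrt.aestronglyMeasurable, by rw [eLpNorm_eq_one hα]; simp⟩
      have hfin : ∀ᶠ α in 𝓝[≠] 0, eLpNorm (rootRemainder p S α) 2 μ ^ 2 < ∞ := by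
        filter_upwards [hqmd.eventually (gt_mem_nhds one_pos)] with α hα
        by_contra hcon
        rw [not_lt_top_iff.1 hcon, ENNReal.top_div_of_ne_top ENNReal.ofReal_ne_top] at hα
        exact absurd hα (by simp)
      refine ((memLp_score hS hp hL2 hfin).const_mul (B / 2)).congr_norm ?_ ?_
      · exact ((hS.norm.const_mul _).mul (hp 0).sqrt).aestronglyMeasurable
      · exact ae_of_all _ fun x => by rw [mul_assoc]
    -- The hypothesis concerns α ≠ 0, but a local sequence may hit 0. There the remainder is zero,
    -- so the quotient is set to 0 and the limit holds on a full neighbourhood.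
    · set ρ : EuclideanSpace ℝ (Fin d) → ℝ≥0∞ := fun α =>
        if α = 0 then 0 else eLpNorm (rootRemainder p S α) 2 μ ^ 2 / ENNReal.ofReal (‖α‖ ^ 2)
      have hρ : Tendsto ρ (𝓝 0) (𝓝 0) := by
        rw [← nhdsNE_sup_pure, tendsto_sup]
        refine ⟨hqmd.congr' ?_, ?_⟩
        · filter_upwards [self_mem_nhdsWithin] with α hα
          exact (if_neg hα).symm
        · rw [tendsto_pure_left]
          intro s hs
          simpa [ρ] using mem_of_mem_nhds hs
      have hbound : ∀ n : ℕ, eLpNorm (fun x => √(n : ℝ) * (√(p (α n) x) - √(p 0 x))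
          - 1 / 2 * inner ℝ (√(n : ℝ) • α n) (S x) * √(p 0 x)) 2 μ ^ 2
          ≤ ENNReal.ofReal (B ^ 2) * ρ (α n) := by
        intro n
        have e : (fun x => √(n : ℝ) * (√(p (α n) x) - √(p 0 x))
            - 1 / 2 * inner ℝ (√(n : ℝ) • α n) (S x) * √(p 0 x))
            = fun x => √(n : ℝ) * rootRemainder p S (α n) x := by
          ext x
          rw [rootRemainder, real_inner_smul_left]
          ring
        rw [e, ← LocalDensities.mul_sq_eLpNorm_eq]
        by_cases h0 : α n = 0
        · have : rootRemainder p S (α n) = fun _ => 0 := by ext x; simp [rootRemainder, h0]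
          simp [this]
        · have hpos : 0 < ‖α n‖ := norm_pos_iff.2 h0
          simp only [ρ, if_neg h0]
          set I := eLpNorm (rootRemainder p S (α n)) 2 μ ^ 2
          have hI : I = ENNReal.ofReal (‖α n‖ ^ 2) * (I / ENNReal.ofReal (‖α n‖ ^ 2)) := by
            rw [ENNReal.mul_div_cancel (by positivity) ENNReal.ofReal_ne_top]
          conv_lhs => rw [hI]
          rw [← mul_assoc]
          gcongr
          rw [← ENNReal.ofReal_natCast, ← ENNReal.ofReal_mul (Nat.cast_nonneg n)]
          refine ENNReal.ofReal_le_ofReal ?_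
          calc (n : ℝ) * ‖α n‖ ^ 2 = (√(n : ℝ) * ‖α n‖) ^ 2 := by
                rw [mul_pow, Real.sq_sqrt (Nat.cast_nonneg n)]
            _ ≤ B ^ 2 := pow_le_pow_left₀ (by positivity) (hB n) 2
      have h1 : Tendsto (fun n => ENNReal.ofReal (B ^ 2) * ρ (α n)) atTop (𝓝 0) := by
        simpa using ENNReal.Tendsto.const_mul (a := ENNReal.ofReal (B ^ 2)) (hρ.comp hα)
          (Or.inr ENNReal.ofReal_ne_top)
      have h2 := (tendsto_zero_of_eventually_le h1
        (Eventually.of_forall hbound)).ennrpow_const (1 / 2 : ℝ)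
      rw [ENNReal.zero_rpow_of_pos (by norm_num)] at h2
      refine h2.congr fun n => ?_
      rw [← ENNReal.rpow_natCast, ← ENNReal.rpow_mul]
      norm_num
  · simp_rw [hsq]
    exact hα.eventually hlaw
  · simp_rw [hsq]
    rw [← hF.through]
    exact hlaw.self_of_nhds

end Submodel

/-! ### Integrals along local alternatives -/

section LocalAlternatives

variable {X : Type*} [MeasurableSpace X]

/-- Laws `P n` such that the integrals with respect to `P n - P₀` of functions of at most the growth
of `V` are of order `1 / √n`, and of smaller order for functions that tend to zero. -/
structure LocalAlternatives (P₀ : Measure X) (P : ℕ → Measure X) (V : X → ℝ) : Prop where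
  isProb₀ : IsProbabilityMeasure P₀
  isProb : ∀ n, IsProbabilityMeasure (P n)
  one_le : ∀ x, 1 ≤ V x
  memLp : MemLp V 2 P₀
  integrable : ∀ᶠ n in atTop, Integrable V (P n)
  bounded : ∀ (f : X → ℝ), Measurable f → (∃ K, ∀ x, |f x| ≤ K * V x) →
    ∃ B : ℝ, ∀ᶠ n : ℕ in atTop, |√(n : ℝ) * (∫ x, f x ∂P n - ∫ x, f x ∂P₀)| ≤ B
  tendsto : ∀ (u : ℕ → X → ℂ), (∀ n, Measurable (u n)) →
    (∃ K, ∀ᶠ n in atTop, ∀ x, ‖u n x‖ ≤ K * V x) →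
    (∀ᵐ x ∂P₀, Tendsto (fun n => u n x) atTop (𝓝 0)) →
    Tendsto (fun n : ℕ => (√(n : ℝ) : ℂ) * (∫ x, u n x ∂P n - ∫ x, u n x ∂P₀)) atTop (𝓝 0)

lemma integrable_of_norm_le_mul {E : Type*} [NormedAddCommGroup E] {P : Measure X} {V : X → ℝ}
    (hV : Integrable V P) {f : X → E} (hf : AEStronglyMeasurable f P) {K : ℝ}
    (hK : ∀ x, ‖f x‖ ≤ K * V x) : Integrable f P :=
  (hV.const_mul K).mono' hf (ae_of_all _ hK)

lemma eLpNorm_withDensity_sq {μ : Measure X} {s V : X → ℝ} (hs : Measurable s) (hV : Measurable V) :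
    eLpNorm V 2 (μ.withDensity fun x => ENNReal.ofReal (s x ^ 2))
      = eLpNorm (fun x => V x * s x) 2 μ := by
  have hd : Measurable fun x => ENNReal.ofReal (s x ^ 2) := (hs.pow_const 2).ennreal_ofReal
  have hVm : Measurable fun x => ENNReal.ofReal (V x ^ 2) := (hV.pow_const 2).ennreal_ofReal
  have h : eLpNorm V 2 (μ.withDensity fun x => ENNReal.ofReal (s x ^ 2)) ^ 2
      = eLpNorm (fun x => V x * s x) 2 μ ^ 2 := by
    rw [lintegral_enorm_sq_eq, lintegral_enorm_sq_eq, lintegral_withDensity_eq_lintegral_mul _ hd hVm]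
    refine lintegral_congr fun x => ?_
    rw [Pi.mul_apply, ← ENNReal.ofReal_mul (sq_nonneg _), mul_pow, mul_comm]
  exact (ENNReal.pow_right_strictMono two_ne_zero).injective h

lemma integral_withDensity_sq {E : Type*} [NormedAddCommGroup E] [NormedSpace ℝ E] {μ : Measure X}
    {s : X → ℝ} (hs : Measurable s) (f : X → E) :
    ∫ x, f x ∂(μ.withDensity fun x => ENNReal.ofReal (s x ^ 2)) = ∫ x, s x ^ 2 • f x ∂μ := by
  rw [integral_withDensity_eq_integral_toReal_smul (hs.pow_const 2).ennreal_ofReal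
    (ae_of_all _ fun _ => ENNReal.ofReal_lt_top)]
  simp_rw [ENNReal.toReal_ofReal (sq_nonneg _)]

lemma integrable_withDensity_sq {E : Type*} [NormedAddCommGroup E] [NormedSpace ℝ E]
    {μ : Measure X} {s : X → ℝ} (hs : Measurable s) {f : X → E} :
    Integrable f (μ.withDensity fun x => ENNReal.ofReal (s x ^ 2))
      ↔ Integrable (fun x => s x ^ 2 • f x) μ := by
  rw [integrable_withDensity_iff_integrable_smul' (hs.pow_const 2).ennreal_ofReal
    (ae_of_all _ fun _ => ENNReal.ofReal_lt_top)]
  simp_rw [ENNReal.toReal_ofReal (sq_nonneg _)]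

lemma enorm_integral_sub_le {E : Type*} [NormedAddCommGroup E] [NormedSpace ℝ E] {μ : Measure X}
    {s s₀ : X → ℝ} (hs : Measurable s) (hs₀ : Measurable s₀) {P P₀ : Measure X}
    (hP : P = μ.withDensity fun x => ENNReal.ofReal (s x ^ 2))
    (hP₀ : P₀ = μ.withDensity fun x => ENNReal.ofReal (s₀ x ^ 2)) {f : X → E}
    (hf : Integrable f P) (hf₀ : Integrable f P₀) (r : ℝ) :
    ‖r • (∫ x, f x ∂P - ∫ x, f x ∂P₀)‖ₑ
      ≤ ∫⁻ x, ‖‖f x‖‖ₑ * ‖r * (s x ^ 2 - s₀ x ^ 2)‖ₑ ∂μ := by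
  rw [hP, integrable_withDensity_sq hs] at hf
  rw [hP₀, integrable_withDensity_sq hs₀] at hf₀
  rw [hP, hP₀, integral_withDensity_sq hs, integral_withDensity_sq hs₀, ← integral_sub hf hf₀,
    ← integral_smul]
  refine (enorm_integral_le_lintegral_enorm _).trans (lintegral_mono fun x => ?_)
  rw [← sub_smul, smul_smul, enorm_smul, enorm_norm, mul_comm]

/-- Passage from densities to laws: integrals against P n - P₀ are integrals against s n ^ 2 - s₀ ^
2, and the uniform L² bound on V is what the two increment lemmas require. -/
lemma LocalDensities.localAlternatives {μ : Measure X} {s : ℕ → X → ℝ} {s₀ : X → ℝ}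
    {g : ℕ → X → ℝ} {D : X → ℝ} (h : LocalDensities μ s s₀ g D) {P : ℕ → Measure X}
    {P₀ : Measure X} [∀ n, IsProbabilityMeasure (P n)] [IsProbabilityMeasure P₀]
    (hP : ∀ᶠ n in atTop, P n = μ.withDensity fun x => ENNReal.ofReal (s n x ^ 2))
    (hP₀ : P₀ = μ.withDensity fun x => ENNReal.ofReal (s₀ x ^ 2)) {V : X → ℝ} (hV : Measurable V)
    (hV1 : ∀ x, 1 ≤ V x) {C : ℝ≥0∞} (hC : C ≠ ∞) (hV₀ : eLpNorm V 2 P₀ ≤ C)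
    (hVn : ∀ᶠ n in atTop, eLpNorm V 2 (P n) ≤ C) : LocalAlternatives P₀ P V := by
  have hmem₀ : MemLp V 2 P₀ := ⟨hV.aestronglyMeasurable, hV₀.trans_lt hC.lt_top⟩
  have hint₀ : Integrable V P₀ := hmem₀.integrable one_le_two
  have hint : ∀ᶠ n in atTop, Integrable V (P n) := by
    filter_upwards [hVn] with n hn
    exact MemLp.integrable one_le_two ⟨hV.aestronglyMeasurable, hn.trans_lt hC.lt_top⟩
  have hV0 : ∀ x, 0 < V x := fun x => one_pos.trans_le (hV1 x)
  have hV₀' : eLpNorm (fun x => V x * s₀ x) 2 μ ≤ C := by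
    rwa [← eLpNorm_withDensity_sq h.measurable_s₀ hV, ← hP₀]
  have hVn' : ∀ᶠ n in atTop, eLpNorm (fun x => V x * s n x) 2 μ ≤ C := by
    filter_upwards [hVn, hP] with n hn hPn
    rwa [← eLpNorm_withDensity_sq (h.measurable_s n) hV, ← hPn]
  refine ⟨inferInstance, inferInstance, hV1, hmem₀, hint, ?_, ?_⟩
  · rintro f hf ⟨K, hK⟩
    obtain ⟨B, hB, hbd⟩ := h.lintegral_increment_bounded hV hC hV₀' hVn'
    refine ⟨(ENNReal.ofReal |K| * B).toReal, ?_⟩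
    filter_upwards [hbd, hP, hint] with n hn hPn hin
    have h1 := enorm_integral_sub_le (h.measurable_s n) h.measurable_s₀ hPn hP₀
      (integrable_of_norm_le_mul hin hf.aestronglyMeasurable hK)
      (integrable_of_norm_le_mul hint₀ hf.aestronglyMeasurable hK) √(n : ℝ)
    rw [← Real.norm_eq_abs, ← toReal_enorm]
    refine ENNReal.toReal_mono (ENNReal.mul_ne_top ENNReal.ofReal_ne_top hB) (h1.trans ?_)
    refine le_trans ?_ (mul_le_mul_right hn _)
    rw [← lintegral_const_mul' _ _ ENNReal.ofReal_ne_top]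
    refine lintegral_mono fun x => ?_
    rw [← mul_assoc]
    gcongr
    rw [← ofReal_norm, ← ofReal_norm, ← ENNReal.ofReal_mul (abs_nonneg _), norm_norm,
      Real.norm_of_nonneg (hV0 x).le]
    refine ENNReal.ofReal_le_ofReal ((hK x).trans ?_)
    exact mul_le_mul_of_nonneg_right (le_abs_self _) (hV0 x).le
  · rintro u hu ⟨K, hK⟩ hlim
    -- A strictly positive constant, so that dividing by it brings u under the envelope V itself.
    set K' := |K| + 1
    have hK'0 : 0 < K' := by positivity
    have hlimμ : ∀ᵐ x ∂μ, s₀ x ≠ 0 → Tendsto (fun n => ‖u n x‖ / K') atTop (𝓝 0) := by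
      rw [hP₀, ae_withDensity_iff (h.measurable_s₀.pow_const 2).ennreal_ofReal] at hlim
      filter_upwards [hlim] with x hx hs
      have h2 := (hx (by simpa using hs)).norm.div_const K'
      simpa using h2
    have h1 := h.tendsto_lintegral_increment hV hV1 hC hV₀' hVn'
      (u := fun n x => ‖u n x‖ / K') (fun n => (hu n).norm.div_const _) ?_ hlimμ
    · rw [tendsto_zero_iff_enorm_tendsto_zero]
      have h2 := ENNReal.Tendsto.const_mul (a := ENNReal.ofReal K') h1
        (Or.inr ENNReal.ofReal_ne_top)
      rw [mul_zero] at h2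
      refine tendsto_zero_of_eventually_le h2 ?_
      filter_upwards [hK, hP, hint] with n hn hPn hin
      have h3 := enorm_integral_sub_le (h.measurable_s n) h.measurable_s₀ hPn hP₀
        (integrable_of_norm_le_mul hin (hu n).aestronglyMeasurable hn)
        (integrable_of_norm_le_mul hint₀ (hu n).aestronglyMeasurable hn) √(n : ℝ)
      rw [Complex.real_smul] at h3
      refine h3.trans ?_
      rw [← lintegral_const_mul' _ _ ENNReal.ofReal_ne_top]
      refine lintegral_mono fun x => ?_
      rw [← mul_assoc]
      gcongr
      rw [← ofReal_norm, ← ofReal_norm, ← ENNReal.ofReal_mul hK'0.le, norm_norm,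
        Real.norm_of_nonneg (by positivity), mul_div_cancel₀ _ hK'0.ne']
    · filter_upwards [hK] with n hn x
      rw [abs_of_nonneg (by positivity), div_le_iff₀ hK'0]
      have h1 : K * V x ≤ V x * K' := by
        have := le_abs_self K
        have := hV0 x
        simp only [K']
        nlinarith
      exact (hn x).trans h1

namespace LocalAlternatives

variable {P₀ : Measure X} {P : ℕ → Measure X} {V : X → ℝ}

lemma integrable₀ (h : LocalAlternatives P₀ P V) : Integrable V P₀ := by
  have := h.isProb₀
  exact h.memLp.integrable one_le_two

lemma tendsto_real (h : LocalAlternatives P₀ P V) {u : ℕ → X → ℝ} (hu : ∀ n, Measurable (u n))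
    (hK : ∃ K, ∀ᶠ n in atTop, ∀ x, |u n x| ≤ K * V x)
    (hlim : ∀ᵐ x ∂P₀, Tendsto (fun n => u n x) atTop (𝓝 0)) :
    Tendsto (fun n : ℕ => √(n : ℝ) * (∫ x, u n x ∂P n - ∫ x, u n x ∂P₀)) atTop (𝓝 0) := by
  have h1 := h.tendsto (fun n x => (u n x : ℂ)) (fun n => Complex.measurable_ofReal.comp (hu n))
    (by simpa using hK) (by
      filter_upwards [hlim] with x hx
      simpa [Function.comp_def] using (Complex.continuous_ofReal.tendsto 0).comp hx)
  have h2 := (Complex.continuous_re.tendsto 0).comp h1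
  refine h2.congr fun n => ?_
  rw [Function.comp_apply, integral_complex_ofReal, integral_complex_ofReal, ← Complex.ofReal_sub,
    ← Complex.ofReal_mul, Complex.ofReal_re]

lemma tendsto_integral (h : LocalAlternatives P₀ P V) {f : X → ℝ} (hf : Measurable f)
    (hK : ∃ K, ∀ x, |f x| ≤ K * V x) :
    Tendsto (fun n => ∫ x, f x ∂P n) atTop (𝓝 (∫ x, f x ∂P₀)) := by
  obtain ⟨B, hB⟩ := h.bounded f hf hK
  have hsqrt : Tendsto (fun n : ℕ => B * (√(n : ℝ))⁻¹) atTop (𝓝 0) := by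
    simpa using ((tendsto_inv_atTop_zero.comp Real.tendsto_sqrt_atTop).comp
      tendsto_natCast_atTop_atTop).const_mul B
  have h1 : Tendsto (fun n => ∫ x, f x ∂P n - ∫ x, f x ∂P₀) atTop (𝓝 0) := by
    refine squeeze_zero_norm' ?_ hsqrt
    filter_upwards [hB, eventually_gt_atTop 0] with n hn hpos
    have hpos' : 0 < √(n : ℝ) := Real.sqrt_pos.2 (by exact_mod_cast hpos)
    rw [← div_eq_mul_inv, le_div_iff₀ hpos', Real.norm_eq_abs, mul_comm, ← abs_of_pos hpos',
      ← abs_mul]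
    exact hn
  simpa using h1.add_const (∫ x, f x ∂P₀)

lemma tendsto_measureReal (h : LocalAlternatives P₀ P V) {E : Set X} (hE : MeasurableSet E) :
    Tendsto (fun n => (P n).real E) atTop (𝓝 (P₀.real E)) := by
  have h1 := h.tendsto_integral (f := E.indicator 1) (measurable_one.indicator hE) ⟨1, fun x => by
    have := h.one_le x
    by_cases hx : x ∈ E <;> simp [hx] <;> linarith⟩
  simpa only [integral_indicator_one hE] using h1

end LocalAlternatives

end LocalAlternatives

/-! ### The central limit theorem along local alternatives -/

section CharFun

lemma norm_cexp_sub_one_le (y : ℝ) : ‖Complex.exp (y * Complex.I) - 1‖ ≤ |y| := by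
  rw [mul_comm]
  exact Real.norm_exp_I_mul_ofReal_sub_one_le

/-- The bound has to hold for all y, since it supplies a dominating function; beyond |y| = 1 the
triangle inequality is enough. -/
lemma norm_cexp_sub_one_sub_le (y : ℝ) :
    ‖Complex.exp (y * Complex.I) - 1 - y * Complex.I‖ ≤ 3 * y ^ 2 := by
  have hn : ‖(y : ℂ) * Complex.I‖ = |y| := by simp
  rw [← sq_abs y]
  rcases le_or_gt |y| 1 with h | h
  · refine (Complex.norm_exp_sub_one_sub_id_le (by rwa [hn])).trans ?_
    rw [hn]
    nlinarith [sq_nonneg |y|]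
  · refine (norm_sub_le _ _).trans ?_
    rw [hn]
    nlinarith [norm_cexp_sub_one_le y]

lemma norm_cexp_sub_taylor_le {y : ℝ} (hy : |y| ≤ 1) :
    ‖Complex.exp (y * Complex.I) - 1 - y * Complex.I + y ^ 2 / 2‖ ≤ 3 * |y| ^ 3 := by
  have h := Complex.norm_exp_sub_sum_le_norm_mul_exp ((y : ℂ) * Complex.I) 3
  have hn : ‖(y : ℂ) * Complex.I‖ = |y| := by simp
  rw [hn] at h
  have e : Complex.exp (y * Complex.I) - ∑ m ∈ Finset.range 3, (y * Complex.I) ^ m / m.factorial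
      = Complex.exp (y * Complex.I) - 1 - y * Complex.I + y ^ 2 / 2 := by
    simp only [Finset.sum_range_succ, Finset.sum_range_zero, mul_pow, Complex.I_sq]
    norm_num
    ring
  rw [e] at h
  refine h.trans ?_
  rw [mul_comm]
  gcongr
  refine (Real.exp_le_exp.2 hy).trans ?_
  linarith [Real.exp_one_lt_d9]

lemma tendsto_div_sqrt_nat {x : ℕ → ℝ} {x₀ : ℝ} (hx : Tendsto x atTop (𝓝 x₀)) :
    Tendsto (fun n : ℕ => x n / √(n : ℝ)) atTop (𝓝 0) := by
  have h1 : Tendsto (fun n : ℕ => (√(n : ℝ))⁻¹) atTop (𝓝 0) :=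
    (tendsto_inv_atTop_zero.comp Real.tendsto_sqrt_atTop).comp tendsto_natCast_atTop_atTop
  simpa [div_eq_mul_inv] using hx.mul h1

/-- The factor n is kept as √n · √n: one root belongs to the integrand `U` of
`tendsto_charFun_increment`, the other to the increment of the laws. -/
lemma tendsto_sqrt_mul_cexp {x : ℕ → ℝ} {x₀ : ℝ} (hx : Tendsto x atTop (𝓝 x₀)) :
    Tendsto (fun n : ℕ => (√(n : ℝ) : ℂ) * (√(n : ℝ) *
      (Complex.exp ((x n / √(n : ℝ) : ℝ) * Complex.I) - 1 - (x n / √(n : ℝ) : ℝ) * Complex.I)))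
      atTop (𝓝 (-(x₀ ^ 2 / 2 : ℝ))) := by
  have hy := tendsto_div_sqrt_nat hx
  have hmain : Tendsto (fun n => ((-(x n ^ 2 / 2) : ℝ) : ℂ)) atTop (𝓝 (-(x₀ ^ 2 / 2) : ℝ)) :=
    (Complex.continuous_ofReal.tendsto _).comp ((hx.pow 2).div_const 2).neg
  have hrem : Tendsto (fun n : ℕ => 3 * (|x n| ^ 3 / √(n : ℝ))) atTop (𝓝 0) := by
    simpa using (tendsto_div_sqrt_nat (hx.abs.pow 3)).const_mul 3
  have hdiff : Tendsto (fun n : ℕ => (√(n : ℝ) : ℂ) * (√(n : ℝ) *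
      (Complex.exp ((x n / √(n : ℝ) : ℝ) * Complex.I) - 1 - (x n / √(n : ℝ) : ℝ) * Complex.I))
      - ((-(x n ^ 2 / 2) : ℝ) : ℂ)) atTop (𝓝 0) := by
    refine squeeze_zero_norm' ?_ hrem
    have hy1 : ∀ᶠ n : ℕ in atTop, |x n / √(n : ℝ)| ≤ 1 :=
      hy.abs.eventually (ge_mem_nhds (by simp))
    filter_upwards [hy1, eventually_gt_atTop 0] with n hn hpos
    have hs : 0 < √(n : ℝ) := Real.sqrt_pos.2 (by exact_mod_cast hpos)
    have hsc : (√(n : ℝ) : ℂ) ≠ 0 := by exact_mod_cast hs.ne'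
    have e : (√(n : ℝ) : ℂ) * (√(n : ℝ) * (Complex.exp ((x n / √(n : ℝ) : ℝ) * Complex.I) - 1
        - (x n / √(n : ℝ) : ℝ) * Complex.I)) - ((-(x n ^ 2 / 2) : ℝ) : ℂ)
        = (√(n : ℝ) : ℂ) * (√(n : ℝ) * (Complex.exp ((x n / √(n : ℝ) : ℝ) * Complex.I) - 1
          - (x n / √(n : ℝ) : ℝ) * Complex.I + (x n / √(n : ℝ) : ℝ) ^ 2 / 2)) := by
      push_cast
      field_simp
      ring
    rw [e, norm_mul, norm_mul, Complex.norm_real, Real.norm_of_nonneg hs.le]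
    refine (mul_le_mul_of_nonneg_left (mul_le_mul_of_nonneg_left (norm_cexp_sub_taylor_le hn) hs.le)
      hs.le).trans (le_of_eq ?_)
    rw [abs_div, abs_of_pos hs]
    field_simp
  have := hdiff.add hmain
  simpa using this

lemma tendsto_sqrt_mul_cexp_zero {x : ℕ → ℝ} {x₀ : ℝ} (hx : Tendsto x atTop (𝓝 x₀)) :
    Tendsto (fun n : ℕ => (√(n : ℝ) : ℂ) *
      (Complex.exp ((x n / √(n : ℝ) : ℝ) * Complex.I) - 1 - (x n / √(n : ℝ) : ℝ) * Complex.I))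
      atTop (𝓝 0) := by
  have hrem : Tendsto (fun n : ℕ => 3 * (x n ^ 2 / √(n : ℝ))) atTop (𝓝 0) := by
    simpa using (tendsto_div_sqrt_nat (hx.pow 2)).const_mul 3
  refine squeeze_zero_norm' ?_ hrem
  filter_upwards [eventually_gt_atTop 0] with n hpos
  have hs : 0 < √(n : ℝ) := Real.sqrt_pos.2 (by exact_mod_cast hpos)
  rw [norm_mul, Complex.norm_real, Real.norm_of_nonneg hs.le]
  refine (mul_le_mul_of_nonneg_left (norm_cexp_sub_one_sub_le _) hs.le).trans (le_of_eq ?_)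
  field_simp

variable {X : Type*} [MeasurableSpace X]

namespace LocalAlternatives

variable {P₀ : Measure X} {P : ℕ → Measure X} {V : X → ℝ}

/-- The laws change with n, yet no Lindeberg condition is needed. The second-order part of the
exponential, scaled by √n, tends to 0 pointwise under an envelope of order V, so P n may be replaced
by P₀ at cost o(1 / √n). Under the fixed law, dominated convergence with majorant of order φ² + 1
gives the limit. -/
lemma tendsto_charFun_increment (h : LocalAlternatives P₀ P V) {φ : X → ℝ} (hφ : Measurable φ)
    {K : ℝ} (hK : ∀ x, |φ x| ≤ K * V x) (h0 : ∫ x, φ x ∂P₀ = 0) (t : ℝ) :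
    Tendsto (fun n : ℕ => (n : ℂ) * (∫ x, Complex.exp
        ((t * (φ x - ∫ y, φ y ∂P n) / √(n : ℝ) : ℝ) * Complex.I) ∂P n - 1)) atTop
      (𝓝 (-(t ^ 2 * (∫ x, φ x ^ 2 ∂P₀) / 2 : ℝ))) := by
  have := h.isProb₀
  have := h.isProb
  set δ : ℕ → ℝ := fun n => ∫ y, φ y ∂P n with hδ
  have hδ0 : Tendsto δ atTop (𝓝 0) := by
    rw [← h0]; exact h.tendsto_integral hφ ⟨K, hK⟩
  have hδ1 : ∀ᶠ n in atTop, |δ n| ≤ 1 := hδ0.abs.eventually (ge_mem_nhds (by simp))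
  have hφsq : Integrable (fun x => φ x ^ 2) P₀ := by
    refine MemLp.integrable_sq ((h.memLp.const_mul K).mono hφ.aestronglyMeasurable
      (ae_of_all _ fun x => ?_))
    exact (hK x).trans (le_abs_self _)
  set y : ℕ → X → ℝ := fun n x => t * (φ x - δ n) / √(n : ℝ) with hy
  have hym : ∀ n, Measurable (y n) := fun n => ((hφ.sub_const _).const_mul _).div_const _
  set U : ℕ → X → ℂ := fun n x => (√(n : ℝ) : ℂ) *
    (Complex.exp ((y n x : ℝ) * Complex.I) - 1 - (y n x : ℝ) * Complex.I) with hU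
  have hcm : ∀ n, Measurable fun x => Complex.exp ((y n x : ℝ) * Complex.I) := fun n =>
    Complex.measurable_exp.comp ((Complex.measurable_ofReal.comp (hym n)).mul_const _)
  have hUm : ∀ n, Measurable (U n) := fun n =>
    (((hcm n).sub_const _).sub ((Complex.measurable_ofReal.comp (hym n)).mul_const _)).const_mul _
  have hx : ∀ x, Tendsto (fun n => t * (φ x - δ n)) atTop (𝓝 (t * φ x)) := fun x => by
    simpa using (hδ0.const_sub (φ x)).const_mul t
  have hUlim : ∀ x, Tendsto (fun n => U n x) atTop (𝓝 0) := fun x =>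
    tendsto_sqrt_mul_cexp_zero (hx x)
  have hUbound : ∀ᶠ n in atTop, ∀ x, ‖U n x‖ ≤ 2 * |t| * (K + 1) * V x := by
    filter_upwards [hδ1, eventually_gt_atTop 0] with n hn hpos x
    have hs : 0 < √(n : ℝ) := Real.sqrt_pos.2 (by exact_mod_cast hpos)
    have h1 : ‖Complex.exp ((y n x : ℝ) * Complex.I) - 1 - (y n x : ℝ) * Complex.I‖
        ≤ 2 * |y n x| := by
      refine (norm_sub_le _ _).trans ?_
      have := norm_cexp_sub_one_le (y n x)
      simp only [norm_mul, Complex.norm_real, Complex.norm_I, mul_one, Real.norm_eq_abs]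
      linarith
    have h2 : √(n : ℝ) * (2 * |y n x|) = 2 * |t| * |φ x - δ n| := by
      simp only [hy]
      rw [abs_div, abs_mul, abs_of_pos hs]
      field_simp
    have h3 : |φ x - δ n| ≤ (K + 1) * V x := by
      have := abs_sub (φ x) (δ n)
      have := hK x
      have := h.one_le x
      linarith
    rw [hU, norm_mul, Complex.norm_real, Real.norm_of_nonneg hs.le]
    calc _ ≤ √(n : ℝ) * (2 * |y n x|) := mul_le_mul_of_nonneg_left h1 hs.le
      _ = 2 * |t| * |φ x - δ n| := h2
      _ ≤ 2 * |t| * ((K + 1) * V x) := by gcongr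
      _ = _ := by ring
  have hB := h.tendsto U hUm ⟨_, hUbound⟩ (ae_of_all _ hUlim)
  have hA : Tendsto (fun n : ℕ => ∫ x, (√(n : ℝ) : ℂ) * U n x ∂P₀) atTop
      (𝓝 (∫ x, ((-((t * φ x) ^ 2 / 2) : ℝ) : ℂ) ∂P₀)) := by
    refine tendsto_integral_filter_of_dominated_convergence
      (fun x => 6 * t ^ 2 * (φ x ^ 2 + 1)) (Eventually.of_forall fun n =>
        ((hUm n).const_mul _).aestronglyMeasurable) ?_
      ((hφsq.add (integrable_const _)).const_mul _)
      (ae_of_all _ fun x => by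
        have := tendsto_sqrt_mul_cexp (hx x)
        rwa [← Complex.ofReal_neg] at this)
    filter_upwards [hδ1, eventually_gt_atTop 0] with n hn hpos
    refine ae_of_all _ fun x => ?_
    have hs : 0 < √(n : ℝ) := Real.sqrt_pos.2 (by exact_mod_cast hpos)
    have hsq : √(n : ℝ) ^ 2 = n := Real.sq_sqrt (Nat.cast_nonneg n)
    rw [hU, norm_mul, norm_mul, Complex.norm_real, Real.norm_of_nonneg hs.le]
    calc _ ≤ √(n : ℝ) * (√(n : ℝ) * (3 * y n x ^ 2)) := by
          gcongr
          exact norm_cexp_sub_one_sub_le _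
      _ = 3 * t ^ 2 * (φ x - δ n) ^ 2 := by
          simp only [hy]
          field_simp
      _ ≤ 3 * t ^ 2 * (2 * (φ x ^ 2 + 1)) := by
          gcongr
          have : δ n ^ 2 ≤ 1 := by rw [← sq_abs]; nlinarith [abs_nonneg (δ n)]
          nlinarith [sq_nonneg (φ x + δ n)]
      _ = _ := by ring
  have hlim := hB.add hA
  rw [integral_complex_ofReal] at hlim
  have e1 : ∫ x, -((t * φ x) ^ 2 / 2) ∂P₀ = -(t ^ 2 * (∫ x, φ x ^ 2 ∂P₀) / 2) := by
    rw [integral_neg, integral_div]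
    simp_rw [mul_pow]
    rw [integral_const_mul]
  rw [zero_add, e1, Complex.ofReal_neg] at hlim
  refine hlim.congr' ?_
  filter_upwards [h.integrable, hUbound, eventually_gt_atTop 0] with n hin hUn hpos
  have hs : 0 < √(n : ℝ) := Real.sqrt_pos.2 (by exact_mod_cast hpos)
  have hsq : (√(n : ℝ) : ℂ) * √(n : ℝ) = n := by
    rw [← Complex.ofReal_mul, Real.mul_self_sqrt (Nat.cast_nonneg n), Complex.ofReal_natCast]
  have hφi : Integrable φ (P n) := integrable_of_norm_le_mul hin hφ.aestronglyMeasurable hK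
  have hyi : Integrable (y n) (P n) := ((hφi.sub (integrable_const _)).const_mul _).div_const _
  -- Centring at the mean under P n kills the linear term exactly.
  have hy0 : ∫ x, y n x ∂P n = 0 := by
    simp only [hy]
    rw [integral_div, integral_const_mul, integral_sub hφi (integrable_const _)]
    simp [hδ]
  have hci : Integrable (fun x => Complex.exp ((y n x : ℝ) * Complex.I)) (P n) :=
    (integrable_const (1 : ℝ)).mono' (hcm n).aestronglyMeasurable (ae_of_all _ fun x => by
      rw [Complex.norm_exp_ofReal_mul_I])
  have hUI : ∫ x, U n x ∂P n = √(n : ℝ) *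
      (∫ x, Complex.exp ((y n x : ℝ) * Complex.I) ∂P n - 1) := by
    simp only [hU]
    have i1 : Integrable (fun x => Complex.exp ((y n x : ℝ) * Complex.I) - 1) (P n) :=
      hci.sub (integrable_const _)
    have i2 : Integrable (fun x => (y n x : ℂ) * Complex.I) (P n) := hyi.ofReal.mul_const _
    rw [integral_const_mul, integral_sub i1 i2, integral_sub hci (integrable_const _),
      integral_mul_const, integral_complex_ofReal, hy0]
    simp
  have hU0 : ∫ x, (√(n : ℝ) : ℂ) * U n x ∂P₀ = √(n : ℝ) * ∫ x, U n x ∂P₀ := integral_const_mul _ _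
  rw [hU0, mul_sub, sub_add_cancel, hUI, ← mul_assoc, hsq]

/-- The centred and rescaled sums of `φ`. -/
lemma tendsto_charFun_sum (h : LocalAlternatives P₀ P V) {φ : X → ℝ} (hφ : Measurable φ)
    {K : ℝ} (hK : ∀ x, |φ x| ≤ K * V x) (h0 : ∫ x, φ x ∂P₀ = 0) (k : ℕ → ℕ) (t : ℝ) :
    Tendsto (fun n : ℕ => ∫ w, Complex.exp ((t * ((√(n : ℝ))⁻¹ *
        ∑ i, (φ (w.1 i) - ∫ y, φ y ∂P n)) : ℝ) * Complex.I) ∂sampleLaw (P n) n (k n)) atTop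
      (𝓝 (charFun (gaussianReal 0 (∫ x, φ x ^ 2 ∂P₀).toNNReal) t)) := by
  have := h.isProb
  have hlim := Complex.tendsto_one_add_pow_exp_of_tendsto
    (h.tendsto_charFun_increment hφ hK h0 t)
  have e0 : charFun (gaussianReal 0 (∫ x, φ x ^ 2 ∂P₀).toNNReal) t
      = Complex.exp (-(t ^ 2 * (∫ x, φ x ^ 2 ∂P₀) / 2 : ℝ)) := by
    rw [charFun_gaussianReal]
    congr 1
    have : ((∫ x, φ x ^ 2 ∂P₀).toNNReal : ℝ) = ∫ x, φ x ^ 2 ∂P₀ :=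
      Real.coe_toNNReal _ (integral_nonneg fun x => sq_nonneg _)
    have h2 : (((∫ x, φ x ^ 2 ∂P₀).toNNReal : ℝ) : ℂ) = ((∫ x, φ x ^ 2 ∂P₀ : ℝ) : ℂ) := by rw [this]
    rw [Complex.ofReal_div, Complex.ofReal_mul, ← h2]
    push_cast
    ring
  rw [e0]
  refine hlim.congr fun n => ?_
  rw [add_sub_cancel, sampleLaw]
  have e : ∀ w : Sample X n (k n), Complex.exp ((t * ((√(n : ℝ))⁻¹ *
      ∑ i, (φ (w.1 i) - ∫ y, φ y ∂P n)) : ℝ) * Complex.I)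
      = ∏ i, Complex.exp ((t * (φ (w.1 i) - ∫ y, φ y ∂P n) / √(n : ℝ) : ℝ) * Complex.I) := by
    intro w
    rw [← Complex.exp_sum, ← Finset.sum_mul, ← Complex.ofReal_sum]
    congr 3
    rw [Finset.mul_sum, Finset.mul_sum]
    exact Finset.sum_congr rfl fun i _ => by rw [div_eq_mul_inv]; ring
  simp_rw [e]
  rw [integral_fun_fst (f := fun v : Fin n → X => ∏ i, Complex.exp
    ((t * (φ (v i) - ∫ y, φ y ∂P n) / √(n : ℝ) : ℝ) * Complex.I))]
  have hpow := integral_fintype_prod_eq_pow (ι := Fin n) (μ := P n) (fun x => Complex.exp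
    ((t * (φ x - ∫ y, φ y ∂P n) / √(n : ℝ) : ℝ) * Complex.I))
  rw [Fintype.card_fin] at hpow
  rw [hpow]
  simp

end LocalAlternatives

/-- Slutsky's lemma for characteristic functions. -/
lemma tendsto_integral_cexp_of_isLittleOP {S : ℕ → Type*} [∀ n, MeasurableSpace (S n)]
    {μ : ∀ n, Measure (S n)} [∀ n, IsProbabilityMeasure (μ n)] {T W : ∀ n, S n → ℝ}
    (hT : ∀ᶠ n in atTop, Measurable (T n)) (hW : ∀ᶠ n in atTop, Measurable (W n))
    (h : IsLittleOP μ fun n w => ‖W n w - T n w‖ₑ) {t : ℝ} {c : ℂ}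
    (hc : Tendsto (fun n => ∫ w, Complex.exp ((t * T n w : ℝ) * Complex.I) ∂μ n) atTop (𝓝 c)) :
    Tendsto (fun n => ∫ w, Complex.exp ((t * W n w : ℝ) * Complex.I) ∂μ n) atTop (𝓝 c) := by
  have hint : ∀ n, ∀ f : S n → ℝ, Measurable f →
      Integrable (fun w => Complex.exp ((t * f w : ℝ) * Complex.I)) (μ n) := by
    intro n f hf
    refine (integrable_const (1 : ℝ)).mono' ?_ (ae_of_all _ fun x => by
      rw [Complex.norm_exp_ofReal_mul_I])
    exact (Complex.measurable_exp.comp ((Complex.measurable_ofReal.comp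
      (hf.const_mul t)).mul_const _)).aestronglyMeasurable
  suffices hdiff : Tendsto (fun n => ∫ w, Complex.exp ((t * W n w : ℝ) * Complex.I) ∂μ n
      - ∫ w, Complex.exp ((t * T n w : ℝ) * Complex.I) ∂μ n) atTop (𝓝 0) by
    simpa using hdiff.add hc
  rw [isLittleOP_enorm_iff] at h
  rw [Metric.tendsto_nhds]
  intro ε hε
  -- Off the bad event the error is at most |t| δ ≤ ε / 2; on it the integrand is at most 2, and the
  -- event eventually has mass below ε / 4.
  set δ := ε / (2 * (|t| + 1)) with hδ
  have hδ0 : 0 < δ := by positivity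
  have hsmall : Tendsto (fun n => (μ n).real {w | δ ≤ |W n w - T n w|}) atTop (𝓝 0) := by
    simpa [Function.comp_def, measureReal_def] using
      (ENNReal.tendsto_toReal ENNReal.zero_ne_top).comp (h δ hδ0)
  filter_upwards [hT, hW, hsmall.eventually (gt_mem_nhds (by positivity : 0 < ε / 4))]
    with n hTn hWn hn
  rw [dist_zero_right, ← integral_sub (hint n _ hWn) (hint n _ hTn)]
  set E : Set (S n) := {w | δ ≤ |W n w - T n w|}
  have hE : MeasurableSet E := measurableSet_le measurable_const (hWn.sub hTn).abs
  have hpt : ∀ w, ‖Complex.exp ((t * W n w : ℝ) * Complex.I)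
      - Complex.exp ((t * T n w : ℝ) * Complex.I)‖ ≤ |t| * δ + E.indicator (fun _ => 2) w := by
    intro w
    by_cases hw : w ∈ E
    · rw [Set.indicator_of_mem hw]
      refine (norm_sub_le _ _).trans ?_
      rw [Complex.norm_exp_ofReal_mul_I, Complex.norm_exp_ofReal_mul_I]
      have : 0 ≤ |t| * δ := by positivity
      linarith
    · rw [Set.indicator_of_notMem hw, add_zero]
      have e : Complex.exp ((t * W n w : ℝ) * Complex.I) - Complex.exp ((t * T n w : ℝ) * Complex.I)
          = Complex.exp ((t * T n w : ℝ) * Complex.I) *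
            (Complex.exp ((t * (W n w - T n w) : ℝ) * Complex.I) - 1) := by
        rw [mul_sub, ← Complex.exp_add, mul_one]
        congr 2
        push_cast
        ring
      rw [e, norm_mul, Complex.norm_exp_ofReal_mul_I, one_mul]
      refine (norm_cexp_sub_one_le _).trans ?_
      rw [abs_mul]
      gcongr
      exact (not_le.1 hw).le
  calc _ ≤ ∫ w, ‖Complex.exp ((t * W n w : ℝ) * Complex.I)
        - Complex.exp ((t * T n w : ℝ) * Complex.I)‖ ∂μ n := norm_integral_le_integral_norm _
    _ ≤ ∫ w, (|t| * δ + E.indicator (fun _ => 2) w) ∂μ n :=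
        integral_mono ((hint n _ hWn).sub (hint n _ hTn)).norm
          ((integrable_const _).add ((integrable_const _).indicator hE)) hpt
    _ = |t| * δ + (μ n).real E * 2 := by
        rw [integral_add (integrable_const _) ((integrable_const _).indicator hE),
          integral_indicator_const _ hE]
        simp
    _ < ε := by
        have h1 : |t| * δ ≤ ε / 2 := by
          rw [hδ, mul_div_assoc', div_le_div_iff₀ (by positivity) (by norm_num)]
          nlinarith [abs_nonneg t]
        linarith

/-- Weak convergence from convergence of characteristic functions. -/
lemma tendsto_integral_of_tendsto_charFun {S : ℕ → Type*} [∀ n, MeasurableSpace (S n)]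
    {μ : ∀ n, Measure (S n)} [∀ n, IsProbabilityMeasure (μ n)] {W : ∀ n, S n → ℝ}
    (hW : ∀ n, Measurable (W n)) {L : Measure ℝ} [IsProbabilityMeasure L]
    (h : ∀ t : ℝ, Tendsto (fun n => ∫ w, Complex.exp ((t * W n w : ℝ) * Complex.I) ∂μ n) atTop
      (𝓝 (charFun L t))) (f : BoundedContinuousFunction ℝ ℝ) :
    Tendsto (fun n => ∫ w, f (W n w) ∂μ n) atTop (𝓝 (∫ u, f u ∂L)) := by
  set ν : ℕ → ProbabilityMeasure ℝ := fun n =>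
    ⟨(μ n).map (W n), Measure.isProbabilityMeasure_map (hW n).aemeasurable⟩
  have hν : Tendsto ν atTop (𝓝 ⟨L, inferInstance⟩) := by
    refine ProbabilityMeasure.tendsto_iff_tendsto_charFun.2 fun t => (h t).congr fun n => ?_
    rw [charFun_apply_real]
    change _ = ∫ x, Complex.exp (t * x * Complex.I) ∂((μ n).map (W n))
    rw [integral_map (hW n).aemeasurable (Measurable.aestronglyMeasurable (by fun_prop))]
    simp
  refine (ProbabilityMeasure.tendsto_iff_forall_integral_tendsto.1 hν f).congr fun n => ?_
  exact integral_map (hW n).aemeasurable f.continuous.aestronglyMeasurable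

end CharFun

/-! ### Regularity -/

section Regularity

universe uA uZ uC uΩ

variable {𝒜 : Type uA} {𝒵 : Type uZ} {𝒞 : Type uC} [Fintype 𝒜] [Fintype 𝒵] [Countable 𝒞]
  [MeasurableSpace 𝒜] [MeasurableSpace 𝒵] [MeasurableSpace 𝒞]
  [MeasurableSingletonClass 𝒜] [MeasurableSingletonClass 𝒵] [MeasurableSingletonClass 𝒞]

/-- The growth of the estimating functions. -/
def growth (x : Obs 𝒜 𝒵 𝒞) : ℝ := 1 + |x.2.2.2|

lemma measurable_growth : Measurable (growth : Obs 𝒜 𝒵 𝒞 → ℝ) := by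
  unfold growth; fun_prop

lemma eLpNorm_growth_le (P : Measure (Obs 𝒜 𝒵 𝒞)) [IsProbabilityMeasure P] :
    eLpNorm growth 2 P ≤ 1 + (∫⁻ x, ‖x.2.2.2‖ₑ ^ 2 ∂P) ^ (1 / 2 : ℝ) := by
  have hY : Measurable fun x : Obs 𝒜 𝒵 𝒞 => |x.2.2.2| := by fun_prop
  have e : (growth : Obs 𝒜 𝒵 𝒞 → ℝ) = (fun _ => 1) + fun x => |x.2.2.2| := rfl
  rw [e]
  refine (eLpNorm_add_le aestronglyMeasurable_const hY.aestronglyMeasurable one_le_two).trans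
    (add_le_add ?_ (le_of_eq ?_))
  · rw [eLpNorm_const _ two_ne_zero (IsProbabilityMeasure.ne_zero P)]
    simp
  · rw [eLpNorm_eq_lintegral_rpow_enorm_toReal two_ne_zero ENNReal.ofNat_ne_top]
    simp

lemma IsBoundedLaw.mono {P : Measure (Obs 𝒜 𝒵 𝒞)} {ε ε' q : ℝ} (h : IsBoundedLaw P ε q)
    (h0 : 0 < ε') (hle : ε' ≤ ε) : IsBoundedLaw P ε' q :=
  ⟨h0, h.nonneg, h.outcome, fun z b c => hle.trans (h.mediator z b c),
    fun b c => hle.trans (h.treatment b c)⟩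

/-! ### Convergence of the nuisances and pathwise differentiability. -/

section Functional

variable {P₀ : Measure (Obs 𝒜 𝒵 𝒞)} {P : ℕ → Measure (Obs 𝒜 𝒵 𝒞)}

lemma tendsto_treatment (h₀ : IsBDTDLaw P₀) (h : ∀ᶠ n in atTop, IsBDTDLaw (P n))
    (hLA : LocalAlternatives P₀ P growth) (b : 𝒜) (c : 𝒞) :
    Tendsto (fun n => (trueNuisance (P n)).treatment b c) atTop
      (𝓝 ((trueNuisance P₀).treatment b c)) := by
  have key : ∀ {Q : Measure (Obs 𝒜 𝒵 𝒞)}, IsBDTDLaw Q → (trueNuisance Q).treatment b c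
      = Q.real {x | x.2.1 = b ∧ x.1 = c} / Q.real {x | x.1 = c} := by
    intro Q hQ
    rw [hQ.cell_eq_treatment, mul_div_cancel_left₀ _ (hQ.cell_C_pos c).ne']
  rw [key h₀]
  refine ((hLA.tendsto_measureReal (measurableSet_cell_AC b c)).div
    (hLA.tendsto_measureReal (measurableSet_cell_C c)) (h₀.cell_C_pos c).ne').congr' ?_
  filter_upwards [h] with n hn
  exact (key hn).symm

lemma tendsto_mediator (h₀ : IsBDTDLaw P₀) (h : ∀ᶠ n in atTop, IsBDTDLaw (P n))
    (hLA : LocalAlternatives P₀ P growth) (z : 𝒵) (b : 𝒜) (c : 𝒞) :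
    Tendsto (fun n => (trueNuisance (P n)).mediator z b c) atTop
      (𝓝 ((trueNuisance P₀).mediator z b c)) := by
  have key : ∀ {Q : Measure (Obs 𝒜 𝒵 𝒞)}, IsBDTDLaw Q → (trueNuisance Q).mediator z b c
      = Q.real {x | x.1 = c ∧ x.2.1 = b ∧ x.2.2.1 = z} / Q.real {x | x.2.1 = b ∧ x.1 = c} := by
    intro Q hQ
    rw [hQ.cell_eq_mediator, mul_div_cancel_left₀ _ (hQ.cell_AC_pos b c).ne']
  rw [key h₀]
  refine ((hLA.tendsto_measureReal (measurableSet_cell c b z)).div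
    (hLA.tendsto_measureReal (measurableSet_cell_AC b c)) (h₀.cell_AC_pos b c).ne').congr' ?_
  filter_upwards [h] with n hn
  exact (key hn).symm

lemma tendsto_weight (h₀ : IsBDTDLaw P₀) (h : ∀ᶠ n in atTop, IsBDTDLaw (P n))
    (hLA : LocalAlternatives P₀ P growth) (aStar a : 𝒜) (z : 𝒵) (c : 𝒞) :
    Tendsto (fun n => (trueNuisance (P n)).weight aStar a z c) atTop
      (𝓝 ((trueNuisance P₀).weight aStar a z c)) := by
  simp only [Nuisance.weight, tsum_fintype]
  exact ((tendsto_mediator h₀ h hLA z aStar c).sub (tendsto_mediator h₀ h hLA z a c)).div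
    (tendsto_finsetSum _ fun b _ =>
      (tendsto_mediator h₀ h hLA z b c).mul (tendsto_treatment h₀ h hLA b c)) (h₀.mix_pos z c).ne'

/-- With the outcome regression of `Q` and the other nuisance functions of `P`, the estimating
function is unbiased under `P`, and under `Q`. -/
lemma integral_drScore_mixed {P Q : Measure (Obs 𝒜 𝒵 𝒞)} (hP : IsBDTDLaw P) {aStar a : 𝒜}
    (hi : Integrable (drScore aStar a (trueNuisance Q).outcome ((trueNuisance P).weight aStar a)
      (trueNuisance Q).mean (trueNuisance P).treatment ((trueNuisance Q).contrast aStar a)) P) :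
    ∫ x, drScore aStar a (trueNuisance Q).outcome ((trueNuisance P).weight aStar a)
      (trueNuisance Q).mean (trueNuisance P).treatment ((trueNuisance Q).contrast aStar a) x ∂P
      = ∫ x, (frontDoorMean P aStar x.1 - frontDoorMean P a x.1) ∂P := by
  refine hP.integral_drScore hi (fun _ _ => (hasSum_fintype _).summable) fun c => ?_
  have hπ : ∀ b, (trueNuisance P).treatment b c / (trueNuisance P).treatment b c = 1 :=
    fun b => div_self (hP.treatment_pos b c).ne'
  have hw : ∀ z, ((trueNuisance P).outcome z c - (trueNuisance Q).outcome z c)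
      * (trueNuisance P).weight aStar a z c *
        ∑ b, (trueNuisance P).mediator z b c * (trueNuisance P).treatment b c
      = ((trueNuisance P).outcome z c - (trueNuisance Q).outcome z c)
        * ((trueNuisance P).mediator z aStar c - (trueNuisance P).mediator z a c) := by
    intro z
    rw [mul_assoc, Nuisance.weight_mul_mix (hP.mix_pos z c)]
  rw [Nuisance.contrast_eq_sub]
  simp only [frontDoorMean, Nuisance.mean, tsum_fintype, hπ, one_mul, hw]
  simp only [mul_sub, sub_mul, Finset.sum_sub_distrib]
  ring

/-- With a true outcome regression and its true means, residual and correction both average to zero,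
whatever the weight and the treatment model. -/
lemma integral_drScore_outcome {P : Measure (Obs 𝒜 𝒵 𝒞)} (hP : IsBDTDLaw P) {aStar a : 𝒜}
    {w : 𝒵 → 𝒞 → ℝ} {π : 𝒜 → 𝒞 → ℝ}
    (hi : Integrable (drScore aStar a (trueNuisance P).outcome w (trueNuisance P).mean π
      ((trueNuisance P).contrast aStar a)) P) :
    ∫ x, drScore aStar a (trueNuisance P).outcome w (trueNuisance P).mean π
      ((trueNuisance P).contrast aStar a) x ∂P
      = ∫ x, (frontDoorMean P aStar x.1 - frontDoorMean P a x.1) ∂P := by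
  refine hP.integral_drScore hi (fun _ _ => (hasSum_fintype _).summable) fun c => ?_
  rw [Nuisance.contrast_eq_sub]
  simp [frontDoorMean, Nuisance.mean]

/-- Pathwise differentiability: the functional has the influence function as its gradient. -/
lemma tendsto_functional_expansion {ε q : ℝ} (hb : IsBoundedLaw P₀ ε q) (h₀ : IsBDTDLaw P₀)
    (h : ∀ᶠ n in atTop, IsBDTDLaw (P n))
    (hover : ∀ᶠ n in atTop, ∀ b c, ε ≤ (trueNuisance (P n)).treatment b c)
    (hLA : LocalAlternatives P₀ P growth) (aStar a : 𝒜) :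
    Tendsto (fun n : ℕ => √(n : ℝ) *
      (∫ x, (frontDoorMean (P n) aStar x.1 - frontDoorMean (P n) a x.1) ∂P n
        - ∫ x, mBDTD aStar a (trueNuisance P₀) x ∂P n)) atTop (𝓝 0) := by
  set m := mBDTD aStar a (trueNuisance P₀) with hm
  -- A score with the outcome regression of P₀ and the weight and treatment model of P n. Under P n
  -- its mean is the functional at P n; under P₀ it has the same mean as m. The quantity in question
  -- is therefore √n ∫ (ψ n - m) d(P n - P₀), and ψ n → m pointwise.
  set ψ : ℕ → Obs 𝒜 𝒵 𝒞 → ℝ := fun n => drScore aStar a (trueNuisance P₀).outcome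
    ((trueNuisance (P n)).weight aStar a) (trueNuisance P₀).mean (trueNuisance (P n)).treatment
    ((trueNuisance P₀).contrast aStar a) with hψ
  have hψm : ∀ n, Measurable (ψ n) := fun n => measurable_drScore _ _ _ _ _ _ _
  have hmm : Measurable m := by rw [hm, mBDTD_eq_drScore]; exact measurable_drScore _ _ _ _ _ _ _
  have hmb : ∀ x, |m x| ≤ growthConst ε q * growth x := hb.abs_mBDTD_le h₀ aStar a
  have hψb : ∀ᶠ n in atTop, ∀ x, |ψ n x| ≤ growthConst ε q * growth x := by
    filter_upwards [h, hover] with n hn ho x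
    exact hb.abs_drScore_le h₀ (hn.abs_weight_le hb.pos ho aStar a) ho x
  have hlim : ∀ x, Tendsto (fun n => ψ n x - m x) atTop (𝓝 0) := by
    intro x
    have h1 : Tendsto (fun n => ψ n x) atTop (𝓝 (m x)) := by
      rw [hm, mBDTD_eq_drScore]
      simp only [hψ, drScore]
      exact (((tendsto_weight h₀ h hLA aStar a _ _).const_mul _).add
        ((tendsto_const_nhds.div (tendsto_treatment h₀ h hLA _ _)
          (h₀.treatment_pos _ _).ne').const_mul _)).add_const _
    simpa using h1.sub_const (m x)
  have hmain := hLA.tendsto_real (u := fun n x => ψ n x - m x) (fun n => (hψm n).sub hmm)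
    ⟨2 * growthConst ε q, by
      filter_upwards [hψb] with n hn x
      refine (abs_sub _ _).trans ?_
      linarith [hn x, hmb x]⟩ (ae_of_all _ hlim)
  refine hmain.congr' ?_
  filter_upwards [h, hψb, hLA.integrable] with n hn hψn hin
  have i1 : Integrable (ψ n) (P n) :=
    integrable_of_norm_le_mul hin (hψm n).aestronglyMeasurable hψn
  have i2 : Integrable (ψ n) P₀ :=
    integrable_of_norm_le_mul hLA.integrable₀ (hψm n).aestronglyMeasurable hψn
  have i3 : Integrable m (P n) := integrable_of_norm_le_mul hin hmm.aestronglyMeasurable hmb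
  have i4 : Integrable m P₀ :=
    integrable_of_norm_le_mul hLA.integrable₀ hmm.aestronglyMeasurable hmb
  have e1 : ∫ x, ψ n x ∂P n
      = ∫ x, (frontDoorMean (P n) aStar x.1 - frontDoorMean (P n) a x.1) ∂P n :=
    integral_drScore_mixed hn i1
  have e2 : ∫ x, ψ n x ∂P₀ = ∫ x, m x ∂P₀ := by
    rw [hm, mBDTD_eq_drScore] at i4 ⊢
    rw [integral_drScore_outcome h₀ i2, integral_drScore_outcome h₀ i4]
  rw [integral_sub i1 i3, integral_sub i2 i4, e1, e2, sub_self, sub_zero]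

end Functional

lemma isLittleOP_of_tendsto {S : ℕ → Type*} [∀ n, MeasurableSpace (S n)]
    {μ : ∀ n, Measure (S n)} {r : ℕ → ℝ} (hr : Tendsto r atTop (𝓝 0)) :
    IsLittleOP μ fun n _ => ‖r n‖ₑ := by
  intro ε hε
  refine tendsto_const_nhds.congr' ?_
  filter_upwards [(tendsto_zero_iff_enorm_tendsto_zero.1 hr).eventually (gt_mem_nhds hε)] with n hn
  simp [not_le.2 hn]

/-- Contiguity transfers the linear expansion to the local laws, the gradient property recentres it
from θ to θ(αₙ), and the central limit theorem under the moving laws gives a Gaussian limit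
depending on φ and P₀ alone. -/
theorem CausalModel.IsBDTD.isRegularEstimator {M : CausalModel.{uA, uZ, uC, uΩ} 𝒜 𝒵 𝒞}
    (hM : M.IsBDTD) {aStar a : 𝒜} {k : ℕ → ℕ}
    {ηhat : ∀ n, Sample (Obs 𝒜 𝒵 𝒞) n (k n) → Nuisance 𝒜 𝒵 𝒞}
    {θhat : ∀ n, Sample (Obs 𝒜 𝒵 𝒞) n (k n) → ℝ}
    (hθ : SolvesEstimatingEquation aStar a k ηhat θhat) (hη : IsNuisanceEstimator k ηhat)
    (hY : MemLp M.Y 2 M.prob) {N : ℕ} (hk : ∀ n, k n ≤ N * (n + 1)) {ε₀ q : ℝ}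
    (hb₀ : IsBoundedLaw M.obsLaw ε₀ q)
    (hlin : IsAsymptoticallyLinear M.obsLaw (M.ace aStar a)
      (phiBDTD aStar a (trueNuisance M.obsLaw) (M.ace aStar a)) k θhat) :
    IsRegularEstimator M aStar a k θhat := by
  set P₀ := M.obsLaw with hP₀
  set θ := M.ace aStar a with hθ₀
  set φ := phiBDTD aStar a (trueNuisance P₀) θ with hφ
  have h₀ : IsBDTDLaw P₀ := hM.isBDTDLaw
  have hφm : Measurable φ := by
    have : Measurable (mBDTD aStar a (trueNuisance P₀)) := by
      rw [mBDTD_eq_drScore]; exact measurable_drScore _ _ _ _ _ _ _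
    exact this.sub_const θ
  refine ⟨gaussianReal 0 (∫ x, φ x ^ 2 ∂P₀).toNNReal, inferInstance, ?_⟩
  rintro d F hF α ⟨B, hB⟩ hα f
  obtain ⟨μ, s, s₀, g, D, hLD, hPn, hP0⟩ := hF.exists_localDensities hB hα
  obtain ⟨ε₁, hε₁, hover⟩ := hF.overlap
  obtain ⟨K, hK⟩ := hF.moment
  set P : ℕ → Measure (Obs 𝒜 𝒵 𝒞) := fun n => (F (α n)).obsLaw with hPdef
  have hmodel : ∀ᶠ n in atTop, (F (α n)).IsBDTD := hα.eventually hF.model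
  have hlaw : ∀ᶠ n in atTop, IsBDTDLaw (P n) := hmodel.mono fun n hn => hn.isBDTDLaw
  set ε := min ε₀ ε₁
  have hb : IsBoundedLaw P₀ ε q := hb₀.mono (lt_min hb₀.pos hε₁) (min_le_left _ _)
  have hoverε : ∀ᶠ n in atTop, ∀ b c, ε ≤ (trueNuisance (P n)).treatment b c := by
    obtain ⟨x⟩ := h₀.nonempty
    filter_upwards [hα.eventually hover] with n hn b c
    exact (min_le_right _ _).trans (hn x.2.2.1 b c).2
  have hV₀ : eLpNorm growth 2 P₀ ≠ ∞ :=
    ((memLp_const (1 : ℝ)).add (CausalModel.memLp_obsLaw hY).norm).2.ne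
  have hLA : LocalAlternatives P₀ P growth := by
    refine hLD.localAlternatives hPn hP0 measurable_growth
      (fun x => le_add_of_nonneg_right (abs_nonneg _))
      -- The first summand controls the envelope under P₀; the second does so under P n through the
      -- uniform second moment of Y.
      (C := eLpNorm growth 2 P₀ + (1 + (K : ℝ≥0∞) ^ (1 / 2 : ℝ))) ?_ le_self_add ?_
    · exact ENNReal.add_ne_top.2 ⟨hV₀, by finiteness⟩
    · filter_upwards [hα.eventually hK] with n hn
      refine (eLpNorm_growth_le (P n)).trans (le_trans ?_ le_add_self)
      gcongr
  have hφb : ∀ x, |φ x| ≤ (growthConst ε q + |θ|) * growth x := by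
    intro x
    have h1 := hb.abs_mBDTD_le h₀ aStar a x
    have h2 : |φ x| ≤ |mBDTD aStar a (trueNuisance P₀) x| + |θ| := abs_sub _ _
    have h3 := hLA.one_le x
    have h4 : |θ| ≤ |θ| * growth x := le_mul_of_one_le_right (abs_nonneg _) h3
    rw [add_mul]
    exact h2.trans (add_le_add h1 h4)
  set W : ∀ n : ℕ, Sample (Obs 𝒜 𝒵 𝒞) n (k n) → ℝ := fun n w =>
    √(n : ℝ) * (θhat n w - (F (α n)).ace aStar a) with hW
  set T : ∀ n : ℕ, Sample (Obs 𝒜 𝒵 𝒞) n (k n) → ℝ := fun n w =>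
    (√(n : ℝ))⁻¹ * ∑ i, (φ (w.1 i) - ∫ y, φ y ∂P n) with hT
  have hWm : ∀ n, 0 < n → Measurable (W n) := by
    intro n hn
    have : Measurable (θhat n) := by
      have e : θhat n = fun w => (n : ℝ)⁻¹ * ∑ i, mBDTD aStar a (ηhat n w) (w.1 i) :=
        funext fun w => hθ.eq_average hn w
      rw [e]
      refine (Finset.measurable_sum _ fun i _ => ?_).const_mul _
      exact (hη.measurable_mBDTD aStar a n).comp
        (measurable_id.prodMk ((measurable_pi_apply i).comp measurable_fst))
    exact (this.sub_const _).const_mul _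
  have hTm : ∀ n, Measurable (T n) := fun n =>
    (Finset.measurable_sum _ fun i _ =>
      (hφm.comp ((measurable_pi_apply i).comp measurable_fst)).sub_const _).const_mul _
  have hexp := tendsto_functional_expansion hb h₀ hlaw hoverε hLA aStar a
  have hexp' := neg_zero (G := ℝ) ▸ hexp.neg
  have hremainder : IsLittleOP (fun n => sampleLaw (P n) n (k n)) fun n w =>
      ‖√(n : ℝ) * (θhat n w - θ) - (√(n : ℝ))⁻¹ * ∑ i, φ (w.1 i)‖ₑ := fun δ hδ =>
    hLD.contiguous hPn hP0 hk (hlin.expansion δ hδ)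
  -- T centres φ at its mean under P n. The difference from W is the expansion remainder plus the
  -- deterministic error of the functional expansion.
  have hWT : IsLittleOP (fun n => sampleLaw (P n) n (k n)) fun n w => ‖W n w - T n w‖ₑ := by
    refine (hremainder.add (isLittleOP_of_tendsto hexp')).mono
      (p := fun _ _ => True) (by simp [WithProbToOne]) ?_
    filter_upwards [hmodel, hLA.integrable] with n hn hin w _
    refine le_trans (le_of_eq ?_) (enorm_add_le _ _)
    congr 1
    have hm : Integrable (mBDTD aStar a (trueNuisance P₀)) (P n) :=
      integrable_of_norm_le_mul hin (by
        rw [mBDTD_eq_drScore]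
        exact (measurable_drScore _ _ _ _ _ _ _).aestronglyMeasurable) (hb.abs_mBDTD_le h₀ aStar a)
    have e1 : ∫ x, φ x ∂P n = ∫ x, mBDTD aStar a (trueNuisance P₀) x ∂P n - θ := by
      simp only [hφ, phiBDTD]
      rw [integral_sub hm (integrable_const _)]
      simp
    have e2 : (√(n : ℝ))⁻¹ * (n * (∫ x, φ x ∂P n)) = √(n : ℝ) * ∫ x, φ x ∂P n := by
      rw [← mul_assoc]
      congr 1
      rw [inv_mul_eq_div, Real.div_sqrt]
    simp only [hW, hT]
    rw [(hn.ace_eq aStar a).2, Finset.sum_sub_distrib, mul_sub (√(n : ℝ))⁻¹,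
      Finset.sum_const, Finset.card_univ,
      Fintype.card_fin, nsmul_eq_mul, e2, e1]
    ring
  -- At n = 0 the estimating equation imposes nothing, so θ̂ may fail to be measurable; the index is
  -- shifted by one.
  refine (tendsto_add_atTop_iff_nat 1).1 ?_
  refine tendsto_integral_of_tendsto_charFun (S := fun n => Sample (Obs 𝒜 𝒵 𝒞) (n + 1) (k (n + 1)))
    (μ := fun n => sampleLaw (P (n + 1)) (n + 1) (k (n + 1))) (W := fun n => W (n + 1))
    (fun n => hWm _ n.succ_pos) (fun t => ?_) f
  exact (tendsto_integral_cexp_of_isLittleOP (Eventually.of_forall hTm)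
    ((eventually_gt_atTop 0).mono hWm) hWT
    (hLA.tendsto_charFun_sum hφm hφb hlin.mean_zero k t)).comp (tendsto_add_atTop_nat 1)

end Regularity

/-! ### The main theorem. -/

theorem mainTheorem6 {𝒜 𝒵 𝒞 : Type*} [Countable 𝒜] [Countable 𝒵] [Countable 𝒞]
    [MeasurableSpace 𝒜] [MeasurableSpace 𝒵] [MeasurableSpace 𝒞]
    [MeasurableSingletonClass 𝒜] [MeasurableSingletonClass 𝒵] [MeasurableSingletonClass 𝒞]
    (M : CausalModel 𝒜 𝒵 𝒞) (hM : M.IsBDTD) (aStar a : 𝒜) (k : ℕ → ℕ)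
    (ηhat : ∀ n, Sample (Obs 𝒜 𝒵 𝒞) n (k n) → Nuisance 𝒜 𝒵 𝒞)
    (θhat : ∀ n, Sample (Obs 𝒜 𝒵 𝒞) n (k n) → ℝ)
    (hθ : SolvesEstimatingEquation aStar a k ηhat θhat) :
    (∀ {E : Type*} [NormedAddCommGroup E] [NormedSpace ℝ E] (ν : E → Nuisance 𝒜 𝒵 𝒞)
        (βhat : ∀ n, Sample (Obs 𝒜 𝒵 𝒞) n (k n) → E) (βbar : E),
      ConsistencyConditions M.obsLaw aStar a k ηhat ν βhat βbar →
      ((ν βbar).outcome = (trueNuisance M.obsLaw).outcome ∧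
          (ν βbar).treatment = (trueNuisance M.obsLaw).treatment ∨
        (ν βbar).outcome = (trueNuisance M.obsLaw).outcome ∧
          (ν βbar).mediator = (trueNuisance M.obsLaw).mediator ∨
        (ν βbar).mediator = (trueNuisance M.obsLaw).mediator ∧
          (ν βbar).treatment = (trueNuisance M.obsLaw).treatment) →
      IsLittleOP (fun n => sampleLaw M.obsLaw n (k n))
        fun n w => ‖θhat n w - M.ace aStar a‖ₑ) ∧
    (IsNuisanceEstimator k ηhat →
      MemLp M.Y 2 M.prob →
      (∃ K : ℕ, ∀ n, k n ≤ K * (n + 1)) →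
      AsymptoticNormalityConditions M.obsLaw aStar a k ηhat →
      BoundednessConditions M.obsLaw aStar a k ηhat →
      ProductRateConditions M.obsLaw aStar a k ηhat →
      IsAsymptoticallyLinear M.obsLaw (M.ace aStar a)
          (phiBDTD aStar a (trueNuisance M.obsLaw) (M.ace aStar a)) k θhat ∧
        IsRegularEstimator M aStar a k θhat) := by
  refine ⟨fun ν βhat βbar h hη => hM.consistent hθ h hη, ?_⟩
  rintro hη hY ⟨N, hk⟩ hA hB hR
  have hP := hM.isBDTDLaw
  obtain ⟨x⟩ := hP.nonempty
  obtain ⟨ε₂, h2, hε₂⟩ := hB.mediator_pos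
  obtain ⟨ε₅, h5, hε₅⟩ := hB.treatment_pos
  -- Probabilities bounded away from 0 that sum to 1 leave room for finitely many values only.
  have : Finite 𝒵 := finite_of_hasSum_of_le (hP.hasSum_mediator x.2.1 x.1) h2 fun z =>
    (hP.forall_of_ae (p := fun c b z => ε₂ < (trueNuisance M.obsLaw).mediator z b c) hε₂ _ _ z).le
  have : Finite 𝒜 := finite_of_hasSum_of_le (hP.hasSum_treatment x.1) h5 fun b =>
    (hP.forall_of_ae (p := fun c b _ => ε₅ < (trueNuisance M.obsLaw).treatment b c) hε₅ x.1 b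
      x.2.2.1).le
  have := Fintype.ofFinite 𝒜
  have := Fintype.ofFinite 𝒵
  have hlin := hM.isAsymptoticallyLinear hθ hη hY hA hB hR
  obtain ⟨ε, q, hb⟩ := hB.isBoundedLaw hP
  exact ⟨hlin, hM.isRegularEstimator hθ hη hY hk hb hlin⟩
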